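/- **Theorem (Equivariant Eilenberg spectral sequence).** Let $G$ be a discrete group, $R$ a commutative ring and $X$ a $G$-space such that, for every subgroup $H\le G$, every path component of the fixed point space $X^H$ has a universal cover (a simply connected covering space). Let $\Pi=\Pi_G X$ be the fundamental EI-category: its objects are pairs $(H,x)$ with $H\le G$ a subgroup and $x\in X^H$; a morphism $(H,x)\to(K,y)$ is a pair $(\alpha,[\gamma])$ of a $G$-map $\alpha\colon G/H\to G/K$, with $\alpha(eH)=gK$, and a homotopy class rel endpoints of paths $\gamma$ in $X^H$ from $x$ to $\alpha^*(y)=gy$; the composite of $(\alpha,[\gamma])$ followed by $(\beta,[\delta])$ is $(\beta\alpha,[\gamma\text{ followed by }\alpha^*\delta])$. Let $\tilde X\colon\Pi^{op}\to\mathrm{Top}$ be the equivariant universal cover: $\tilde X(H,x)$ is the space of homotopy classes rel endpoints of paths in $X^H$ starting at $x$ (a quotient of the path space), and $(\alpha,[\gamma])$ acts by $[\beta]\mapsto[\gamma\text{ followed by }\alpha^*\beta]$. Let $C_*(\tilde X)\colon\Pi^{op}\to\mathrm{Ch}_R$ be the normalized singular chains of $\tilde X$ with coefficients in $R$, and let $\mathcal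 H_q(\tilde X)\colon\Pi^{op}\to R\text{-mod}$ be their (levelwise) homology. Write $\otimes_\Pi$ and $\mathrm{Hom}_\Pi$ for the tensor product (coend) and the module of natural transformations of functors to $R$-modules. For functors $\mathcal M\colon\Pi\to R\text{-mod}$ and $\mathcal N\colon\Pi^{op}\to R\text{-mod}$ put $$H^G_n(X;\mathcal M)=H_n(C_*(\tilde X)\otimes_\Pi\mathcal M),\qquad H_G^n(X;\mathcal N)=H^n(\mathrm{Hom}_\Pi(C_*(\tilde X),\mathcal N)).$$ Let $\mathrm{Tor}^\Pi_{p,q}(\mathcal H_*(\tilde X),\mathcal M)$ be the $p$-th homology of $\mathcal H_q(\tilde X)\otimes_\Pi\mathcal P_*$ for a projective resolution $\mathcal P_*\to\mathcal M$, and $\mathrm{Ext}_\Pi^{p,q}(\mathcal H_*(\tilde X),\mathcal N)$ the $p$-th cohomology of $\mathrm{Hom}_\Pi(\mathcal H_q(\tilde X),\mathcal I^*)$ for an injective resolution $\mathcal N\to\mathcal I^*$. 1. For every $\mathcal M\colon\Pi\to R\text{-mod}$ and every projective resolution $\mathcal P_*\to\mathcal M$, the spectral sequence of the total complex of the bicomplex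 $C_*(\tilde X)\otimes_\Pi\mathcal P_*$, filtered by the degree of $\mathcal P_*$, is a first quadrant homological spectral sequence (with $d^r$ of bidegree $(-r,r-1)$) with $$E^2_{p,q}\cong\mathrm{Tor}^\Pi_{p,q}(\mathcal H_*(\tilde X),\mathcal M)\Longrightarrow H^G_{p+q}(X;\mathcal M).$$ The spectral sequence of the same total complex filtered by the degree of $C_*(\tilde X)$ has the same target, and its $E^2$-term is $H^G_p(X;\mathcal M)$ for $q=0$ and $0$ for $q\neq0$. 2. For every $\mathcal N\colon\Pi^{op}\to R\text{-mod}$ and every injective resolution $\mathcal N\to\mathcal I^*$, the spectral sequence of the total complex of the bicomplex $\mathrm{Hom}_\Pi(C_*(\tilde X),\mathcal I^*)$, filtered by the degree of $\mathcal I^*$, is a first quadrant cohomological spectral sequence (with $d_r$ of bidegree $(r,1-r)$) with $$E_2^{p,q}\cong\mathrm{Ext}_\Pi^{p,q}(\mathcal H_*(\tilde X),\mathcal N)\Longrightarrow H_G^{p+q}(X;\mathcal N).$$ The spectral sequence of the same total complex filtered by the degree of $C_*(\tilde X)$ has the same target, and its $E_2$-term is $H_G^p(X;\mathcal N)$ for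 $q=0$ and $0$ for $q\neq0$. Here convergence means that the target in degree $n=p+q$ is isomorphic to the (co)homology of the total complex and carries the finite filtration induced by that of the total complex, and that $E^\infty_{p,q}$ (which is $E^r_{p,q}$ for $r\ge p+q+2$) is the corresponding filtration quotient; likewise in cohomology. -/

import Mathlib

open CategoryTheory Limits Opposite unitInterval
universe u

section
variable {A B D : Type u} [TopologicalSpace A] [TopologicalSpace B] [TopologicalSpace D]

/-- Paths in `A` with initial point `a`, with the compact-open topology. -/
def PathsFrom (a : A) : Type u := {γ : C(I, A) // γ 0 = a}

instance (a : A) : TopologicalSpace (PathsFrom a) :=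
  inferInstanceAs (TopologicalSpace {γ : C(I, A) // γ 0 = a})

/-- Homotopy relative to the endpoints of paths starting at `a`. -/
instance pathsFromSetoid (a : A) : Setoid (PathsFrom a) where
  r γ δ := γ.1.HomotopicRel δ.1 {0, 1}
  iseqv := ⟨fun γ => .refl γ.1, fun h => h.symm, fun h k => h.trans k⟩

/-- The space of homotopy classes rel endpoints of paths in `A` starting at `a`, with the quotient
topology: the universal cover of (the path component of `a` in) `A`. -/
def UnivCover (a : A) : Type u := Quotient (pathsFromSetoid a)

instance (a : A) : TopologicalSpace (UnivCover a) :=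
  inferInstanceAs (TopologicalSpace (Quotient (pathsFromSetoid a)))

namespace PathsFrom

/-- A path starting at `a`, as a Mathlib path between two points. -/
def toPath {a : A} (γ : PathsFrom a) {z : A} (h : γ.1 1 = z) : Path a z where
  toContinuousMap := γ.1
  source' := γ.2
  target' := h

/-- A path between two points, as a path with prescribed initial point. -/
def ofPath {a z : A} (p : Path a z) : PathsFrom a := ⟨p.toContinuousMap, p.source⟩

end PathsFrom

namespace UnivCover

/-- The class of a path. -/
def mk {a z : A} (p : Path a z) : UnivCover a := Quotient.mk _ (PathsFrom.ofPath p)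

/-- The endpoint of a class of paths; this is the covering projection. -/
def endpoint {a : A} (c : UnivCover a) : A :=
  Quotient.lift (fun γ : PathsFrom a => γ.1 1) (fun _ _ (h : ContinuousMap.HomotopicRel _ _ _) => h.fst_eq_snd (by simp)) c

@[simp] lemma endpoint_mk {a z : A} (p : Path a z) : (mk p).endpoint = z := p.target

lemma exists_mk {a : A} (c : UnivCover a) {z : A} (h : c.endpoint = z) :
    ∃ p : Path a z, mk p = c := by
  induction c using Quotient.inductionOn with
  | h γ => exact ⟨γ.toPath h, rfl⟩

lemma exists_mk' {a : A} (c : UnivCover a) : ∃ (z : A) (p : Path a z), mk p = c :=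
  ⟨_, c.exists_mk rfl⟩

lemma mk_eq_of_homotopic {a z : A} {p q : Path a z} (h : p.Homotopic q) : mk p = mk q :=
  Quotient.sound h

lemma mk_eq_iff {a z : A} {p q : Path a z} : mk p = mk q ↔ p.Homotopic q :=
  ⟨fun h => Quotient.exact h, mk_eq_of_homotopic⟩

lemma mk_eq_of_apply {a z z' : A} {p : Path a z} {q : Path a z'} (h : ∀ t, p t = q t) :
    mk p = mk q := by
  have : PathsFrom.ofPath p = PathsFrom.ofPath q := Subtype.ext (ContinuousMap.ext h)
  exact congrArg (Quotient.mk _) this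

/-- A continuous map `f` with `f a = b` induces a map on classes of paths. -/
def map (f : C(A, B)) {a : A} {b : B} (h : f a = b) : UnivCover a → UnivCover b :=
  Quotient.map (fun γ : PathsFrom a => ⟨f.comp γ.1, by simp [γ.2, h]⟩)
    (fun _ _ k => k.comp_continuousMap f)

lemma continuous_map (f : C(A, B)) {a : A} {b : B} (h : f a = b) : Continuous (map f h) :=
  Continuous.quotient_map' (Continuous.subtype_mk
    ((ContinuousMap.continuous_postcomp f).comp continuous_subtype_val) _) _

lemma map_mk (f : C(A, B)) {a z : A} {b : B} (h : f a = b) (p : Path a z) :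
    map f h (mk p) = mk ((p.map f.continuous).cast h.symm rfl) := rfl

@[simp] lemma endpoint_map (f : C(A, B)) {a : A} {b : B} (h : f a = b) (c : UnivCover a) :
    (map f h c).endpoint = f c.endpoint := by
  obtain ⟨_, p, rfl⟩ := c.exists_mk'
  simp [map_mk]

/-- Concatenation: first a class `c` of paths from `a` to `z`, then a class of paths starting
at `z`. -/
noncomputable def trans {a z : A} (c : UnivCover a) (h : c.endpoint = z) :
    UnivCover z → UnivCover a :=
  Quotient.map (fun δ : PathsFrom z =>
      PathsFrom.ofPath (((c.exists_mk h).choose).trans (δ.toPath rfl)))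
    (fun δ δ' (k : δ.1.HomotopicRel δ'.1 {0, 1}) => by
      have e : δ'.1 1 = δ.1 1 := (k.fst_eq_snd (by simp)).symm
      have k' : (δ.toPath rfl).Homotopic (δ'.toPath e) := k
      exact Path.Homotopic.hcomp (Path.Homotopic.refl (c.exists_mk h).choose) k')

lemma trans_mk {a z w : A} (p : Path a z) (h : (mk p).endpoint = z) (q : Path z w) :
    trans (mk p) h (mk q) = mk (p.trans q) := by
  have e := ((mk p).exists_mk h).choose_spec
  have e' := mk_eq_iff.1 e
  have : mk (((mk p).exists_mk h).choose.trans q) = mk (p.trans q) :=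
    mk_eq_of_homotopic (e'.hcomp (.refl q))
  rw [← this]
  have hq : q = (PathsFrom.ofPath q).toPath q.target := rfl
  refine mk_eq_of_apply (p := Path.trans _ ((PathsFrom.ofPath q).toPath rfl)) fun t => ?_
  simp only [Path.trans_apply]
  rfl

lemma continuous_trans {a z : A} (c : UnivCover a) (h : c.endpoint = z) :
    Continuous (trans c h) := by
  refine Continuous.quotient_map' (Continuous.subtype_mk
    (ContinuousMap.continuous_of_continuous_uncurry _ ?_) _) _
  exact Path.trans_continuous_family (a := fun _ : PathsFrom z => a) (b := fun _ => z)
    (c := fun δ => δ.1 1) (fun _ => (c.exists_mk h).choose)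
    (by exact (c.exists_mk h).choose.continuous.comp continuous_snd)
    (fun δ => δ.toPath rfl)
    (by
      have : Continuous fun x : PathsFrom z × I => x.1.1 x.2 := by
        have h1 : Continuous fun x : PathsFrom z × I => (x.1.1 : C(I, A)) :=
          continuous_subtype_val.comp continuous_fst
        exact h1.eval continuous_snd
      exact this)

@[simp] lemma endpoint_trans {a z : A} (c : UnivCover a) (h : c.endpoint = z) (d : UnivCover z) :
    (trans c h d).endpoint = d.endpoint := by
  obtain ⟨p, rfl⟩ := c.exists_mk h
  obtain ⟨_, q, rfl⟩ := d.exists_mk'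
  rw [trans_mk]
  simp

lemma trans_assoc {a z w : A} (c : UnivCover a) (h : c.endpoint = z) (d : UnivCover z)
    (k : d.endpoint = w) (e : UnivCover w) (l : (trans c h d).endpoint = w) :
    trans (trans c h d) l e = trans c h (trans d k e) := by
  obtain ⟨p, rfl⟩ := c.exists_mk h
  obtain ⟨q, rfl⟩ := d.exists_mk k
  obtain ⟨_, r, rfl⟩ := e.exists_mk'
  have l' : (mk (p.trans q)).endpoint = w := by simp
  have : trans (trans (mk p) h (mk q)) l (mk r) = trans (mk (p.trans q)) l' (mk r) := by
    congr 1
    exact trans_mk p h q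
  rw [this, trans_mk, trans_mk, trans_mk]
  exact mk_eq_of_homotopic ⟨Path.Homotopy.transAssoc p q r⟩

lemma map_trans (f : C(A, B)) {a z : A} {b y : B} (hb : f a = b) (hy : f z = y)
    (c : UnivCover a) (h : c.endpoint = z) (k : (map f hb c).endpoint = y) (d : UnivCover z) :
    map f hb (trans c h d) = trans (map f hb c) k (map f hy d) := by
  subst hb hy
  obtain ⟨p, rfl⟩ := c.exists_mk h
  obtain ⟨_, q, rfl⟩ := d.exists_mk'
  rw [trans_mk, map_mk]
  refine Eq.trans ?_ (trans_mk (p.map f.continuous) k (q.map f.continuous)).symm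
  refine mk_eq_of_apply fun t => ?_
  simp

lemma map_map (f : C(A, B)) (g : C(B, D)) (k : C(A, D)) {a : A} {b : B} {d : D} (hb : f a = b)
    (hd : g b = d) (hk : k a = d) (e : ∀ x, k x = g (f x)) (c : UnivCover a) :
    map g hd (map f hb c) = map k hk c := by
  obtain ⟨_, p, rfl⟩ := c.exists_mk'
  subst hb
  rw [map_mk, map_mk, map_mk]
  refine mk_eq_of_apply fun t => ?_
  simp [e]

lemma map_id (f : C(A, A)) {a : A} (hb : f a = a) (e : ∀ x, f x = x) (c : UnivCover a) :
    map f hb c = c := by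
  obtain ⟨_, p, rfl⟩ := c.exists_mk'
  rw [map_mk]
  refine mk_eq_of_apply fun t => ?_
  simp [e]

lemma refl_trans {a : A} (h : (mk (Path.refl a)).endpoint = a) (d : UnivCover a) :
    trans (mk (Path.refl a)) h d = d := by
  obtain ⟨_, q, rfl⟩ := d.exists_mk'
  rw [trans_mk]
  exact mk_eq_of_homotopic ⟨Path.Homotopy.reflTrans q⟩

lemma trans_refl {a z : A} (c : UnivCover a) (h : c.endpoint = z) :
    trans c h (mk (Path.refl z)) = c := by
  obtain ⟨p, rfl⟩ := c.exists_mk h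
  rw [trans_mk]
  exact mk_eq_of_homotopic ⟨Path.Homotopy.transRefl p⟩

end UnivCover

/-- `A` has a universal cover: a covering space which is simply connected. -/
def HasUnivCover (A : Type u) [TopologicalSpace A] : Prop :=
  ∃ (E : Type u) (_ : TopologicalSpace E) (p : E → A), SimplyConnectedSpace E ∧ IsCoveringMap p

end

section
variable (G X : Type u) [Group G] [MulAction G X]

/-- Objects of the fundamental category of the `G`-space `X`: pairs `(H, x)` with `x ∈ X^H`. -/
structure FundCat where
  /-- the subgroup `H` -/
  sub : Subgroup G
  /-- the point `x` of `X^H` -/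
  pt : MulAction.fixedPoints sub X

variable {G X}

/-- For `y ∈ X^K`, the map `G/K → X` given by `gK ↦ g y`. -/
def cosetEval {K : Subgroup G} (y : MulAction.fixedPoints K X) : G ⧸ K → X :=
  fun c => Quotient.liftOn' c (fun g => g • (y : X)) (fun g g' h => by
    have h' := y.2 ⟨g⁻¹ * g', QuotientGroup.leftRel_apply.1 h⟩
    rw [Subgroup.smul_def, mul_smul] at h'
    exact (eq_inv_smul_iff.1 h'.symm).symm ▸ rfl)

@[simp] lemma cosetEval_mk {K : Subgroup G} (y : MulAction.fixedPoints K X) (g : G) :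
    cosetEval y (g : G ⧸ K) = g • (y : X) := rfl

lemma cosetEval_smul {K : Subgroup G} (y : MulAction.fixedPoints K X) (g : G) (c : G ⧸ K) :
    cosetEval y (g • c) = g • cosetEval y c := by
  induction c using QuotientGroup.induction_on with
  | H k => exact mul_smul g k (y : X)

variable [TopologicalSpace X] [ContinuousConstSMul G X]

/-- The map `α^* : X^K → X^H` induced by a `G`-map `α : G/H → G/K`: it sends `z` to `g z`
if `α (eH) = gK`. -/
def fixedPull {H K : Subgroup G} (α : (G ⧸ H) →[G] (G ⧸ K)) :
    C(MulAction.fixedPoints K X, MulAction.fixedPoints H X) where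
  toFun z := ⟨cosetEval z (α ((1 : G) : G ⧸ H)), fun h => by
    rw [Subgroup.smul_def, ← cosetEval_smul, ← map_smul]
    congr 2
    exact QuotientGroup.eq.2 (by simp)⟩
  continuous_toFun := by
    refine Continuous.subtype_mk ?_ _
    induction α ((1 : G) : G ⧸ H) using QuotientGroup.induction_on with
    | H g => exact (continuous_const_smul g).comp continuous_subtype_val

lemma fixedPull_id {H : Subgroup G} (z : MulAction.fixedPoints H X) :
    fixedPull (MulActionHom.id G) z = z :=
  Subtype.ext (one_smul G (z : X))

lemma fixedPull_apply {H K : Subgroup G} (α : (G ⧸ H) →[G] (G ⧸ K)) (g : G)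
    (h : α ((1 : G) : G ⧸ H) = (g : G ⧸ K)) (z : MulAction.fixedPoints K X) :
    (fixedPull α z : X) = g • (z : X) := by
  change cosetEval z (α ((1 : G) : G ⧸ H)) = _
  rw [h, cosetEval_mk]

lemma fixedPull_comp {H K L : Subgroup G} (α : (G ⧸ H) →[G] (G ⧸ K)) (β : (G ⧸ K) →[G] (G ⧸ L))
    (z : MulAction.fixedPoints L X) :
    fixedPull (β.comp α) z = fixedPull α (fixedPull β z) := by
  obtain ⟨g, hg⟩ := QuotientGroup.mk_surjective (α ((1 : G) : G ⧸ H))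
  obtain ⟨k, hk⟩ := QuotientGroup.mk_surjective (β ((1 : G) : G ⧸ K))
  apply Subtype.ext
  rw [fixedPull_apply α g hg.symm, fixedPull_apply β k hk.symm,
    fixedPull_apply _ (g * k), mul_smul]
  change β (α _) = _
  have e : (g : G ⧸ K) = g • ((1 : G) : G ⧸ K) := by
    simp
  rw [← hg, e, map_smul, ← hk]
  rfl

namespace FundCat

/-- A morphism `(H, x) → (K, y)`: a `G`-map `α : G/H → G/K` and a homotopy class rel endpoints of
paths in `X^H` from `x` to `α^* y`. -/
@[ext] structure Hom (a b : FundCat G X) where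
  /-- the `G`-map `α : G/H → G/K` -/
  map : (G ⧸ a.sub) →[G] (G ⧸ b.sub)
  /-- the class of paths in `X^H` starting at `x` -/
  path : UnivCover a.pt
  /-- the paths in the class end at `α^* y` -/
  endpoint_path : path.endpoint = fixedPull map b.pt

/-- The map of universal covers induced by a morphism `(α, γ)`: it sends the class of a path `β`
to the class of the concatenation of `γ` and `α^* β`. -/
noncomputable def Hom.act {a b : FundCat G X} (f : Hom a b) : UnivCover b.pt → UnivCover a.pt :=
  fun c => UnivCover.trans f.path f.endpoint_path (UnivCover.map (fixedPull f.map) rfl c)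

lemma Hom.continuous_act {a b : FundCat G X} (f : Hom a b) : Continuous f.act :=
  (UnivCover.continuous_trans _ _).comp (UnivCover.continuous_map _ _)

/-- The identity `(id, constant path)`. -/
noncomputable def Hom.id (a : FundCat G X) : Hom a a where
  map := MulActionHom.id G
  path := .mk (Path.refl a.pt)
  endpoint_path := by rw [UnivCover.endpoint_mk, fixedPull_id]

/-- The composition of `(α, γ)` and `(β, δ)` is `(β ∘ α, γ` followed by `α^* δ)`. -/
noncomputable def Hom.comp {a b c : FundCat G X} (f : Hom a b) (g : Hom b c) : Hom a c where
  map := g.map.comp f.map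
  path := f.act g.path
  endpoint_path := by
    rw [Hom.act, UnivCover.endpoint_trans, UnivCover.endpoint_map, g.endpoint_path, fixedPull_comp]

lemma Hom.act_id (a : FundCat G X) (d : UnivCover a.pt) : (Hom.id a).act d = d := by
  have h : (UnivCover.mk (Path.refl a.pt)).endpoint = a.pt := UnivCover.endpoint_mk _
  have key : ∀ (y : MulAction.fixedPoints a.sub X) (hy : y = a.pt)
      (h1 : (UnivCover.mk (Path.refl a.pt)).endpoint = y)
      (h2 : fixedPull (MulActionHom.id G) a.pt = y),
      UnivCover.trans (.mk (Path.refl a.pt)) h1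
        (UnivCover.map (fixedPull (MulActionHom.id G)) h2 d) = d := by
    rintro y rfl h1 h2
    rw [UnivCover.refl_trans, UnivCover.map_id _ _ fixedPull_id]
  exact key _ (fixedPull_id _) _ rfl

lemma Hom.act_comp {a b c : FundCat G X} (f : Hom a b) (g : Hom b c) (d : UnivCover c.pt) :
    (f.comp g).act d = f.act (g.act d) := by
  have key : ∀ (y : MulAction.fixedPoints a.sub X)
      (hy : fixedPull f.map (fixedPull g.map c.pt) = y)
      (h1 : (f.act g.path).endpoint = y)
      (h2 : fixedPull (g.map.comp f.map) c.pt = y),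
      UnivCover.trans (f.act g.path) h1
        (UnivCover.map (fixedPull (g.map.comp f.map)) h2 d) = f.act (g.act d) := by
    intro y hy h1 h2
    have h3 : (UnivCover.map (fixedPull f.map) rfl g.path).endpoint = y := by
      rw [UnivCover.endpoint_map, g.endpoint_path, hy]
    refine (UnivCover.trans_assoc f.path f.endpoint_path
      (UnivCover.map (fixedPull f.map) rfl g.path) h3 _ h1).trans ?_
    unfold Hom.act
    congr 1
    rw [UnivCover.map_trans (fixedPull f.map) rfl hy g.path g.endpoint_path h3,
      UnivCover.map_map _ _ _ _ _ h2 (fixedPull_comp _ _)]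
  exact key _ (fixedPull_comp _ _ _).symm _ rfl

noncomputable instance : Category.{u} (FundCat G X) where
  Hom := Hom
  id := Hom.id
  comp := Hom.comp
  id_comp f := Hom.ext rfl (Hom.act_id _ _)
  comp_id {a b} f := by
    refine Hom.ext rfl ?_
    change UnivCover.trans f.path f.endpoint_path
      (UnivCover.map (fixedPull f.map) rfl (.mk (Path.refl b.pt))) = f.path
    exact UnivCover.trans_refl _ _
  assoc f g h := Hom.ext rfl (Hom.act_comp f g h.path)

end FundCat

variable (G X)

/-- The equivariant universal cover, sending `(H, x)` to the universal cover of `X^H` at `x`. -/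
noncomputable def eqUnivCover : (FundCat G X)ᵒᵖ ⥤ TopCat.{u} where
  obj a := TopCat.of (UnivCover a.unop.pt)
  map f := TopCat.ofHom ⟨FundCat.Hom.act f.unop, FundCat.Hom.continuous_act f.unop⟩
  map_id a := by ext d; exact FundCat.Hom.act_id _ d
  map_comp f g := by ext d; exact FundCat.Hom.act_comp g.unop f.unop d

end

section
variable (C : Type u) [SmallCategory C] (R : Type u) [CommRing R]

instance enoughProjectivesFunctorModule : EnoughProjectives (C ⥤ ModuleCat.{u} R) where
  presentation F := by
    let P : C → (C ⥤ ModuleCat.{u} R) := fun c =>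
      (evaluationLeftAdjoint (ModuleCat.{u} R) c).obj (Projective.over (F.obj c))
    let φ : ∀ c, P c ⟶ F := fun c =>
      ((evaluationAdjunctionRight (ModuleCat.{u} R) c).homEquiv _ _).symm (Projective.π (F.obj c))
    have hφ : ∀ c, Epi ((φ c).app c) := fun c => by
      have h := ((evaluationAdjunctionRight (ModuleCat.{u} R) c).homEquiv _ _).apply_symm_apply
        (Projective.π (F.obj c))
      rw [Adjunction.homEquiv_unit] at h
      have : Epi ((evaluationAdjunctionRight (ModuleCat.{u} R) c).unit.app
        (Projective.over (F.obj c)) ≫ ((evaluation C (ModuleCat.{u} R)).obj c).map (φ c)) := by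
        rw [h]; exact Projective.π_epi _
      exact epi_of_epi ((evaluationAdjunctionRight (ModuleCat.{u} R) c).unit.app
        (Projective.over (F.obj c))) (((evaluation C (ModuleCat.{u} R)).obj c).map (φ c))
    have hP : ∀ c, Projective (P c) := fun c =>
      (evaluationAdjunctionRight (ModuleCat.{u} R) c).map_projective _ inferInstance
    suffices h : Epi (Sigma.desc φ) from 
      ⟨{ p := ∐ P, f := Sigma.desc φ, projective := inferInstance, epi := h }⟩
    refine (NatTrans.epi_iff_epi_app (Sigma.desc φ)).2 ?_
    intro c
    have h : (Sigma.ι P c).app c ≫ (Sigma.desc φ).app c = (φ c).app c := by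
      rw [← NatTrans.comp_app, Sigma.ι_desc]
    have := hφ c
    rw [← h] at this
    exact epi_of_epi ((Sigma.ι P c).app c) _

instance enoughInjectivesFunctorModule : EnoughInjectives (C ⥤ ModuleCat.{u} R) where
  presentation F := by
    let J : C → (C ⥤ ModuleCat.{u} R) := fun c =>
      (evaluationRightAdjoint (ModuleCat.{u} R) c).obj (Injective.under (F.obj c))
    let φ : ∀ c, F ⟶ J c := fun c =>
      ((evaluationAdjunctionLeft (ModuleCat.{u} R) c).homEquiv _ _) (Injective.ι (F.obj c))
    have hφ : ∀ c, Mono ((φ c).app c) := fun c => by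
      have h := ((evaluationAdjunctionLeft (ModuleCat.{u} R) c).homEquiv _ _).symm_apply_apply
        (Injective.ι (F.obj c))
      rw [Adjunction.homEquiv_counit] at h
      have : Mono (((evaluation C (ModuleCat.{u} R)).obj c).map (φ c) ≫
        (evaluationAdjunctionLeft (ModuleCat.{u} R) c).counit.app
        (Injective.under (F.obj c))) := by
        rw [h]; exact Injective.ι_mono _
      exact mono_of_mono (((evaluation C (ModuleCat.{u} R)).obj c).map (φ c))
        ((evaluationAdjunctionLeft (ModuleCat.{u} R) c).counit.app (Injective.under (F.obj c)))
    have hJ : ∀ c, Injective (J c) := fun c =>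
      (evaluationAdjunctionLeft (ModuleCat.{u} R) c).map_injective _ inferInstance
    suffices h : Mono (Pi.lift φ) from ⟨⟨∏ᶜ J, inferInstance, Pi.lift φ, h⟩⟩
    refine (NatTrans.mono_iff_mono_app (Pi.lift φ)).2 ?_
    intro c
    have h : (Pi.lift φ).app c ≫ (Pi.π J c).app c = (φ c).app c := by
      rw [← NatTrans.comp_app, Pi.lift_π]
    have := hφ c
    rw [← h] at this
    exact mono_of_mono _ ((Pi.π J c).app c)



variable {C}

/-- The tensor product over `C` of a contravariant functor `N` and a covariant functor `M`, as a
bifunctor: the coend of `(a, b) ↦ N a ⊗ M b`. -/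
noncomputable def functorTensor :
    (Cᵒᵖ ⥤ ModuleCat.{u} R) ⥤ (C ⥤ ModuleCat.{u} R) ⥤ ModuleCat.{u} R where
  obj N :=
    { obj M := coend (N ⋙ MonoidalCategory.curriedTensor (ModuleCat.{u} R) ⋙
        (Functor.whiskeringLeft C _ _).obj M)
      map g := coend.map (Functor.whiskerLeft N (Functor.whiskerLeft
        (MonoidalCategory.curriedTensor (ModuleCat.{u} R)) ((Functor.whiskeringLeft C _ _).map g)))
      map_id M := by apply coend.hom_ext; intro j; simp
      map_comp g h := by apply coend.hom_ext; intro j; simp }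
  map f :=
    { app M := coend.map (Functor.whiskerRight f
        (MonoidalCategory.curriedTensor (ModuleCat.{u} R) ⋙ (Functor.whiskeringLeft C _ _).obj M))
      naturality M M' g := by
        apply coend.hom_ext; intro j
        simp [MonoidalCategory.whisker_exchange_assoc] }
  map_id N := by
    apply NatTrans.ext; funext M; apply coend.hom_ext; intro j; simp
  map_comp f g := by
    apply NatTrans.ext; funext M; apply coend.hom_ext; intro j; simp

variable {R}

/-- The canonical map `N a ⊗ M a → N ⊗_C M`. -/
noncomputable def functorTensorι (N : Cᵒᵖ ⥤ ModuleCat.{u} R) (M : C ⥤ ModuleCat.{u} R) (a : C) :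
    MonoidalCategoryStruct.tensorObj (N.obj (op a)) (M.obj a) ⟶ ((functorTensor R).obj N).obj M :=
  coend.ι (N ⋙ MonoidalCategory.curriedTensor (ModuleCat.{u} R) ⋙
    (Functor.whiskeringLeft C _ _).obj M) a

lemma functorTensor_hom_ext {N : Cᵒᵖ ⥤ ModuleCat.{u} R} {M : C ⥤ ModuleCat.{u} R}
    {Z : ModuleCat.{u} R} {f g : ((functorTensor R).obj N).obj M ⟶ Z}
    (h : ∀ a, functorTensorι N M a ≫ f = functorTensorι N M a ≫ g) : f = g :=
  coend.hom_ext h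

lemma functorTensorι_map (N : Cᵒᵖ ⥤ ModuleCat.{u} R) {M M' : C ⥤ ModuleCat.{u} R} (g : M ⟶ M')
    (a : C) : functorTensorι N M a ≫ ((functorTensor R).obj N).map g =
      MonoidalCategoryStruct.whiskerLeft _ (g.app a) ≫ functorTensorι N M' a := by
  simp [functorTensor, functorTensorι]

lemma functorTensorι_map_app {N N' : Cᵒᵖ ⥤ ModuleCat.{u} R} (f : N ⟶ N')
    (M : C ⥤ ModuleCat.{u} R) (a : C) :
    functorTensorι N M a ≫ ((functorTensor R).map f).app M =
      MonoidalCategoryStruct.whiskerRight (f.app (op a)) _ ≫ functorTensorι N' M a := by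
  simp [functorTensor, functorTensorι]

variable (R)

instance functorTensor_obj_additive (N : Cᵒᵖ ⥤ ModuleCat.{u} R) :
    ((functorTensor R).obj N).Additive where
  map_add {M M' f g} := functorTensor_hom_ext fun a => by
    simp [functorTensorι_map, MonoidalPreadditive.whiskerLeft_add, Preadditive.comp_add,
      Preadditive.add_comp]

instance functorTensor_additive : (functorTensor (C := C) R).Additive where
  map_add {N N' f g} := by
    ext M : 2
    refine functorTensor_hom_ext fun a => ?_
    rw [NatTrans.app_add]
    simp [functorTensorι_map_app, MonoidalPreadditive.add_whiskerRight, Preadditive.comp_add,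
      Preadditive.add_comp]

instance functorTensor_flip_obj_additive (M : C ⥤ ModuleCat.{u} R) :
    ((functorTensor R).flip.obj M).Additive where
  map_add {N N' f g} := by
    change ((functorTensor R).map (f + g)).app M = _
    rw [(functorTensor R).map_add]; rfl

variable {R}

/-- `Tor_p^C(N, M)`: the `p`-th left derived functor of `N ⊗_C -`, that is, the homology of
`N ⊗_C P_*` for a projective resolution `P_*` of `M`. -/
noncomputable def torFunctor (N : Cᵒᵖ ⥤ ModuleCat.{u} R) (M : C ⥤ ModuleCat.{u} R) (p : ℕ) :
    ModuleCat.{u} R :=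
  (((functorTensor R).obj N).leftDerived p).obj M

/-- `Ext^p_C(N, N')`: the `p`-th right derived functor of `Hom_C(N, -)`, that is, the cohomology of
`Hom_C(N, I^*)` for an injective resolution `I^*` of `N'`. -/
noncomputable def extFunctor (N N' : C ⥤ ModuleCat.{u} R) (p : ℕ) : ModuleCat.{u} R :=
  (((linearCoyoneda R (C ⥤ ModuleCat.{u} R)).obj (op N)).rightDerived p).obj N'

/-- The usual sign `(-1)^p` in the total complex of a bicomplex of cochain complexes. -/
instance tensorSignsUpNat : (ComplexShape.up ℕ).TensorSigns where
  ε' := MonoidHom.mk' (fun (i : ℕ) => (-1 : ℤˣ) ^ i) (pow_add (-1 : ℤˣ))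
  rel_add p q r (hpq : p + 1 = q) := show p + r + 1 = q + r by lia
  add_rel p q r (hpq : p + 1 = q) := show r + p + 1 = r + q by lia
  ε'_succ p q (hpq : p + 1 = q) := by
    subst hpq
    exact (pow_succ (-1 : ℤˣ) p).trans (by rw [mul_neg, mul_one]; rfl)

end


section
variable (G X : Type u) [Group G] [MulAction G X] [TopologicalSpace X] [ContinuousConstSMul G X]
variable (R : Type u) [CommRing R]

/-- The normalized singular chains of the equivariant universal cover, as a functor from the
opposite of the fundamental category to chain complexes of `R`-modules. -/
noncomputable def eqChainFunctor : (FundCat G X)ᵒᵖ ⥤ ChainComplex (ModuleCat.{u} R) ℕ :=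
  eqUnivCover G X ⋙ TopCat.toSSet ⋙ SSet.normalizedChainComplexFunctorObj (ModuleCat.of R R)

/-- The same chains, as a chain complex of functors to `R`-modules. -/
noncomputable def eqChains : ChainComplex ((FundCat G X)ᵒᵖ ⥤ ModuleCat.{u} R) ℕ where
  X n := eqChainFunctor G X R ⋙ HomologicalComplex.eval _ _ n
  d i j :=
    { app a := ((eqChainFunctor G X R).obj a).d i j
      naturality _ _ f := (((eqChainFunctor G X R).map f).comm i j) }
  shape i j h := by ext a : 2; exact ((eqChainFunctor G X R).obj a).shape i j h
  d_comp_d' i j k _ _ := by ext a : 2; exact ((eqChainFunctor G X R).obj a).d_comp_d i j k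

/-- The functor `(H, x) ↦ H_q` of the chains of the universal cover of `X^H` at `x`. -/
noncomputable def eqCoverHomology (q : ℕ) : (FundCat G X)ᵒᵖ ⥤ ModuleCat.{u} R :=
  eqChainFunctor G X R ⋙ HomologicalComplex.homologyFunctor _ _ q

/-- The chains of the equivariant universal cover, as a cochain complex in the opposite category. -/
noncomputable def eqChainsOp : CochainComplex ((FundCat G X)ᵒᵖ ⥤ ModuleCat.{u} R)ᵒᵖ ℕ :=
  (eqChains G X R).op

variable {R}

/-- Equivariant homology with local coefficients in `M`: the homology of `C_*(X̃) ⊗_Π M`. -/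
noncomputable def eqHomology (M : FundCat G X ⥤ ModuleCat.{u} R) (n : ℕ) : ModuleCat.{u} R :=
  ((((functorTensor R).flip.obj M).mapHomologicalComplex _).obj (eqChains G X R)).homology n

/-- Equivariant cohomology with local coefficients in `N`: the cohomology of `Hom_Π(C_*(X̃), N)`. -/
noncomputable def eqCohomology (N : (FundCat G X)ᵒᵖ ⥤ ModuleCat.{u} R) (n : ℕ) :
    ModuleCat.{u} R :=
  ((((linearYoneda R ((FundCat G X)ᵒᵖ ⥤ ModuleCat.{u} R)).obj N).mapHomologicalComplex
    (ComplexShape.up ℕ)).obj (eqChainsOp G X R)).homology n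

/-- The total complex of the bicomplex `C_*(X̃) ⊗_Π P_*`. -/
noncomputable def eqTensorTotal (P : ChainComplex (FundCat G X ⥤ ModuleCat.{u} R) ℕ) :
    ChainComplex (ModuleCat.{u} R) ℕ :=
  HomologicalComplex.mapBifunctor (eqChains G X R) P (functorTensor R) (ComplexShape.down ℕ)

/-- The total complex of the bicomplex `Hom_Π(C_*(X̃), I^*)`. -/
noncomputable def eqHomTotal (J : CochainComplex ((FundCat G X)ᵒᵖ ⥤ ModuleCat.{u} R) ℕ) :
    CochainComplex (ModuleCat.{u} R) ℕ :=
  HomologicalComplex.mapBifunctor (eqChainsOp G X R) J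
    (linearCoyoneda R ((FundCat G X)ᵒᵖ ⥤ ModuleCat.{u} R)) (ComplexShape.up ℕ)

/-- The submodule of `Tot_n (C_*(X̃) ⊗_Π P_*)` spanned by the summands `C_i(X̃) ⊗_Π P_j` for which
`S i j` holds. -/
noncomputable def eqTensorTotalSpan (P : ChainComplex (FundCat G X ⥤ ModuleCat.{u} R) ℕ)
    (S : ℕ → ℕ → Prop) (n : ℕ) : Submodule R ((eqTensorTotal G X P).X n) :=
  ⨆ (i : ℕ) (j : ℕ) (h : i + j = n) (_ : S i j),
    LinearMap.range (HomologicalComplex.ιMapBifunctor (eqChains G X R) P (functorTensor R)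
      (ComplexShape.down ℕ) i j n h).hom

/-- The submodule of `Tot^n (Hom_Π(C_*(X̃), I^*))` spanned by the summands `Hom_Π(C_i(X̃), I^j)` for
which `S i j` holds. -/
noncomputable def eqHomTotalSpan (J : CochainComplex ((FundCat G X)ᵒᵖ ⥤ ModuleCat.{u} R) ℕ)
    (S : ℕ → ℕ → Prop) (n : ℕ) : Submodule R ((eqHomTotal G X J).X n) :=
  ⨆ (i : ℕ) (j : ℕ) (h : i + j = n) (_ : S i j),
    LinearMap.range (HomologicalComplex.ιMapBifunctor (eqChainsOp G X R) J
      (linearCoyoneda R ((FundCat G X)ᵒᵖ ⥤ ModuleCat.{u} R)) (ComplexShape.up ℕ) i j n h).hom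

end

section
variable {R : Type u} [CommRing R] {c : ComplexShape ℕ}

/-- `Z^r_k` in degree `n` for an increasing filtration `F` of a complex `K`: the elements of `F_k`
whose differential lies in `F_{k-r}`. -/
noncomputable def filtCycles (K : HomologicalComplex (ModuleCat.{u} R) c)
    (F : ℤ → ∀ n, Submodule R (K.X n)) (r k : ℤ) (n : ℕ) : Submodule R (K.X n) :=
  F k n ⊓ ⨅ m, (F (k - r) m).comap (K.d n m).hom

/-- `Z^{r-1}_{k-1} + d Z^{r-1}_{k+r-1}` in degree `n`, so that the term of the `r`-th page of the
spectral sequence of the filtered complex is `Z^r_k` modulo this submodule. -/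
noncomputable def filtBoundaries (K : HomologicalComplex (ModuleCat.{u} R) c)
    (F : ℤ → ∀ n, Submodule R (K.X n)) (r k : ℤ) (n : ℕ) : Submodule R (K.X n) :=
  filtCycles K F (r - 1) (k - 1) n ⊔
    ⨆ m, (filtCycles K F (r - 1) (k + r - 1) m).map (K.d m n).hom

/-- The filtration on homology induced by a filtration of a complex: classes which have a
representing cycle in `F_k`. -/
noncomputable def filtHomology (K : HomologicalComplex (ModuleCat.{u} R) c)
    (F : ℤ → ∀ n, Submodule R (K.X n)) (k : ℤ) (n : ℕ) : Submodule R (K.homology n) :=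
  ((F k n).comap (K.iCycles n).hom).map (K.homologyπ n).hom


/-- First quadrant spectral sequences of `R`-modules starting from the second page, whose
differential on the `r`-th page has bidegree `v r`. -/
abbrev QuadrantSS (R : Type u) [CommRing R] (v : ℤ → ℤ × ℤ) :=
  SpectralSequence (ModuleCat.{u} R) (fun r => ComplexShape.spectralSequenceNat (v r)) 2
end
section
variable {R : Type u} [CommRing R] {c : ComplexShape ℕ} {v : ℤ → ℤ × ℤ}

/-- The data exhibiting `E` as the spectral sequence of the complex `K` with the increasing
filtration `F`: the term in position `(p, q)` of the `r`-th page is identified with the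
subquotient `Z^r_k / (Z^{r-1}_{k-1} + d Z^{r-1}_{k+r-1})` of `K` in degree `p + q`, for `k = wt p`,
in such a way that the differentials are induced by that of `K` and that the identification of the
homology of a page with the next page is induced by the inclusion `Z^{r+1}_k ⊆ Z^r_k`. -/
structure IsFiltrationSS (E : QuadrantSS R v) (K : HomologicalComplex (ModuleCat.{u} R) c)
    (F : ℤ → ∀ n, Submodule R (K.X n)) (wt : ℕ → ℤ) where
  /-- the projection from `Z^r_k` to the term of the `r`-th page -/
  proj (r : ℤ) (hr : 2 ≤ r) (p q : ℕ) :
    filtCycles K F r (wt p) (p + q) →ₗ[R] (E.page r hr).X (p, q)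
  proj_surjective (r : ℤ) (hr : 2 ≤ r) (p q : ℕ) : Function.Surjective (proj r hr p q)
  proj_eq_zero_iff (r : ℤ) (hr : 2 ≤ r) (p q : ℕ) (x : filtCycles K F r (wt p) (p + q)) :
    proj r hr p q x = 0 ↔ (x : K.X (p + q)) ∈ filtBoundaries K F r (wt p) (p + q)
  d_proj (r : ℤ) (hr : 2 ≤ r) (p q p' q' : ℕ)
    (h : (ComplexShape.spectralSequenceNat (v r)).Rel (p, q) (p', q'))
    (x : filtCycles K F r (wt p) (p + q)) (y : filtCycles K F r (wt p') (p' + q'))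
    (hxy : (K.d (p + q) (p' + q')).hom (x : K.X (p + q)) = y) :
    ((E.page r hr).d (p, q) (p', q')).hom (proj r hr p q x) = proj r hr p' q' y
  iso_proj (r : ℤ) (hr : 2 ≤ r) (p q : ℕ) (x : filtCycles K F r (wt p) (p + q))
    (y : filtCycles K F (r + 1) (wt p) (p + q)) (hxy : (x : K.X (p + q)) = y)
    (z : (E.page r hr).cycles (p, q))
    (hz : ((E.page r hr).iCycles (p, q)).hom z = proj r hr p q x) :
    (E.iso r (r + 1) (p, q) rfl hr).hom.hom (((E.page r hr).homologyπ (p, q)).hom z) =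
      proj (r + 1) (by lia) p q y

/-- Convergence of a first quadrant spectral sequence `E` to a graded module `H` with an increasing
filtration `F`, where the `p`-th column corresponds to the filtration index `wt p`:
on `H n` the filtration is finite, with jumps only at the indices `wt p` for `p ≤ n`, and for `r`
large (`r ≥ p + q + 2`) the term `(p, q)` of the `r`-th page, which no longer depends on `r`, is
identified with `F_k / F_{k-1}` for the filtration of `H (p + q)` and `k = wt p`. -/
structure ConvergesTo (E : QuadrantSS R v) (H : ℕ → ModuleCat.{u} R)
    (F : ℤ → ∀ n, Submodule R (H n)) (wt : ℕ → ℤ) where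
  mono (k l : ℤ) (n : ℕ) (h : k ≤ l) : F k n ≤ F l n
  eq_bot (k : ℤ) (n : ℕ) (h : ∀ p ≤ n, k < wt p) : F k n = ⊥
  eq_top (k : ℤ) (n : ℕ) (h : ∀ p ≤ n, wt p ≤ k) : F k n = ⊤
  /-- the projection from `F_k` to the term of the `r`-th page -/
  proj (r : ℤ) (hr : 2 ≤ r) (p q : ℕ) (hpq : (p : ℤ) + q + 2 ≤ r) :
    F (wt p) (p + q) →ₗ[R] (E.page r hr).X (p, q)
  proj_surjective (r : ℤ) (hr : 2 ≤ r) (p q : ℕ) (hpq : (p : ℤ) + q + 2 ≤ r) :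
    Function.Surjective (proj r hr p q hpq)
  proj_eq_zero_iff (r : ℤ) (hr : 2 ≤ r) (p q : ℕ) (hpq : (p : ℤ) + q + 2 ≤ r)
    (x : F (wt p) (p + q)) :
    proj r hr p q hpq x = 0 ↔ (x : H (p + q)) ∈ F (wt p - 1) (p + q)
  iso_proj (r : ℤ) (hr : 2 ≤ r) (p q : ℕ) (hpq : (p : ℤ) + q + 2 ≤ r) (x : F (wt p) (p + q))
    (z : (E.page r hr).cycles (p, q))
    (hz : ((E.page r hr).iCycles (p, q)).hom z = proj r hr p q hpq x) :
    (E.iso r (r + 1) (p, q) rfl hr).hom.hom (((E.page r hr).homologyπ (p, q)).hom z) =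
      proj (r + 1) (by lia) p q (by lia) x

end

/-!
Both spectral sequences are those of the bicomplex `T (C_i, K_j)`, where `C` is the complex of
chains of the equivariant universal cover, `K` is the given resolution and `T` is the tensor product over
`Π` or the bifunctor `Hom_Π`.

The algebraic part is elementary. A filtration of a complex of modules, finite in each degree, has
a spectral sequence with pages `Z^r / B^r` (`IsBoundedFiltration.exists_isFiltrationSS`), which
converges to the homology (`IsFiltrationSS.convergesTo`). For the filtration of a total complex by
columns, the leading coefficient of an element of `Z^2` identifies the second page with the
horizontal homology of the vertical homology (`BicomplexCoordinates.nonempty_secondPage_iso`). If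
`T (-, K_j)` and `T (C_i, -)` are exact, this yields the homology of `T (H_q C, K)`, which is `Tor`
or `Ext`, for one filtration, and for the other one the homology of `T (C, H_q K)`, which is
concentrated in the row `q = 0`. The second spectral sequence therefore identifies the homology of
the total complex with that of `T (C, M)` (`exists_spectralSequences_mapBifunctor`).

Exactness of the `Hom` functors at projective and injective objects is immediate. For the tensor
product it follows by duality: maps from `N ⊗ M` to an injective module `I` are natural
transformations from `N` to the dual of `M` with values in `I`, so that `N ⊗ -` is exact for
projective `N` (`functorTensor_obj_preservesHomology`).

It remains to see that the functors `C_n` are projective (`projective_eqChains_X`), which is the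
only place where universal covers enter. A homotopy class of paths is determined by the endpoint of
its lift to a universal cover, so that maps from a connected space to the space of homotopy classes
are determined by their composite with the endpoint map and their value at one point
(`UnivCover.eq_of_endpoint_eq`). Hence a simplex `Δ → X̃ (H, x)` amounts to a simplex
`τ : Δ → X^H` together with a class of paths from `x` to `τ v₀`; that is, to a morphism from
`(H, x)` to `(K, τ₀ v₀)`, where `τ₀` is the representative of the `G`-orbit of `τ` and `K` is its
stabilizer. So the singular `n`-simplices are a coproduct of representable functors
(`existsUnique_act_comp_mapLift`), the singular chains are free, and the normalized chains are a
natural retract of them.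
-/

/-! ### Homology classes of elements -/

section
variable {R : Type u} [CommRing R] {ι : Type*} {c : ComplexShape ι}
  (K L : HomologicalComplex (ModuleCat.{u} R) c)

/-- The cycles of a complex of modules, as a submodule of the chains. -/
noncomputable def cycleSubmodule (i : ι) : Submodule R (K.X i) :=
  ⨅ j, LinearMap.ker (K.d i j).hom

variable {K} in
lemma mem_cycleSubmodule {i : ι} {x : K.X i} :
    x ∈ cycleSubmodule K i ↔ ∀ j, (K.d i j).hom x = 0 := by
  simp [cycleSubmodule]

variable {K} in
lemma mem_cycleSubmodule_of_rel {i : ι} {x : K.X i}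
    (h : ∀ j, c.Rel i j → (K.d i j).hom x = 0) : x ∈ cycleSubmodule K i := by
  refine mem_cycleSubmodule.2 fun j => ?_
  by_cases hj : c.Rel i j
  · exact h j hj
  · rw [K.shape i j hj]; rfl

lemma d_d_apply {i j k : ι} (x : K.X i) : (K.d j k).hom ((K.d i j).hom x) = 0 := by
  rw [← LinearMap.comp_apply, ← ModuleCat.hom_comp, K.d_comp_d]; rfl

/-- The map sending a cycle to its homology class. -/
noncomputable def homologyClass (i : ι) : cycleSubmodule K i →ₗ[R] K.homology i :=
  (K.liftCycles (ModuleCat.ofHom (cycleSubmodule K i).subtype) (c.next i) rfl (by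
    ext x; exact mem_cycleSubmodule.1 x.2 _) ≫ K.homologyπ i).hom

lemma iCycles_injective (i : ι) : Function.Injective (K.iCycles i).hom :=
  (ModuleCat.mono_iff_injective _).1 inferInstance

lemma iCycles_mem (i : ι) (z : K.cycles i) : (K.iCycles i).hom z ∈ cycleSubmodule K i := by
  refine mem_cycleSubmodule.2 fun j => ?_
  rw [← LinearMap.comp_apply, ← ModuleCat.hom_comp, K.iCycles_d]; rfl

lemma homologyπ_apply (i : ι) (z : K.cycles i) :
    (K.homologyπ i).hom z = homologyClass K i ⟨(K.iCycles i).hom z, iCycles_mem K i z⟩ := by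
  rw [homologyClass, ModuleCat.hom_comp, LinearMap.comp_apply]
  congr 1
  apply iCycles_injective K i
  rw [← LinearMap.comp_apply, ← ModuleCat.hom_comp, K.liftCycles_i]; rfl

lemma exists_cycles (i : ι) (x : cycleSubmodule K i) :
    ∃ z : K.cycles i, (K.iCycles i).hom z = x ∧ (K.homologyπ i).hom z = homologyClass K i x := by
  refine ⟨(K.liftCycles (ModuleCat.ofHom (cycleSubmodule K i).subtype) (c.next i) rfl (by
    ext x; exact mem_cycleSubmodule.1 x.2 _)).hom x, ?_, rfl⟩
  rw [← LinearMap.comp_apply, ← ModuleCat.hom_comp, K.liftCycles_i]; rfl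

lemma homologyClass_surjective (i : ι) : Function.Surjective (homologyClass K i) := fun y => by
  obtain ⟨z, rfl⟩ := (ModuleCat.epi_iff_surjective (K.homologyπ i)).1 inferInstance y
  exact ⟨_, (homologyπ_apply K i z).symm⟩

lemma homologyClass_eq_zero_iff (i : ι) (x : cycleSubmodule K i) :
    homologyClass K i x = 0 ↔ ∃ j, ∃ w : K.X j, (K.d j i).hom w = x := by
  obtain ⟨z, hz, hz'⟩ := exists_cycles K i x
  rw [← hz', ← hz]
  have hex : (ShortComplex.mk (K.toCycles (c.prev i) i) (K.homologyπ i) (by simp)).Exact :=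
    ShortComplex.exact_of_g_is_cokernel _ (K.homologyIsCokernel (c.prev i) i rfl)
  rw [ShortComplex.moduleCat_exact_iff] at hex
  have key : ∀ j (w : K.X j),
      (K.iCycles i).hom ((K.toCycles j i).hom w) = (K.d j i).hom w := fun j w => by
    rw [← LinearMap.comp_apply, ← ModuleCat.hom_comp, K.toCycles_i]
  constructor
  · intro h
    obtain ⟨w, hw⟩ := hex z h
    refine ⟨_, w, ?_⟩
    rw [← key]; exact congrArg _ hw
  · rintro ⟨j, w, hw⟩
    rw [← key] at hw
    rw [← iCycles_injective K i hw, ← LinearMap.comp_apply, ← ModuleCat.hom_comp,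
      K.toCycles_comp_homologyπ]; rfl

variable {K L} in
lemma map_mem_cycleSubmodule (f : K ⟶ L) {i : ι} {x : K.X i} (hx : x ∈ cycleSubmodule K i) :
    (f.f i).hom x ∈ cycleSubmodule L i := by
  refine mem_cycleSubmodule.2 fun j => ?_
  rw [← LinearMap.comp_apply, ← ModuleCat.hom_comp, f.comm, ModuleCat.hom_comp,
    LinearMap.comp_apply, mem_cycleSubmodule.1 hx, map_zero]

variable {K L} in
lemma homologyMap_homologyClass (f : K ⟶ L) {i : ι} (x : cycleSubmodule K i) :
    (HomologicalComplex.homologyMap f i).hom (homologyClass K i x) =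
      homologyClass L i ⟨(f.f i).hom x, map_mem_cycleSubmodule f x.2⟩ := by
  obtain ⟨z, hz, hz'⟩ := exists_cycles K i x
  rw [← hz', ← LinearMap.comp_apply, ← ModuleCat.hom_comp,
    HomologicalComplex.homologyπ_naturality, ModuleCat.hom_comp, LinearMap.comp_apply,
    homologyπ_apply]
  congr 2
  rw [← LinearMap.comp_apply, ← ModuleCat.hom_comp, HomologicalComplex.cyclesMap_i,
    ModuleCat.hom_comp, LinearMap.comp_apply, hz]

end

section
variable {R : Type*} [CommRing R] {A B D : Type*} [AddCommGroup A] [AddCommGroup B]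
  [AddCommGroup D] [Module R A] [Module R B] [Module R D]

/-- Two quotients of a module by the same submodule are isomorphic. -/
lemma exists_equiv_of_surjective (f : A →ₗ[R] B) (g : A →ₗ[R] D) (hf : Function.Surjective f)
    (hg : Function.Surjective g) (h : ∀ x, f x = 0 ↔ g x = 0) :
    ∃ e : B ≃ₗ[R] D, ∀ x, e (f x) = g x := by
  have hk : LinearMap.ker f = LinearMap.ker g := by ext x; exact h x
  refine ⟨(f.quotKerEquivOfSurjective hf).symm.trans
    ((Submodule.quotEquivOfEq _ _ hk).trans (g.quotKerEquivOfSurjective hg)), fun x => ?_⟩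
  have : (f.quotKerEquivOfSurjective hf).symm (f x) = Submodule.Quotient.mk x := by
    rw [LinearEquiv.symm_apply_eq]; rfl
  simp [this]

end

/-! ### The spectral sequence of a bounded filtration -/

/-- The differentials of `c` and the bidegrees `v r` are either the homological ones (sign `1`) or
the cohomological ones (sign `-1`), and the `p`-th column has filtration index `wt p = p`,
respectively `wt p = -p`. -/
def IsQuadrantShape (c : ComplexShape ℕ) (v : ℤ → ℤ × ℤ) (wt : ℕ → ℤ) : Prop :=
  ∃ s : ℤ, (s = 1 ∨ s = -1) ∧ (∀ i j, c.Rel i j ↔ (i : ℤ) = j + s) ∧ (∀ p, wt p = s * p) ∧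
    ∀ r, v r = (-(s * r), s * (r - 1))

namespace IsQuadrantShape

variable {c : ComplexShape ℕ} {v : ℤ → ℤ × ℤ} {wt : ℕ → ℤ} (h : IsQuadrantShape c v wt)
include h

lemma rel_of_rel {r : ℤ} {p q p' q' : ℕ}
    (hr : (ComplexShape.spectralSequenceNat (v r)).Rel (p, q) (p', q')) :
    c.Rel (p + q) (p' + q') ∧ wt p' = wt p - r := by
  obtain ⟨s, hs, hc, hw, hv⟩ := h
  rw [ComplexShape.spectralSequenceNat_rel_iff, hv] at hr
  rw [hc, hw, hw]
  rcases hs with rfl | rfl <;> (dsimp only at hr; constructor <;> (push_cast; lia))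

lemma lt_of_no_next {r : ℤ} (hr : 2 ≤ r) {p q m : ℕ}
    (hn : ¬ ∃ p' q', (ComplexShape.spectralSequenceNat (v r)).Rel (p, q) (p', q'))
    (hm : c.Rel (p + q) m) {p' : ℕ} (hp' : p' ≤ m) : wt p - r < wt p' := by
  obtain ⟨s, hs, hc, hw, hv⟩ := h
  simp only [ComplexShape.spectralSequenceNat_rel_iff, hv] at hn
  rw [hc] at hm
  rw [hw, hw]
  by_contra hlt
  apply hn
  rcases hs with rfl | rfl
  · exact ⟨(p - r).toNat, (q + r - 1).toNat, by lia, by lia⟩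
  · exact ⟨(p + r).toNat, (q + 1 - r).toNat, by lia, by lia⟩

lemma le_of_no_prev {r : ℤ} (hr : 2 ≤ r) {p q m : ℕ}
    (hn : ¬ ∃ p' q', (ComplexShape.spectralSequenceNat (v r)).Rel (p', q') (p, q))
    (hm : c.Rel m (p + q)) {p' : ℕ} (hp' : p' ≤ m) : wt p' ≤ wt p + r - 1 := by
  obtain ⟨s, hs, hc, hw, hv⟩ := h
  simp only [ComplexShape.spectralSequenceNat_rel_iff, hv] at hn
  rw [hc] at hm
  rw [hw, hw]
  by_contra hlt
  apply hn
  rcases hs with rfl | rfl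
  · exact ⟨(p + r).toNat, (q - r + 1).toNat, by lia, by lia⟩
  · exact ⟨(p - r).toNat, (q + r - 1).toNat, by lia, by lia⟩

lemma lt_of_large {r : ℤ} {p q m : ℕ} (hr : (p : ℤ) + q + 2 ≤ r)
    (hm : c.Rel (p + q) m) {p' : ℕ} (hp' : p' ≤ m) : wt p - r < wt p' := by
  obtain ⟨s, hs, hc, hw, hv⟩ := h
  rw [hc] at hm
  rw [hw, hw]
  rcases hs with rfl | rfl <;> lia

lemma le_of_large {r : ℤ} {p q m : ℕ} (hr : (p : ℤ) + q + 2 ≤ r)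
    (hm : c.Rel m (p + q)) {p' : ℕ} (hp' : p' ≤ m) : wt p' ≤ wt p + r - 1 := by
  obtain ⟨s, hs, hc, hw, hv⟩ := h
  rw [hc] at hm
  rw [hw, hw]
  rcases hs with rfl | rfl <;> lia

lemma wt_eq_of_rel {p p' : ℕ} (hp : c.Rel p p') : wt p' = wt p - 1 := by
  obtain ⟨s, hs, hc, hw, hv⟩ := h
  rw [hc] at hp
  rw [hw, hw]
  rcases hs with rfl | rfl <;> lia

lemma wt_injective : Function.Injective wt := fun p p' hp => by
  obtain ⟨s, hs, hc, hw, hv⟩ := h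
  rw [hw, hw] at hp
  rcases hs with rfl | rfl <;> lia

end IsQuadrantShape

section
variable {R : Type u} [CommRing R] {c : ComplexShape ℕ} (K : HomologicalComplex (ModuleCat.{u} R) c)
  (F : ℤ → ∀ n, Submodule R (K.X n)) (wt : ℕ → ℤ)

/-- `F` is an increasing filtration by subcomplexes which in degree `n` is finite and jumps only
between the smallest and the largest of the indices `wt p` for `p ≤ n`. -/
structure IsBoundedFiltration : Prop where
  mono {k l : ℤ} (n : ℕ) (h : k ≤ l) : F k n ≤ F l n
  d_mem {k : ℤ} {n : ℕ} (m : ℕ) {x : K.X n} (hx : x ∈ F k n) : (K.d n m).hom x ∈ F k m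
  eq_bot {k : ℤ} {n : ℕ} (h : ∀ p ≤ n, k < wt p) : F k n = ⊥
  eq_top {k : ℤ} {n : ℕ} (h : ∀ p ≤ n, wt p ≤ k) : F k n = ⊤

variable {K F wt}

lemma mem_filtCycles {r k : ℤ} {n : ℕ} {x : K.X n} :
    x ∈ filtCycles K F r k n ↔ x ∈ F k n ∧ ∀ m, (K.d n m).hom x ∈ F (k - r) m := by
  simp [filtCycles]

lemma mem_filtCycles_of_rel {r k : ℤ} {n : ℕ} {x : K.X n} (hx : x ∈ F k n)
    (h : ∀ m, c.Rel n m → (K.d n m).hom x ∈ F (k - r) m) : x ∈ filtCycles K F r k n := by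
  refine mem_filtCycles.2 ⟨hx, fun m => ?_⟩
  by_cases hm : c.Rel n m
  · exact h m hm
  · rw [K.shape n m hm]; exact zero_mem _

lemma mem_filtBoundaries {r k : ℤ} {n : ℕ} {x : K.X n} :
    x ∈ filtBoundaries K F r k n ↔ ∃ z ∈ filtCycles K F (r - 1) (k - 1) n, ∃ m,
      ∃ w ∈ filtCycles K F (r - 1) (k + r - 1) m, x = z + (K.d m n).hom w := by
  constructor
  · intro hx
    obtain ⟨z, hz, y, hy, rfl⟩ := Submodule.mem_sup.1 hx
    have hle : (⨆ m, (filtCycles K F (r - 1) (k + r - 1) m).map (K.d m n).hom) ≤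
        (filtCycles K F (r - 1) (k + r - 1) (c.prev n)).map (K.d (c.prev n) n).hom := by
      refine iSup_le fun m => ?_
      by_cases hm : c.Rel m n
      · rw [c.prev_eq' hm]
      · rw [K.shape m n hm]
        rintro _ ⟨w, -, rfl⟩
        exact zero_mem _
    obtain ⟨w, hw, rfl⟩ := hle hy
    exact ⟨z, hz, _, w, hw, rfl⟩
  · rintro ⟨z, hz, m, w, hw, rfl⟩
    exact add_mem (Submodule.mem_sup_left hz)
      (Submodule.mem_sup_right (Submodule.mem_iSup_of_mem m ⟨w, hw, rfl⟩))

namespace IsBoundedFiltration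

variable (hF : IsBoundedFiltration K F wt)
include hF

lemma filtCycles_le {r r' k k' : ℤ} {n : ℕ} (h : k ≤ k') (h' : k - r ≤ k' - r') :
    filtCycles K F r k n ≤ filtCycles K F r' k' n := fun x hx => by
  rw [mem_filtCycles] at hx ⊢
  exact ⟨hF.mono n h hx.1, fun m => hF.mono m h' (hx.2 m)⟩

/-- The differential of a class of the `r`-th page vanishes if and only if the class has a
representative in `Z^{r+1}`. -/
lemma exists_filtCycles_succ {r k : ℤ} {n : ℕ} {x : K.X n}
    (hx : x ∈ filtCycles K F r k n)
    (h : ∀ m, c.Rel n m → (K.d n m).hom x ∈ filtBoundaries K F r (k - r) m) :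
    ∃ y ∈ filtCycles K F (r + 1) k n, x - y ∈ filtBoundaries K F r k n := by
  by_cases hn : ∃ m, c.Rel n m
  · obtain ⟨m, hm⟩ := hn
    obtain ⟨z, hz, n', w, hw, hzw⟩ := mem_filtBoundaries.1 (h m hm)
    by_cases hn' : c.Rel n' m
    · obtain rfl : n = n' := (c.prev_eq' hm).symm.trans (c.prev_eq' hn')
      have hw' : w ∈ filtCycles K F (r - 1) (k - 1) n := hF.filtCycles_le (by lia) (by lia) hw
      refine ⟨x - w, mem_filtCycles_of_rel (sub_mem (mem_filtCycles.1 hx).1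
        (hF.mono n (by lia) (mem_filtCycles.1 hw').1)) fun m' hm' => ?_,
        mem_filtBoundaries.2 ⟨w, hw', n, 0, zero_mem _, by simp⟩⟩
      obtain rfl : m = m' := (c.next_eq' hm).symm.trans (c.next_eq' hm')
      rw [map_sub, hzw, add_sub_cancel_right]
      exact hF.mono m (by lia) (mem_filtCycles.1 hz).1
    · rw [K.shape n' m hn'] at hzw
      refine ⟨x, mem_filtCycles_of_rel (mem_filtCycles.1 hx).1 fun m' hm' => ?_, by simp⟩
      obtain rfl : m = m' := (c.next_eq' hm).symm.trans (c.next_eq' hm')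
      rw [hzw]
      exact add_mem (hF.mono m (by lia) (mem_filtCycles.1 hz).1) (zero_mem _)
  · exact ⟨x, mem_filtCycles_of_rel (mem_filtCycles.1 hx).1 fun m hm => (hn ⟨m, hm⟩).elim, by simp⟩

/-- A class of `Z^{r+1}` is killed in the page `r + 1` if and only if in the page `r` it is a value
of the differential. -/
lemma mem_filtBoundaries_succ {r k : ℤ} {n : ℕ} {y : K.X n}
    (hy : y ∈ filtCycles K F (r + 1) k n) :
    y ∈ filtBoundaries K F (r + 1) k n ↔
      ∃ m, ∃ w ∈ filtCycles K F r (k + r) m, y - (K.d m n).hom w ∈ filtBoundaries K F r k n := by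
  constructor
  · intro h
    obtain ⟨z, hz, m, w, hw, rfl⟩ := mem_filtBoundaries.1 h
    exact ⟨m, w, hF.filtCycles_le (by lia) (by lia) hw, mem_filtBoundaries.2
      ⟨z, hF.filtCycles_le (by lia) (by lia) hz, n, 0, zero_mem _, by simp⟩⟩
  · rintro ⟨m', w', hw', h⟩
    obtain ⟨z, hz, m, w, hw, h⟩ := mem_filtBoundaries.1 h
    have hyF := mem_filtCycles.1 hy
    have hzF := mem_filtCycles.1 hz
    have hwF := mem_filtCycles.1 hw
    have hw'F := mem_filtCycles.1 hw'
    have hdw : (K.d m n).hom w = y - (K.d m' n).hom w' - z := by rw [h]; abel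
    -- both boundaries combine into one, since `n` has only one predecessor
    obtain ⟨w'', hw'', hd⟩ : ∃ w'' ∈ filtCycles K F r (k + r) (c.prev n),
        (K.d (c.prev n) n).hom w'' = (K.d m' n).hom w' + (K.d m n).hom w := by
      have h1 : ∃ a ∈ filtCycles K F r (k + r) (c.prev n),
          (K.d (c.prev n) n).hom a = (K.d m' n).hom w' := by
        by_cases hm : c.Rel m' n
        · obtain rfl := c.prev_eq' hm
          exact ⟨w', hw', rfl⟩
        · exact ⟨0, zero_mem _, by rw [K.shape _ _ hm]; simp⟩
      have h2 : ∃ a ∈ filtCycles K F r (k + r) (c.prev n),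
          (K.d (c.prev n) n).hom a = (K.d m n).hom w := by
        by_cases hm : c.Rel m n
        · obtain rfl := c.prev_eq' hm
          refine ⟨w, mem_filtCycles_of_rel (hF.mono _ (by lia) hwF.1) fun m₁ hm₁ => ?_, rfl⟩
          obtain rfl : n = m₁ := (c.next_eq' hm).symm.trans (c.next_eq' hm₁)
          exact hF.mono n (by lia) (hwF.2 n)
        · exact ⟨0, zero_mem _, by rw [K.shape _ _ hm]; simp⟩
      obtain ⟨a, ha, ha'⟩ := h1
      obtain ⟨b, hb, hb'⟩ := h2
      exact ⟨a + b, add_mem ha hb, by rw [map_add, ha', hb']⟩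
    refine mem_filtBoundaries.2 ⟨z, mem_filtCycles.2 ⟨hzF.1, fun m₁ => ?_⟩, _, w'',
      hF.filtCycles_le (by lia) (by lia) hw'', by rw [hd, hdw]; abel⟩
    have : z = y - (K.d m' n).hom w' - (K.d m n).hom w := by rw [hdw]; abel
    rw [this, map_sub, map_sub, d_d_apply, d_d_apply, sub_zero, sub_zero]
    exact hF.mono m₁ (by lia) (hyF.2 m₁)

end IsBoundedFiltration
end

section
variable {R : Type u} [CommRing R] {c : ComplexShape ℕ} {K : HomologicalComplex (ModuleCat.{u} R) c}
  {F : ℤ → ∀ n, Submodule R (K.X n)} {v : ℤ → ℤ × ℤ} {wt : ℕ → ℤ}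

/-- The differential `Z^r_k → Z^r_{k-r}`. -/
noncomputable def filtCyclesD (K : HomologicalComplex (ModuleCat.{u} R) c)
    (F : ℤ → ∀ n, Submodule R (K.X n)) (r k l : ℤ) (n m : ℕ)
    (h : l = k - r) : filtCycles K F r k n →ₗ[R] filtCycles K F r l m :=
  ((K.d n m).hom.comp (filtCycles K F r k n).subtype).codRestrict _ fun x => by
    have hx := mem_filtCycles.1 x.2
    subst h
    refine mem_filtCycles.2 ⟨hx.2 m, fun m' => ?_⟩
    rw [LinearMap.comp_apply, d_d_apply]
    exact zero_mem _

lemma filtCyclesD_mem (hF : IsBoundedFiltration K F wt) {r k l : ℤ} {n m : ℕ} (h : l = k - r)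
    {x : filtCycles K F r k n} (hx : (x : K.X n) ∈ filtBoundaries K F r k n) :
    (filtCyclesD K F r k l n m h x : K.X m) ∈ filtBoundaries K F r l m := by
  obtain ⟨z, hz, n', w, hw, hx⟩ := mem_filtBoundaries.1 hx
  refine mem_filtBoundaries.2 ⟨0, zero_mem _, n, z, hF.filtCycles_le (by lia) (by lia) hz, ?_⟩
  change (K.d n m).hom (x : K.X n) = _
  rw [hx, map_add, d_d_apply, add_zero, zero_add]

/-- The differential of the `r`-th page from filtration index `k` to filtration index `k - r`. -/
noncomputable def filtTermD (hF : IsBoundedFiltration K F wt) (r k l : ℤ) (n m : ℕ)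
    (h : l = k - r) :
    (filtCycles K F r k n ⧸ (filtBoundaries K F r k n).comap (filtCycles K F r k n).subtype) →ₗ[R]
      (filtCycles K F r l m ⧸ (filtBoundaries K F r l m).comap (filtCycles K F r l m).subtype) :=
  Submodule.mapQ _ _ (filtCyclesD K F r k l n m h) fun _ hx => filtCyclesD_mem hF h hx

lemma filtTermD_comp (hF : IsBoundedFiltration K F wt) (r k l j : ℤ) (n m i : ℕ)
    (h : l = k - r) (h' : j = l - r) :
    (filtTermD hF r l j m i h').comp (filtTermD hF r k l n m h) = 0 := by
  refine Submodule.linearMap_qext _ (LinearMap.ext fun x => ?_)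
  refine (Submodule.Quotient.mk_eq_zero _).2 ?_
  have h0 : (K.d m i).hom ((K.d n m).hom (x : K.X n)) = 0 := d_d_apply K _
  have : (filtCyclesD K F r l j m i h' (filtCyclesD K F r k l n m h x) : K.X i) = 0 := h0
  rw [Submodule.mem_comap, Submodule.subtype_apply, this]
  exact zero_mem _

open Classical in
/-- The `r`-th page of the spectral sequence of a filtered complex. -/
noncomputable def filtPage (hQ : IsQuadrantShape c v wt) (hF : IsBoundedFiltration K F wt) (r : ℤ) :
    HomologicalComplex (ModuleCat.{u} R) (ComplexShape.spectralSequenceNat (v r)) where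
  X a := ModuleCat.of R (filtCycles K F r (wt a.1) (a.1 + a.2) ⧸
    (filtBoundaries K F r (wt a.1) (a.1 + a.2)).comap (Submodule.subtype _))
  d a b :=
    if h : (ComplexShape.spectralSequenceNat (v r)).Rel a b then
      ModuleCat.ofHom (filtTermD hF r (wt a.1) (wt b.1) (a.1 + a.2) (b.1 + b.2)
        (hQ.rel_of_rel h).2)
    else 0
  shape a b h := dif_neg h
  d_comp_d' a b e hab hbe := by
    rw [dif_pos hab, dif_pos hbe, ← ModuleCat.ofHom_comp, filtTermD_comp]
    rfl

variable (hQ : IsQuadrantShape c v wt) (hF : IsBoundedFiltration K F wt)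

/-- The projection of `Z^r_k` to a term of the `r`-th page. -/
noncomputable def filtPageProj (r : ℤ) (p q : ℕ) :
    filtCycles K F r (wt p) (p + q) →ₗ[R] (filtPage hQ hF r).X (p, q) :=
  Submodule.mkQ _

lemma filtPageProj_surjective (r : ℤ) (p q : ℕ) :
    Function.Surjective (filtPageProj hQ hF r p q) := Submodule.mkQ_surjective _

lemma filtPageProj_eq_zero_iff (r : ℤ) (p q : ℕ) (x : filtCycles K F r (wt p) (p + q)) :
    filtPageProj hQ hF r p q x = 0 ↔ (x : K.X (p + q)) ∈ filtBoundaries K F r (wt p) (p + q) :=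
  Submodule.Quotient.mk_eq_zero _

lemma filtPage_d_proj (r : ℤ) {p q p' q' : ℕ}
    (h : (ComplexShape.spectralSequenceNat (v r)).Rel (p, q) (p', q'))
    (x : filtCycles K F r (wt p) (p + q)) :
    ((filtPage hQ hF r).d (p, q) (p', q')).hom (filtPageProj hQ hF r p q x) =
      filtPageProj hQ hF r p' q'
        (filtCyclesD K F r (wt p) (wt p') (p + q) (p' + q') (hQ.rel_of_rel h).2 x) := by
  simp only [filtPage, dif_pos h]
  rfl

attribute [irreducible] filtPage filtPageProj

/-- A class of `Z^{r+1}` is a cycle for the differential of the `r`-th page. -/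
lemma filtPageProj_mem_cycleSubmodule (r : ℤ) (p q : ℕ)
    (x : filtCycles K F (r + 1) (wt p) (p + q)) :
    filtPageProj hQ hF r p q ⟨x, hF.filtCycles_le le_rfl (by lia) x.2⟩ ∈
      cycleSubmodule (filtPage hQ hF r) (p, q) := by
  refine mem_cycleSubmodule_of_rel fun ⟨p', q'⟩ h => ?_
  rw [filtPage_d_proj hQ hF r h, filtPageProj_eq_zero_iff]
  have hx := mem_filtCycles.1 x.2
  refine mem_filtBoundaries.2 ⟨(K.d _ _).hom x.1, mem_filtCycles.2 ⟨?_, fun m => ?_⟩, p' + q', 0,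
    zero_mem _, by simp; rfl⟩
  · rw [(hQ.rel_of_rel h).2]
    exact hF.mono _ (by lia) (hx.2 _)
  · rw [d_d_apply]
    exact zero_mem _

/-- The map from `Z^{r+1}` to the homology of the `r`-th page. -/
noncomputable def filtPageHomologyProj (r : ℤ) (p q : ℕ) :
    filtCycles K F (r + 1) (wt p) (p + q) →ₗ[R] (filtPage hQ hF r).homology (p, q) :=
  (homologyClass (filtPage hQ hF r) (p, q)).comp
    (((filtPageProj hQ hF r p q).comp
      (Submodule.inclusion (hF.filtCycles_le le_rfl (by lia)))).codRestrict _
      (filtPageProj_mem_cycleSubmodule hQ hF r p q))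

lemma filtPageHomologyProj_apply (r : ℤ) (p q : ℕ)
    (x : filtCycles K F (r + 1) (wt p) (p + q)) :
    filtPageHomologyProj hQ hF r p q x = homologyClass (filtPage hQ hF r) (p, q)
      ⟨filtPageProj hQ hF r p q ⟨x, hF.filtCycles_le le_rfl (by lia) x.2⟩,
        filtPageProj_mem_cycleSubmodule hQ hF r p q x⟩ := rfl

lemma filtPageProj_eq_iff (r : ℤ) (p q : ℕ) (x y : filtCycles K F r (wt p) (p + q)) :
    filtPageProj hQ hF r p q x = filtPageProj hQ hF r p q y ↔
      (x : K.X (p + q)) - y ∈ filtBoundaries K F r (wt p) (p + q) := by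
  rw [← sub_eq_zero, ← map_sub, filtPageProj_eq_zero_iff]
  rfl

lemma filtPageHomologyProj_surjective {r : ℤ} (hr : 2 ≤ r) (p q : ℕ) :
    Function.Surjective (filtPageHomologyProj hQ hF r p q) := fun y => by
  obtain ⟨⟨y, hy⟩, rfl⟩ := homologyClass_surjective _ _ y
  obtain ⟨x, rfl⟩ := filtPageProj_surjective hQ hF r p q y
  have hx := mem_filtCycles.1 x.2
  obtain ⟨z, hz, hxz⟩ := hF.exists_filtCycles_succ x.2 fun m hm => by
    by_cases hn : ∃ p' q', (ComplexShape.spectralSequenceNat (v r)).Rel (p, q) (p', q')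
    · obtain ⟨p', q', hn⟩ := hn
      obtain ⟨h1, h2⟩ := hQ.rel_of_rel hn
      obtain rfl : m = p' + q' := (c.next_eq' hm).symm.trans (c.next_eq' h1)
      have := mem_cycleSubmodule.1 hy (p', q')
      rw [filtPage_d_proj hQ hF r hn, filtPageProj_eq_zero_iff] at this
      rw [← h2]
      exact this
    · have := hx.2 m
      rw [hF.eq_bot fun p' hp' => hQ.lt_of_no_next hr hn hm hp', Submodule.mem_bot] at this
      rw [this]
      exact zero_mem _
  refine ⟨⟨z, hz⟩, ?_⟩
  rw [filtPageHomologyProj_apply]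
  congr 2
  exact ((filtPageProj_eq_iff hQ hF r p q _ _).2 hxz).symm

lemma filtPageHomologyProj_eq_zero_iff {r : ℤ} (hr : 2 ≤ r) (p q : ℕ)
    (x : filtCycles K F (r + 1) (wt p) (p + q)) :
    filtPageHomologyProj hQ hF r p q x = 0 ↔
      (x : K.X (p + q)) ∈ filtBoundaries K F (r + 1) (wt p) (p + q) := by
  rw [hF.mem_filtBoundaries_succ x.2, filtPageHomologyProj_apply, homologyClass_eq_zero_iff]
  constructor
  · rintro ⟨⟨p', q'⟩, w, hw⟩
    by_cases h : (ComplexShape.spectralSequenceNat (v r)).Rel (p', q') (p, q)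
    · obtain ⟨w, rfl⟩ := filtPageProj_surjective hQ hF r p' q' w
      rw [filtPage_d_proj hQ hF r h] at hw
      refine ⟨p' + q', w, ?_, ?_⟩
      · convert! w.2 using 2
        have := (hQ.rel_of_rel h).2
        lia
      · exact (filtPageProj_eq_iff hQ hF r p q _ _).1 hw.symm
    · rw [HomologicalComplex.shape _ _ _ h, ModuleCat.hom_zero, LinearMap.zero_apply, eq_comm,
        filtPageProj_eq_zero_iff] at hw
      refine ⟨p + q, 0, zero_mem _, ?_⟩
      rw [map_zero, sub_zero]
      exact hw
  · rintro ⟨m, w, hw, hx⟩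
    by_cases hm : c.Rel m (p + q)
    · by_cases hn : ∃ p' q', (ComplexShape.spectralSequenceNat (v r)).Rel (p', q') (p, q)
      · obtain ⟨p', q', hn⟩ := hn
        obtain ⟨h1, h2⟩ := hQ.rel_of_rel hn
        obtain rfl : m = p' + q' := (c.prev_eq' hm).symm.trans (c.prev_eq' h1)
        have hw' : w ∈ filtCycles K F r (wt p') (p' + q') := by
          convert! hw using 2
          lia
        refine ⟨(p', q'), filtPageProj hQ hF r p' q' ⟨w, hw'⟩, ?_⟩
        rw [filtPage_d_proj hQ hF r hn]
        exact ((filtPageProj_eq_iff hQ hF r p q _ _).2 hx).symm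
      · refine ⟨(p, q), 0, ?_⟩
        rw [map_zero, eq_comm, filtPageProj_eq_zero_iff]
        have hw' : (K.d m (p + q)).hom w ∈ filtBoundaries K F r (wt p) (p + q) := by
          refine mem_filtBoundaries.2 ⟨0, zero_mem _, m, w, mem_filtCycles.2 ⟨?_, fun m' => ?_⟩,
            by rw [zero_add]⟩
          · rw [hF.eq_top fun p' hp' => hQ.le_of_no_prev hr hn hm hp']
            trivial
          · exact hF.mono _ (by lia) ((mem_filtCycles.1 hw).2 m')
        simpa using add_mem hx hw'
    · refine ⟨(p, q), 0, ?_⟩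
      rw [map_zero, eq_comm, filtPageProj_eq_zero_iff]
      rw [K.shape _ _ hm] at hx
      simpa using hx

lemma exists_filtPage_equiv {r r' : ℤ} (h : r + 1 = r') (hr : 2 ≤ r) (p q : ℕ) :
    ∃ e : (filtPage hQ hF r).homology (p, q) ≃ₗ[R] (filtPage hQ hF r').X (p, q),
      ∀ x : filtCycles K F (r + 1) (wt p) (p + q), e (filtPageHomologyProj hQ hF r p q x) =
        filtPageProj hQ hF r' p q ⟨x, h ▸ x.2⟩ := by
  subst h
  refine exists_equiv_of_surjective _ _ (filtPageHomologyProj_surjective hQ hF hr p q)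
    (filtPageProj_surjective hQ hF (r + 1) p q) fun x => ?_
  rw [filtPageHomologyProj_eq_zero_iff hQ hF hr]
  exact (filtPageProj_eq_zero_iff hQ hF (r + 1) p q x).symm

/-- The isomorphism between the homology of a page and the next page. -/
noncomputable def filtPageEquiv {r r' : ℤ} (h : r + 1 = r') (hr : 2 ≤ r) (p q : ℕ) :
    (filtPage hQ hF r).homology (p, q) ≃ₗ[R] (filtPage hQ hF r').X (p, q) :=
  (exists_filtPage_equiv hQ hF h hr p q).choose

lemma filtPageEquiv_homologyπ {r : ℤ} (hr : 2 ≤ r) (p q : ℕ)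
    (x : filtCycles K F r (wt p) (p + q)) (y : filtCycles K F (r + 1) (wt p) (p + q))
    (hxy : (x : K.X (p + q)) = y) (z : (filtPage hQ hF r).cycles (p, q))
    (hz : ((filtPage hQ hF r).iCycles (p, q)).hom z = filtPageProj hQ hF r p q x) :
    filtPageEquiv hQ hF rfl hr p q (((filtPage hQ hF r).homologyπ (p, q)).hom z) =
      filtPageProj hQ hF (r + 1) p q y := by
  have he := (exists_filtPage_equiv hQ hF rfl hr p q).choose_spec y
  refine Eq.trans ?_ he
  rw [homologyπ_apply, filtPageHomologyProj_apply]
  obtain rfl : x = ⟨y, hF.filtCycles_le le_rfl (by lia) y.2⟩ := Subtype.ext hxy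
  simp only [hz]
  rfl

/-- The spectral sequence of a filtered complex. -/
noncomputable def filtSS : QuadrantSS R v where
  page r _ := filtPage hQ hF r
  iso _ _ pq h hr := (filtPageEquiv hQ hF h hr pq.1 pq.2).toModuleIso

/-- A bounded filtration of a complex has a spectral sequence. -/
theorem IsBoundedFiltration.exists_isFiltrationSS (hQ : IsQuadrantShape c v wt)
    (hF : IsBoundedFiltration K F wt) :
    ∃ E : QuadrantSS R v, Nonempty (IsFiltrationSS E K F wt) :=
  ⟨filtSS hQ hF, ⟨{
    proj r _ p q := filtPageProj hQ hF r p q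
    proj_surjective r _ p q := filtPageProj_surjective hQ hF r p q
    proj_eq_zero_iff r _ p q x := filtPageProj_eq_zero_iff hQ hF r p q x
    d_proj r _ p q p' q' h x y hxy := by
      obtain rfl : filtCyclesD K F r (wt p) (wt p') (p + q) (p' + q') (hQ.rel_of_rel h).2 x = y :=
        Subtype.ext hxy
      exact filtPage_d_proj hQ hF r h x
    iso_proj r hr p q x y hxy z hz := filtPageEquiv_homologyπ hQ hF hr p q x y hxy z hz }⟩⟩

end

section
variable {R : Type*} [CommRing R] {A B D : Type*} [AddCommGroup A] [AddCommGroup B]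
  [AddCommGroup D] [Module R A] [Module R B] [Module R D]

lemma exists_linearMap_of_surjective (f : A →ₗ[R] B) (g : A →ₗ[R] D) (hg : Function.Surjective g)
    (h : ∀ x, g x = 0 → f x = 0) : ∃ e : D →ₗ[R] B, ∀ x, e (g x) = f x := by
  refine ⟨((LinearMap.ker g).liftQ f h).comp (g.quotKerEquivOfSurjective hg).symm.toLinearMap,
    fun x => ?_⟩
  have : (g.quotKerEquivOfSurjective hg).symm (g x) = Submodule.Quotient.mk x := by
    rw [LinearEquiv.symm_apply_eq]; rfl
  rw [LinearMap.comp_apply, LinearEquiv.coe_coe, this]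
  exact Submodule.liftQ_apply _ _ _

end

section
variable {R : Type u} [CommRing R] {c : ComplexShape ℕ} {K : HomologicalComplex (ModuleCat.{u} R) c}
  {F : ℤ → ∀ n, Submodule R (K.X n)} {v : ℤ → ℤ × ℤ} {wt : ℕ → ℤ}

lemma mem_filtHomology {k : ℤ} {n : ℕ} {y : K.homology n} :
    y ∈ filtHomology K F k n ↔
      ∃ x : cycleSubmodule K n, (x : K.X n) ∈ F k n ∧ homologyClass K n x = y := by
  constructor
  · rintro ⟨z, hz, rfl⟩
    exact ⟨⟨(K.iCycles n).hom z, iCycles_mem K n z⟩, hz, (homologyπ_apply K n z).symm⟩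
  · rintro ⟨x, hx, rfl⟩
    obtain ⟨z, hz, hz'⟩ := exists_cycles K n x
    exact ⟨z, by rw [← hz] at hx; exact hx, hz'⟩

section
variable (hQ : IsQuadrantShape c v wt) (hF : IsBoundedFiltration K F wt)
include hQ hF

lemma IsBoundedFiltration.mem_filtCycles_iff_of_large {r : ℤ} {p q : ℕ}
    (hr : (p : ℤ) + q + 2 ≤ r) {x : K.X (p + q)} :
    x ∈ filtCycles K F r (wt p) (p + q) ↔ x ∈ F (wt p) (p + q) ⊓ cycleSubmodule K (p + q) := by
  rw [mem_filtCycles, Submodule.mem_inf]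
  refine and_congr_right fun _ => ⟨fun h => mem_cycleSubmodule_of_rel fun m hm => ?_,
    fun h m => ?_⟩
  · have := h m
    rwa [hF.eq_bot fun p' hp' => hQ.lt_of_large hr hm hp', Submodule.mem_bot] at this
  · rw [mem_cycleSubmodule.1 h]
    exact zero_mem _

lemma IsBoundedFiltration.mem_filtBoundaries_iff_of_large {r : ℤ} {p q : ℕ}
    (hr : (p : ℤ) + q + 2 ≤ r) (x : cycleSubmodule K (p + q))
    (hx : (x : K.X (p + q)) ∈ F (wt p) (p + q)) :
    (x : K.X (p + q)) ∈ filtBoundaries K F r (wt p) (p + q) ↔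
      homologyClass K (p + q) x ∈ filtHomology K F (wt p - 1) (p + q) := by
  rw [mem_filtBoundaries, mem_filtHomology]
  constructor
  · rintro ⟨z, hz, m, w, hw, h⟩
    have hz' : z ∈ cycleSubmodule K (p + q) := by
      have : z = (x : K.X (p + q)) - (K.d m (p + q)).hom w := by rw [h]; abel
      refine mem_cycleSubmodule.2 fun j => ?_
      rw [this, map_sub, d_d_apply, mem_cycleSubmodule.1 x.2, sub_zero]
    refine ⟨⟨z, hz'⟩, (mem_filtCycles.1 hz).1, ?_⟩
    rw [eq_comm, ← sub_eq_zero, ← map_sub, homologyClass_eq_zero_iff]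
    refine ⟨m, w, ?_⟩
    rw [Submodule.coe_sub, h]
    abel
  · rintro ⟨z, hz, h⟩
    rw [eq_comm, ← sub_eq_zero, ← map_sub, homologyClass_eq_zero_iff] at h
    obtain ⟨m, w, hw⟩ := h
    rw [Submodule.coe_sub] at hw
    refine ⟨z, mem_filtCycles.2 ⟨hz, fun j => ?_⟩, ?_⟩
    · rw [mem_cycleSubmodule.1 z.2]
      exact zero_mem _
    by_cases hm : c.Rel m (p + q)
    · refine ⟨m, w, mem_filtCycles_of_rel ?_ fun j hj => ?_, by rw [hw]; abel⟩
      · rw [hF.eq_top fun p' hp' => hQ.le_of_large hr hm hp']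
        trivial
      · obtain rfl : p + q = j := (c.next_eq' hm).symm.trans (c.next_eq' hj)
        rw [hw]
        exact sub_mem (hF.mono _ (by lia) hx) (hF.mono _ (by lia) hz)
    · rw [K.shape _ _ hm, ModuleCat.hom_zero, LinearMap.zero_apply] at hw
      exact ⟨m, 0, zero_mem _, by rw [map_zero, add_zero]; exact (sub_eq_zero.1 hw.symm)⟩

variable {H : ℕ → ModuleCat.{u} R} (φ : ∀ n, K.homology n ≅ H n) {E : QuadrantSS R v}
  (hE : IsFiltrationSS E K F wt)

/-- For large `r`, the terms of the `r`-th page are the graded pieces of the filtration on the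
homology of the complex. -/
lemma IsFiltrationSS.exists_proj {r : ℤ} (hr : 2 ≤ r) {p q : ℕ} (hpq : (p : ℤ) + q + 2 ≤ r) :
    ∃ f : (filtHomology K F (wt p) (p + q)).map (φ (p + q)).hom.hom →ₗ[R] (E.page r hr).X (p, q),
      ∀ (x : cycleSubmodule K (p + q)) (hx : (x : K.X (p + q)) ∈ F (wt p) (p + q)),
        f ⟨(φ (p + q)).hom.hom (homologyClass K (p + q) x),
          Submodule.mem_map_of_mem (mem_filtHomology.2 ⟨x, hx, rfl⟩)⟩ = hE.proj r hr p q
            ⟨x, (hF.mem_filtCycles_iff_of_large hQ hpq).2 ⟨hx, x.2⟩⟩ := by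
  let W := (F (wt p) (p + q)).comap (cycleSubmodule K (p + q)).subtype
  let g : W →ₗ[R] (filtHomology K F (wt p) (p + q)).map (φ (p + q)).hom.hom :=
    (((φ (p + q)).hom.hom.comp (homologyClass K (p + q))).comp W.subtype).codRestrict _ fun x =>
      Submodule.mem_map_of_mem (mem_filtHomology.2 ⟨x.1, x.2, rfl⟩)
  let f : W →ₗ[R] (E.page r hr).X (p, q) := (hE.proj r hr p q).comp
    (((cycleSubmodule K (p + q)).subtype.comp W.subtype).codRestrict _ fun x =>
      (hF.mem_filtCycles_iff_of_large hQ hpq).2 ⟨x.2, x.1.2⟩)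
  obtain ⟨e, he⟩ := exists_linearMap_of_surjective f g (by
    rintro ⟨_, y, hy, rfl⟩
    obtain ⟨x, hx, rfl⟩ := mem_filtHomology.1 hy
    exact ⟨⟨x, hx⟩, rfl⟩) (fun x hx => by
    refine (hE.proj_eq_zero_iff r hr p q _).2 ?_
    refine (hF.mem_filtBoundaries_iff_of_large hQ hpq x.1 x.2).2 ?_
    have h0 : (φ (p + q)).hom.hom (homologyClass K (p + q) x.1) = 0 := congrArg Subtype.val hx
    have h1 : homologyClass K (p + q) x.1 = 0 :=
      (φ (p + q)).toLinearEquiv.injective (h0.trans (map_zero _).symm)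
    rw [h1]
    exact zero_mem _)
  exact ⟨e, fun x hx => he ⟨x, hx⟩⟩

include hE in
/-- The spectral sequence of a bounded filtration converges to the homology of the complex. -/
theorem IsFiltrationSS.convergesTo : Nonempty (ConvergesTo E H
    (fun k n => (filtHomology K F k n).map (φ n).hom.hom) wt) := by
  have hφ : ∀ n, Function.Bijective (φ n).hom.hom := fun n => (φ n).toLinearEquiv.bijective
  choose f hf using fun (r : ℤ) (hr : 2 ≤ r) (p q : ℕ) (hpq : (p : ℤ) + q + 2 ≤ r) =>
    hE.exists_proj hQ hF φ hr hpq
  refine ⟨{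
    mono := fun k l n h => Submodule.map_mono fun y hy => ?_
    eq_bot := fun k n h => ?_
    eq_top := fun k n h => ?_
    proj := f
    proj_surjective := fun r hr p q hpq y => ?_
    proj_eq_zero_iff := ?_
    iso_proj := ?_ }⟩
  · obtain ⟨x, hx, rfl⟩ := mem_filtHomology.1 hy
    exact mem_filtHomology.2 ⟨x, hF.mono n h hx, rfl⟩
  · refine (Submodule.eq_bot_iff _).2 ?_
    rintro _ ⟨y, hy, rfl⟩
    obtain ⟨x, hx, rfl⟩ := mem_filtHomology.1 hy
    rw [hF.eq_bot h, Submodule.mem_bot] at hx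
    obtain rfl : x = 0 := Subtype.ext hx
    rw [map_zero, map_zero]
  · refine Submodule.eq_top_iff'.2 fun y => ?_
    obtain ⟨y, rfl⟩ := (hφ n).2 y
    obtain ⟨x, rfl⟩ := homologyClass_surjective K n y
    refine Submodule.mem_map_of_mem (mem_filtHomology.2 ⟨x, ?_, rfl⟩)
    rw [hF.eq_top h]
    trivial
  · obtain ⟨x, rfl⟩ := hE.proj_surjective r hr p q y
    have hx := (hF.mem_filtCycles_iff_of_large hQ hpq).1 x.2
    exact ⟨_, hf r hr p q hpq ⟨x, hx.2⟩ hx.1⟩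
  · rintro r hr p q hpq ⟨_, y, hy, rfl⟩
    obtain ⟨x, hx, rfl⟩ := mem_filtHomology.1 hy
    rw [hf r hr p q hpq x hx, hE.proj_eq_zero_iff,
      hF.mem_filtBoundaries_iff_of_large hQ hpq x hx]
    refine ⟨fun h => Submodule.mem_map_of_mem h, fun h => ?_⟩
    obtain ⟨y, hy, hxy⟩ := h
    rwa [← (hφ _).1 hxy]
  · rintro r hr p q hpq ⟨_, y, hy, rfl⟩ z hz
    obtain ⟨x, hx, rfl⟩ := mem_filtHomology.1 hy
    rw [hf r hr p q hpq x hx] at hz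
    rw [hf (r + 1) _ p q _ x hx]
    exact hE.iso_proj r hr p q _ _ rfl z hz

end

/-- If the second page of a convergent spectral sequence is concentrated in the row `q = 0`, then
this row is isomorphic to the target. -/
theorem ConvergesTo.nonempty_iso (hQ : IsQuadrantShape c v wt) {E : QuadrantSS R v}
    {H : ℕ → ModuleCat.{u} R} {F : ℤ → ∀ n, Submodule R (H n)} (hE : ConvergesTo E H F wt)
    (h0 : ∀ p q : ℕ, q ≠ 0 → IsZero ((E.page 2 le_rfl).X (p, q))) (n : ℕ) :
    Nonempty (H n ≅ (E.page 2 le_rfl).X (n, 0)) := by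
  have hz : ∀ (r : ℤ) (hr : 2 ≤ r) (p q : ℕ), q ≠ 0 → IsZero ((E.page r hr).X (p, q)) := by
    intro r hr
    induction r, hr using Int.leInduction with
    | base => exact h0
    | succ r hr ih =>
      intro p q hq
      refine IsZero.of_iso ?_ (E.iso r (r + 1) (p, q) rfl hr).symm
      exact (HomologicalComplex.exactAt_iff_isZero_homology _ _).1 (.of_isZero (ih p q hq))
  -- all differentials into and out of the row `q = 0` vanish
  have hi : ∀ (r : ℤ) (hr : 2 ≤ r),
      Nonempty ((E.page r hr).X (n, 0) ≅ (E.page 2 le_rfl).X (n, 0)) := by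
    intro r hr
    induction r, hr using Int.leInduction with
    | base => exact ⟨Iso.refl _⟩
    | succ r hr ih =>
      obtain ⟨e⟩ := ih
      obtain ⟨s, hs, -, -, hv⟩ := hQ
      have hfrom : ∀ a, (E.page r hr).d (n, 0) a = 0 := by
        rintro ⟨p, q⟩
        by_cases h : (ComplexShape.spectralSequenceNat (v r)).Rel (n, 0) (p, q)
        · rw [ComplexShape.spectralSequenceNat_rel_iff, hv] at h
          refine (hz r hr p q ?_).eq_of_tgt _ _
          rintro rfl
          rcases hs with rfl | rfl <;> (dsimp only at h; lia)
        · exact HomologicalComplex.shape _ _ _ h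
      have hto : ∀ a, (E.page r hr).d a (n, 0) = 0 := by
        rintro ⟨p, q⟩
        by_cases h : (ComplexShape.spectralSequenceNat (v r)).Rel (p, q) (n, 0)
        · rw [ComplexShape.spectralSequenceNat_rel_iff, hv] at h
          refine (hz r hr p q ?_).eq_of_src _ _
          rintro rfl
          rcases hs with rfl | rfl <;> (dsimp only at h; lia)
        · exact HomologicalComplex.shape _ _ _ h
      have := (E.page r hr).isIso_iCycles (n, 0) _ rfl (hfrom _)
      have := (E.page r hr).isIso_homologyπ _ (n, 0) rfl (hto _)
      exact ⟨(E.iso r (r + 1) (n, 0) rfl hr).symm ≪≫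
        (asIso ((E.page r hr).homologyπ (n, 0))).symm ≪≫
          asIso ((E.page r hr).iCycles (n, 0)) ≪≫ e⟩
  -- the graded pieces of the target off the row `q = 0` vanish, so the filtration has one jump only
  have hstep : ∀ k, k ≠ wt n → F k n = F (k - 1) n := by
    intro k hk
    by_cases hp : ∃ p q : ℕ, p + q = n ∧ wt p = k
    · obtain ⟨p, q, rfl, rfl⟩ := hp
      refine le_antisymm (fun x hx => ?_) (hE.mono _ _ _ (by lia))
      have hq : q ≠ 0 := by
        rintro rfl
        exact hk rfl
      refine (hE.proj_eq_zero_iff (p + q + 2) (by lia) p q le_rfl ⟨x, hx⟩).1 ?_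
      have := ModuleCat.subsingleton_of_isZero (hz (p + q + 2) (by lia) p q hq)
      exact Subsingleton.elim _ _
    · obtain ⟨s, hs, -, hw, -⟩ := hQ
      have hp' : (∀ p ≤ n, k < wt p) ∨ (∀ p ≤ n, wt p ≤ k - 1) := by
        simp only [hw] at hp ⊢
        by_contra hcon
        apply hp
        simp only [not_or, not_forall] at hcon
        obtain ⟨⟨a, ha, ha'⟩, b, hb, hb'⟩ := hcon
        rcases hs with rfl | rfl
        · exact ⟨k.toNat, n - k.toNat, by lia, by lia⟩
        · exact ⟨(-k).toNat, n - (-k).toNat, by lia, by lia⟩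
      rcases hp' with hp' | hp'
      · rw [hE.eq_bot k n hp', hE.eq_bot (k - 1) n fun p hp => by linarith [hp' p hp]]
      · rw [hE.eq_top (k - 1) n hp', hE.eq_top k n fun p hp => by linarith [hp' p hp]]
  have hbot : F (wt n - 1) n = ⊥ := by
    obtain ⟨s, rfl | rfl, -, hw, -⟩ := hQ
    · have : ∀ j : ℕ, j ≤ n → F ((j : ℤ) - 1) n = ⊥ := by
        intro j
        induction j with
        | zero => exact fun _ => hE.eq_bot _ _ fun p hp => by rw [hw]; lia
        | succ j ih =>
          intro hj
          have hj' : ((j + 1 : ℕ) : ℤ) - 1 = j := by lia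
          rw [hj', hstep _ (by rw [hw]; lia), ih (by lia)]
      rw [hw, one_mul]
      exact this n le_rfl
    · exact hE.eq_bot _ _ fun p hp => by rw [hw, hw]; lia
  have htop : F (wt n) n = ⊤ := by
    obtain ⟨s, rfl | rfl, -, hw, -⟩ := hQ
    · exact hE.eq_top _ _ fun p hp => by rw [hw, hw]; lia
    · have : ∀ j : ℕ, F (-(n : ℤ) + j) n = F (-(n : ℤ)) n := by
        intro j
        induction j with
        | zero => simp
        | succ j ih =>
          rw [← ih, hstep _ (by rw [hw]; lia)]
          congr 1
          lia
      rw [hw, neg_one_mul, ← this n]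
      exact hE.eq_top _ _ fun p hp => by rw [hw]; lia
  obtain ⟨e⟩ := hi (n + 2) (by lia)
  have hinj : Function.Injective (hE.proj (n + 2) (by lia) n 0 (by simp)) := by
    rw [injective_iff_map_eq_zero]
    intro x hx
    rw [hE.proj_eq_zero_iff] at hx
    have hx' : (x : H (n + 0)) ∈ (⊥ : Submodule R (H n)) := hbot ▸ hx
    exact Subtype.ext ((Submodule.mem_bot R).1 hx')
  let e' := LinearEquiv.ofBijective _ ⟨hinj, hE.proj_surjective (n + 2) (by lia) n 0 (by simp)⟩
  exact ⟨((LinearEquiv.ofTop _ htop).symm.trans e').toModuleIso ≪≫ e⟩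

end

/-! ### The second page of the spectral sequence of a bicomplex -/

namespace IsQuadrantShape

variable {c : ComplexShape ℕ} {v : ℤ → ℤ × ℤ} {wt : ℕ → ℤ} (h : IsQuadrantShape c v wt)
include h

lemma rel_add_left {q q' : ℕ} (hq : c.Rel q q') (p : ℕ) : c.Rel (p + q) (p + q') := by
  obtain ⟨s, hs, hc, -⟩ := h
  rw [hc] at hq ⊢
  push_cast
  lia

lemma rel_add_right {p p' : ℕ} (hp : c.Rel p p') (q : ℕ) : c.Rel (p + q) (p' + q) := by
  obtain ⟨s, hs, hc, -⟩ := h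
  rw [hc] at hp ⊢
  push_cast
  lia

lemma rel_of_wt_eq {p p' : ℕ} (hp : wt p' = wt p - 1) : c.Rel p p' := by
  obtain ⟨s, hs, hc, hw, -⟩ := h
  rw [hw, hw] at hp
  rw [hc]
  rcases hs with rfl | rfl <;> lia

end IsQuadrantShape

section
variable {R : Type u} [CommRing R] {c : ComplexShape ℕ}

/-- Coordinates which exhibit the complex `K` as a total complex of the bicomplex `B`: maps
`proj p q n` and `incl p q n` between `K` in degree `n` and `B` in bidegree `(p, q)`, which for
`p + q = n` are the projections and inclusions of a direct sum, such that the differential of `K`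
is up to signs the sum of the differentials of `B`. -/
structure BicomplexCoordinates (K : HomologicalComplex (ModuleCat.{u} R) c)
    (B : HomologicalComplex₂ (ModuleCat.{u} R) c c) where
  /-- the projection to bidegree `(p, q)` -/
  proj (p q n : ℕ) : K.X n →ₗ[R] (B.X p).X q
  /-- the inclusion of bidegree `(p, q)` -/
  incl (p q n : ℕ) : (B.X p).X q →ₗ[R] K.X n
  proj_incl (p q n : ℕ) (h : p + q = n) (x : (B.X p).X q) : proj p q n (incl p q n x) = x
  proj_incl_of_ne' (p q p' q' n : ℕ) (h : p ≠ p' ∨ q ≠ q') (x : (B.X p).X q) :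
    proj p' q' n (incl p q n x) = 0
  eq_zero (n : ℕ) (x : K.X n) (h : ∀ p q, p + q = n → proj p q n x = 0) : x = 0
  proj_d (p q n m : ℕ) (hnm : c.Rel n m) (h : p + q = m) : ∃ a b : R, a * a = 1 ∧ b * b = 1 ∧
    ∀ x, proj p q m ((K.d n m).hom x) =
      a • ((B.X p).d (c.prev q) q).hom (proj p (c.prev q) n x) +
      b • ((B.d (c.prev p) p).f q).hom (proj (c.prev p) q n x)

variable {K : HomologicalComplex (ModuleCat.{u} R) c}
  {B : HomologicalComplex₂ (ModuleCat.{u} R) c c}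
  (Φ : BicomplexCoordinates K B) {v : ℤ → ℤ × ℤ} {wt : ℕ → ℤ}

/-- The filtration of a total complex by columns. -/
noncomputable def BicomplexCoordinates.filt (wt : ℕ → ℤ) (k : ℤ) (n : ℕ) : Submodule R (K.X n) :=
  ⨅ (p : ℕ) (q : ℕ) (_ : p + q = n ∧ k < wt p), LinearMap.ker (Φ.proj p q n)

/-- The `q`-th row of the first page of a bicomplex: the complex of the `q`-th homology modules of
the columns. -/
noncomputable abbrev homologyRow (B : HomologicalComplex₂ (ModuleCat.{u} R) c c) (q : ℕ) :
    HomologicalComplex (ModuleCat.{u} R) c :=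
  ((HomologicalComplex.homologyFunctor (ModuleCat.{u} R) c q).mapHomologicalComplex c).obj B

/-- The class of a cycle of a column of `B`, as an element of a row of the first page. -/
noncomputable def homologyRowClass (B : HomologicalComplex₂ (ModuleCat.{u} R) c c) (q p : ℕ) :
    cycleSubmodule (B.X p) q →ₗ[R] (homologyRow B q).X p :=
  homologyClass (B.X p) q

lemma homologyRowClass_surjective (q p : ℕ) : Function.Surjective (homologyRowClass B q p) :=
  homologyClass_surjective _ _

lemma homologyRowClass_eq_zero_iff (q p : ℕ) (x : cycleSubmodule (B.X p) q) :
    homologyRowClass B q p x = 0 ↔ ∃ j, ∃ w, ((B.X p).d j q).hom w = x :=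
  homologyClass_eq_zero_iff _ _ _

lemma homologyRow_d_class (q p p' : ℕ) (x : cycleSubmodule (B.X p) q) :
    ((homologyRow B q).d p p').hom (homologyRowClass B q p x) =
      homologyRowClass B q p' ⟨((B.d p p').f q).hom x, map_mem_cycleSubmodule _ x.2⟩ :=
  homologyMap_homologyClass _ _

namespace BicomplexCoordinates

lemma proj_incl_of_ne (p q p' q' n : ℕ) (h : p ≠ p') (x : (B.X p).X q) :
    Φ.proj p' q' n (Φ.incl p q n x) = 0 :=
  Φ.proj_incl_of_ne' p q p' q' n (.inl h) x

lemma mem_filt {k : ℤ} {n : ℕ} {x : K.X n} :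
    x ∈ Φ.filt wt k n ↔ ∀ p q, p + q = n → k < wt p → Φ.proj p q n x = 0 := by
  simp [filt, Submodule.mem_iInf]

lemma incl_mem_filt {k : ℤ} {p q n : ℕ} (hp : wt p ≤ k) (x : (B.X p).X q) :
    Φ.incl p q n x ∈ Φ.filt wt k n := by
  refine Φ.mem_filt.2 fun p' q' _ h => Φ.proj_incl_of_ne _ _ _ _ _ ?_ _
  rintro rfl
  lia

/-- The vertical part of the differential. -/
lemma exists_proj_d_vert {p q q' n m : ℕ} (hq : c.Rel q q') (hnm : c.Rel n m) (h : p + q' = m) :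
    ∃ a : R, a * a = 1 ∧ ∀ x, (∀ p₀, c.Rel p₀ p → Φ.proj p₀ q' n x = 0) →
      Φ.proj p q' m ((K.d n m).hom x) = a • ((B.X p).d q q').hom (Φ.proj p q n x) := by
  obtain ⟨a, b, ha, -, hab⟩ := Φ.proj_d p q' n m hnm h
  refine ⟨a, ha, fun x hx => ?_⟩
  rw [hab]
  obtain rfl := c.prev_eq' hq
  by_cases hp : c.Rel (c.prev p) p
  · rw [hx _ hp, map_zero, smul_zero, add_zero]
  · rw [B.shape _ _ hp]
    simp

/-- The horizontal part of the differential. -/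
lemma exists_proj_d_horiz {p p' q n m : ℕ} (hp : c.Rel p p') (hnm : c.Rel n m) (h : p' + q = m) :
    ∃ a b : R, a * a = 1 ∧ b * b = 1 ∧ ∀ x, Φ.proj p' q m ((K.d n m).hom x) =
      a • ((B.X p').d (c.prev q) q).hom (Φ.proj p' (c.prev q) n x) +
      b • ((B.d p p').f q).hom (Φ.proj p q n x) := by
  obtain rfl := c.prev_eq' hp
  exact Φ.proj_d p' q n m hnm h

variable (hQ : IsQuadrantShape c v wt)
include hQ

theorem isBoundedFiltration : IsBoundedFiltration K (Φ.filt wt) wt where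
  mono n h x hx := Φ.mem_filt.2 fun p q hpq hk => Φ.mem_filt.1 hx p q hpq (by lia)
  d_mem {k n} m {x} hx := by
    by_cases hnm : c.Rel n m
    · refine Φ.mem_filt.2 fun p q hpq hk => ?_
      obtain ⟨a, b, -, -, hab⟩ := Φ.proj_d p q n m hnm hpq
      rw [hab]
      have h1 : ((B.X p).d (c.prev q) q).hom (Φ.proj p (c.prev q) n x) = 0 := by
        by_cases hq : c.Rel (c.prev q) q
        · have hr := hQ.rel_add_left hq p
          rw [hpq] at hr
          rw [Φ.mem_filt.1 hx _ _ ((c.prev_eq' hr).symm.trans (c.prev_eq' hnm)) hk, map_zero]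
        · rw [HomologicalComplex.shape _ _ _ hq]; rfl
      have h2 : ((B.d (c.prev p) p).f q).hom (Φ.proj (c.prev p) q n x) = 0 := by
        by_cases hp : c.Rel (c.prev p) p
        · have hr := hQ.rel_add_right hp q
          rw [hpq] at hr
          have := hQ.wt_eq_of_rel hp
          rw [Φ.mem_filt.1 hx _ _ ((c.prev_eq' hr).symm.trans (c.prev_eq' hnm)) (by lia), map_zero]
        · rw [B.shape _ _ hp]; rfl
      rw [h1, h2, smul_zero, smul_zero, add_zero]
    · rw [K.shape _ _ hnm]
      exact zero_mem _
  eq_bot {k n} h := (Submodule.eq_bot_iff _).2 fun x hx =>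
    Φ.eq_zero n x fun p q hpq => Φ.mem_filt.1 hx p q hpq (h p (by lia))
  eq_top {k n} h := Submodule.eq_top_iff'.2 fun x => Φ.mem_filt.2 fun p q hpq hk => by
    have := h p (by lia)
    lia

/-- The leading coefficient of an element of `Z²` is a vertical cycle; more generally this holds
for the leading coefficient of an element of `Z¹`. -/
lemma proj_mem_cycleSubmodule {p q n : ℕ} (hpq : p + q = n) {x : K.X n}
    (hx : x ∈ Φ.filt wt (wt p) n) (hd : ∀ m, (K.d n m).hom x ∈ Φ.filt wt (wt p - 1) m) :
    Φ.proj p q n x ∈ cycleSubmodule (B.X p) q := by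
  subst hpq
  refine mem_cycleSubmodule_of_rel fun q' hq => ?_
  have hr := hQ.rel_add_left hq p
  obtain ⟨a, ha, h⟩ := Φ.exists_proj_d_vert hq hr rfl
  have h1 := h x fun p₀ hp₀ => by
    have hr' := hQ.rel_add_right hp₀ q'
    have := hQ.wt_eq_of_rel hp₀
    exact Φ.mem_filt.1 hx _ _ ((c.prev_eq' hr').symm.trans (c.prev_eq' hr)) (by lia)
  rw [Φ.mem_filt.1 (hd _) p q' rfl (by lia)] at h1
  rw [← one_smul R (((B.X p).d q q').hom _), ← ha, mul_smul, ← h1, smul_zero]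

/-- A vertical boundary in bidegree `(p, q)` is the leading coefficient of a boundary of an element
of the `p`-th filtration step. -/
lemma exists_proj_d_eq_vert {p q n m : ℕ} (hpq : p + q = m) (hnm : c.Rel n m) {j : ℕ}
    (w : (B.X p).X j) :
    ∃ x ∈ Φ.filt wt (wt p) n, Φ.proj p q m ((K.d n m).hom x) = ((B.X p).d j q).hom w ∧
      ∀ p' q', p ≠ p' → Φ.proj p' q' n x = 0 := by
  by_cases hj : c.Rel j q
  · obtain ⟨a, ha, h⟩ := Φ.exists_proj_d_vert hj hnm hpq
    have hr := hQ.rel_add_left hj p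
    rw [hpq] at hr
    have hpj : p + j = n := (c.prev_eq' hr).symm.trans (c.prev_eq' hnm)
    refine ⟨Φ.incl p j n (a • w), Φ.incl_mem_filt le_rfl _, ?_,
      fun p' q' hp' => Φ.proj_incl_of_ne _ _ _ _ _ hp' _⟩
    rw [h, Φ.proj_incl _ _ _ hpj, map_smul, smul_smul, ha, one_smul]
    intro p₀ hp₀
    refine Φ.proj_incl_of_ne _ _ _ _ _ ?_ _
    rintro rfl
    have := hQ.wt_eq_of_rel hp₀
    lia
  · refine ⟨0, zero_mem _, ?_, fun _ _ _ => map_zero _⟩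
    rw [HomologicalComplex.shape _ _ _ hj]
    simp

/-- A vertical boundary in bidegree `(p, q)` is the leading coefficient of an element of `B²`. -/
lemma exists_mem_filtBoundaries_vert {p q n : ℕ} (hpq : p + q = n) {j : ℕ} (w : (B.X p).X j) :
    ∃ b ∈ filtBoundaries K (Φ.filt wt) 2 (wt p) n, b ∈ Φ.filt wt (wt p) n ∧
      b ∈ cycleSubmodule K n ∧ Φ.proj p q n b = ((B.X p).d j q).hom w := by
  have hF := Φ.isBoundedFiltration hQ
  by_cases hj : c.Rel j q
  · have hr := hQ.rel_add_left hj p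
    rw [hpq] at hr
    obtain ⟨x, hx, hd, -⟩ := Φ.exists_proj_d_eq_vert hQ hpq hr w
    refine ⟨_, mem_filtBoundaries.2 ⟨0, zero_mem _, _, x, mem_filtCycles.2
      ⟨hF.mono _ (by lia) hx, fun m' => hF.mono _ (by lia) (hF.d_mem m' hx)⟩, (zero_add _).symm⟩,
      hF.d_mem _ hx, mem_cycleSubmodule.2 fun m' => d_d_apply K x, hd⟩
  · refine ⟨0, zero_mem _, zero_mem _, zero_mem _, ?_⟩
    rw [HomologicalComplex.shape _ _ _ hj]
    simp

/-- The horizontal differential of a vertical cycle is the leading coefficient of an element of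
`B²`. -/
lemma exists_mem_filtBoundaries_horiz {p q n : ℕ} (hpq : p + q = n) {p₀ : ℕ} {w : (B.X p₀).X q}
    (hw : w ∈ cycleSubmodule (B.X p₀) q) :
    ∃ b ∈ filtBoundaries K (Φ.filt wt) 2 (wt p) n, b ∈ Φ.filt wt (wt p) n ∧
      b ∈ cycleSubmodule K n ∧ Φ.proj p q n b = ((B.d p₀ p).f q).hom w := by
  have hF := Φ.isBoundedFiltration hQ
  by_cases hp : c.Rel p₀ p
  · have hr := hQ.rel_add_right hp q
    rw [hpq] at hr
    have hwt := hQ.wt_eq_of_rel hp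
    obtain ⟨a, b, -, hb, h⟩ := Φ.exists_proj_d_horiz hp hr hpq
    have hx : Φ.incl p₀ q (p₀ + q) (b • w) ∈ Φ.filt wt (wt p + 1) (p₀ + q) :=
      Φ.incl_mem_filt (by lia) _
    have hdx : (K.d (p₀ + q) n).hom (Φ.incl p₀ q (p₀ + q) (b • w)) ∈ Φ.filt wt (wt p) n := by
      refine Φ.mem_filt.2 fun p₁ q₁ h₁ hlt => ?_
      rcases (by lia : wt p₁ = wt p + 1 ∨ wt p + 1 < wt p₁) with h₂ | h₂
      · obtain rfl : p₀ = p₁ := hQ.wt_injective (by lia)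
        by_cases hq₁ : c.Rel (c.prev q₁) q₁
        · obtain ⟨a', -, h'⟩ := Φ.exists_proj_d_vert hq₁ hr h₁
          have hr' := hQ.rel_add_left hq₁ p₀
          rw [h₁] at hr'
          have hq : c.prev q₁ = q := by
            have := (c.prev_eq' hr').symm.trans (c.prev_eq' hr)
            lia
          rw [h', hq, Φ.proj_incl _ _ _ rfl, map_smul, mem_cycleSubmodule.1 hw, smul_zero,
            smul_zero]
          intro p₂ hp₂
          refine Φ.proj_incl_of_ne _ _ _ _ _ ?_ _
          rintro rfl
          have := hQ.wt_eq_of_rel hp₂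
          lia
        · obtain ⟨a', b', -, -, h'⟩ := Φ.proj_d p₀ q₁ _ _ hr h₁
          rw [h', HomologicalComplex.shape _ _ _ hq₁, ModuleCat.hom_zero, LinearMap.zero_apply,
            smul_zero, zero_add]
          by_cases hp₂ : c.Rel (c.prev p₀) p₀
          · have hne : p₀ ≠ c.prev p₀ := by
              intro he
              have := hQ.wt_eq_of_rel hp₂
              rw [← he] at this
              lia
            rw [Φ.proj_incl_of_ne _ _ _ _ _ hne, map_zero, smul_zero]
          · rw [B.shape _ _ hp₂, HomologicalComplex.zero_f, ModuleCat.hom_zero,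
              LinearMap.zero_apply, smul_zero]
      · exact Φ.mem_filt.1 (hF.d_mem n hx) p₁ q₁ h₁ h₂
    refine ⟨_, mem_filtBoundaries.2 ⟨0, zero_mem _, _, _, mem_filtCycles_of_rel
      (hF.mono _ (by lia) hx) fun m' hm' => ?_, (zero_add _).symm⟩, hdx,
      mem_cycleSubmodule.2 fun m' => d_d_apply K _, ?_⟩
    · obtain rfl : n = m' := (c.next_eq' hr).symm.trans (c.next_eq' hm')
      exact hF.mono _ (by lia) hdx
    · rw [h, Φ.proj_incl _ _ _ rfl, Φ.proj_incl_of_ne, map_zero, smul_zero, zero_add, map_smul,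
        smul_smul, hb, one_smul]
      rintro rfl
      lia
  · refine ⟨0, zero_mem _, zero_mem _, zero_mem _, ?_⟩
    rw [B.shape _ _ hp]
    simp

/-- The class of the leading coefficient of an element of `Z²` in the vertical homology. -/
noncomputable def vertClass (p q : ℕ) :
    filtCycles K (Φ.filt wt) 2 (wt p) (p + q) →ₗ[R] (homologyRow B q).X p :=
  (homologyRowClass B q p).comp
    (((Φ.proj p q (p + q)).comp (Submodule.subtype _)).codRestrict _ fun x =>
      Φ.proj_mem_cycleSubmodule hQ rfl (mem_filtCycles.1 x.2).1
        fun m => (Φ.isBoundedFiltration hQ).mono _ (by lia) ((mem_filtCycles.1 x.2).2 m))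

lemma vertClass_apply (p q : ℕ) (x : filtCycles K (Φ.filt wt) 2 (wt p) (p + q)) :
    Φ.vertClass hQ p q x = homologyRowClass B q p ⟨Φ.proj p q (p + q) x,
      Φ.proj_mem_cycleSubmodule hQ rfl (mem_filtCycles.1 x.2).1
        fun m => (Φ.isBoundedFiltration hQ).mono _ (by lia) ((mem_filtCycles.1 x.2).2 m)⟩ := rfl

lemma vertClass_mem_cycleSubmodule (p q : ℕ)
    (x : filtCycles K (Φ.filt wt) 2 (wt p) (p + q)) :
    Φ.vertClass hQ p q x ∈ cycleSubmodule (homologyRow B q) p := by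
  refine mem_cycleSubmodule_of_rel fun p' hp => ?_
  rw [vertClass_apply, homologyRow_d_class, homologyRowClass_eq_zero_iff]
  have hwt := hQ.wt_eq_of_rel hp
  obtain ⟨a, b, -, hb, h⟩ := Φ.exists_proj_d_horiz hp (hQ.rel_add_right hp q) rfl
  have h0 := h x.1
  rw [Φ.mem_filt.1 ((mem_filtCycles.1 x.2).2 _) p' q rfl (by lia), eq_comm,
    add_eq_zero_iff_neg_eq] at h0
  refine ⟨_, -(b * a) • Φ.proj p' (c.prev q) (p + q) x.1, ?_⟩
  rw [map_smul, neg_smul, mul_smul, ← smul_neg, h0, smul_smul, hb, one_smul]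

/-- The map from `Z²` to the homology of a row of vertical homology modules. -/
noncomputable def secondPageProj (p q : ℕ) :
    filtCycles K (Φ.filt wt) 2 (wt p) (p + q) →ₗ[R] (homologyRow B q).homology p :=
  (homologyClass (homologyRow B q) p).comp
    ((Φ.vertClass hQ p q).codRestrict _ (Φ.vertClass_mem_cycleSubmodule hQ p q))

lemma secondPageProj_eq_zero_iff_vertClass (p q : ℕ)
    (x : filtCycles K (Φ.filt wt) 2 (wt p) (p + q)) :
    Φ.secondPageProj hQ p q x = 0 ↔
      ∃ p₀, ∃ u, ((homologyRow B q).d p₀ p).hom u = Φ.vertClass hQ p q x :=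
  homologyClass_eq_zero_iff _ _ _

lemma secondPageProj_surjective (p q : ℕ) :
    Function.Surjective (Φ.secondPageProj hQ p q) := fun y => by
  have hF := Φ.isBoundedFiltration hQ
  obtain ⟨⟨y, hy⟩, rfl⟩ := homologyClass_surjective _ _ y
  obtain ⟨⟨y, hyc⟩, rfl⟩ := homologyRowClass_surjective _ _ y
  suffices h : ∃ x ∈ filtCycles K (Φ.filt wt) 2 (wt p) (p + q), Φ.proj p q (p + q) x = y by
    obtain ⟨x, hx, rfl⟩ := h
    exact ⟨⟨x, hx⟩, rfl⟩
  have hι : Φ.incl p q (p + q) y ∈ Φ.filt wt (wt p) (p + q) := Φ.incl_mem_filt le_rfl _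
  -- the differential of `y` has no component in the `p`-th column, since `y` is a vertical cycle
  have hdι : ∀ m, c.Rel (p + q) m → ∀ q', p + q' = m →
      Φ.proj p q' m ((K.d (p + q) m).hom (Φ.incl p q (p + q) y)) = 0 := by
    intro m hm q' hq'
    obtain ⟨a, b, -, -, h⟩ := Φ.proj_d p q' (p + q) m hm hq'
    rw [h]
    have h1 : ((B.X p).d (c.prev q') q').hom (Φ.proj p (c.prev q') (p + q)
        (Φ.incl p q (p + q) y)) = 0 := by
      by_cases hr : c.Rel (c.prev q') q'
      · have hr' := hQ.rel_add_left hr p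
        rw [hq'] at hr'
        have he : c.prev q' = q := by
          have := (c.prev_eq' hr').symm.trans (c.prev_eq' hm)
          lia
        rw [he, Φ.proj_incl _ _ _ rfl, mem_cycleSubmodule.1 hyc]
      · rw [HomologicalComplex.shape _ _ _ hr]; rfl
    have h2 : ((B.d (c.prev p) p).f q').hom (Φ.proj (c.prev p) q' (p + q)
        (Φ.incl p q (p + q) y)) = 0 := by
      by_cases hp : c.Rel (c.prev p) p
      · rw [Φ.proj_incl_of_ne, map_zero]
        intro he
        have := hQ.wt_eq_of_rel hp
        rw [← he] at this
        lia
      · rw [B.shape _ _ hp]; rfl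
    rw [h1, h2, smul_zero, smul_zero, add_zero]
  by_cases hp : ∃ p', c.Rel p p'
  -- the horizontal part is a vertical boundary; subtracting an element that bounds it raises the
  -- drop in filtration of the differential to `2`
  · obtain ⟨p', hp⟩ := hp
    have hwt := hQ.wt_eq_of_rel hp
    have hne : p' ≠ p := by
      rintro rfl
      lia
    have hr := hQ.rel_add_right hp q
    have h0 := mem_cycleSubmodule.1 hy p'
    rw [homologyRow_d_class, homologyRowClass_eq_zero_iff] at h0
    obtain ⟨j, w, hw⟩ := h0
    obtain ⟨a, b, -, -, h⟩ := Φ.exists_proj_d_horiz hp hr rfl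
    obtain ⟨x, hx, hxd, hx0⟩ := Φ.exists_proj_d_eq_vert hQ rfl hr (b • w)
    refine ⟨Φ.incl p q (p + q) y - x, mem_filtCycles_of_rel
      (sub_mem hι (hF.mono _ (by lia) hx)) fun m hm => ?_, ?_⟩
    · obtain rfl : m = p' + q := (c.next_eq' hm).symm.trans (c.next_eq' hr)
      refine Φ.mem_filt.2 fun p₁ q₁ h₁ hlt => ?_
      rcases (by lia : wt p₁ = wt p - 1 ∨ wt p₁ = wt p ∨ wt p < wt p₁) with h₂ | h₂ | h₂
      · obtain rfl : p₁ = p' := hQ.wt_injective (by lia)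
        obtain rfl : q₁ = q := by lia
        rw [map_sub, map_sub, hxd, h, Φ.proj_incl _ _ _ rfl, Φ.proj_incl_of_ne _ _ _ _ _ hne.symm,
          map_zero, smul_zero, zero_add, map_smul, hw, sub_self]
      · obtain rfl : p₁ = p := hQ.wt_injective (by lia)
        rw [map_sub, map_sub, hdι _ hm _ h₁, zero_sub, neg_eq_zero]
        exact Φ.mem_filt.1 (hF.d_mem _ hx) _ _ h₁ (by lia)
      · exact Φ.mem_filt.1 (hF.d_mem _ (sub_mem hι (hF.mono _ (by lia) hx))) _ _ h₁ h₂
    · rw [map_sub, Φ.proj_incl _ _ _ rfl, hx0 _ _ hne, sub_zero]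
  · refine ⟨Φ.incl p q (p + q) y, mem_filtCycles_of_rel hι fun m hm => ?_, Φ.proj_incl _ _ _ rfl _⟩
    refine Φ.mem_filt.2 fun p₁ q₁ h₁ hlt => ?_
    rcases (by lia : wt p₁ = wt p - 1 ∨ wt p₁ = wt p ∨ wt p < wt p₁) with h₂ | h₂ | h₂
    · exact (hp ⟨p₁, hQ.rel_of_wt_eq h₂⟩).elim
    · obtain rfl : p₁ = p := hQ.wt_injective (by lia)
      exact hdι _ hm _ h₁
    · exact Φ.mem_filt.1 (hF.d_mem _ hι) _ _ h₁ h₂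

lemma secondPageProj_eq_zero_iff (p q : ℕ) (x : filtCycles K (Φ.filt wt) 2 (wt p) (p + q)) :
    Φ.secondPageProj hQ p q x = 0 ↔
      (x : K.X (p + q)) ∈ filtBoundaries K (Φ.filt wt) 2 (wt p) (p + q) := by
  have hF := Φ.isBoundedFiltration hQ
  have hx := mem_filtCycles.1 x.2
  rw [secondPageProj_eq_zero_iff_vertClass]
  constructor
  · rintro ⟨p₀, u, hu⟩
    obtain ⟨⟨u, huc⟩, rfl⟩ := homologyRowClass_surjective _ _ u
    rw [homologyRow_d_class, vertClass_apply, eq_comm, ← sub_eq_zero, ← map_sub,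
      homologyRowClass_eq_zero_iff] at hu
    obtain ⟨j, w, hw⟩ := hu
    obtain ⟨b₁, hb₁, hb₁F, hb₁c, hb₁p⟩ :=
      Φ.exists_mem_filtBoundaries_vert hQ (rfl : p + q = p + q) w
    obtain ⟨b₂, hb₂, hb₂F, hb₂c, hb₂p⟩ :=
      Φ.exists_mem_filtBoundaries_horiz hQ (rfl : p + q = p + q) huc
    have hz : x.1 - b₁ - b₂ ∈ filtBoundaries K (Φ.filt wt) 2 (wt p) (p + q) := by
      refine mem_filtBoundaries.2 ⟨_, mem_filtCycles.2 ⟨Φ.mem_filt.2 fun p₁ q₁ h₁ hlt => ?_,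
        fun m => ?_⟩, p + q, 0, zero_mem _, by rw [map_zero, add_zero]⟩
      · rcases (by lia : wt p₁ = wt p ∨ wt p < wt p₁) with h₂ | h₂
        · obtain rfl : p₁ = p := hQ.wt_injective (by lia)
          obtain rfl : q₁ = q := by lia
          rw [map_sub, map_sub, hb₁p, hb₂p, hw, Submodule.coe_sub]
          abel
        · exact Φ.mem_filt.1 (sub_mem (sub_mem hx.1 hb₁F) hb₂F) _ _ h₁ h₂
      · rw [map_sub, map_sub, mem_cycleSubmodule.1 hb₁c, mem_cycleSubmodule.1 hb₂c, sub_zero,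
          sub_zero]
        exact hF.mono _ (by lia) (hx.2 m)
    have := add_mem (add_mem hz hb₂) hb₁
    rwa [sub_add_cancel, sub_add_cancel] at this
  · intro h
    obtain ⟨z, hz, m, w, hw, hxz⟩ := mem_filtBoundaries.1 h
    have hwF := mem_filtCycles.1 hw
    have hz0 : Φ.proj p q (p + q) z = 0 := Φ.mem_filt.1 (mem_filtCycles.1 hz).1 _ _ rfl (by lia)
    by_cases hm : c.Rel m (p + q)
    · obtain ⟨a, b, -, -, hab⟩ := Φ.proj_d p q m (p + q) hm rfl
      by_cases hp : c.Rel (c.prev p) p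
      · have hwt := hQ.wt_eq_of_rel hp
        have hr := hQ.rel_add_right hp q
        have hwc : Φ.proj (c.prev p) q m w ∈ cycleSubmodule (B.X (c.prev p)) q := by
          refine Φ.proj_mem_cycleSubmodule (wt := wt) hQ
            ((c.prev_eq' hr).symm.trans (c.prev_eq' hm)) (hF.mono _ (by lia) hwF.1) fun m' =>
              hF.mono _ (by lia) (hwF.2 m')
        refine ⟨c.prev p, homologyRowClass _ _ _ ⟨_, Submodule.smul_mem _ b hwc⟩, ?_⟩
        rw [homologyRow_d_class, vertClass_apply, eq_comm, ← sub_eq_zero, ← map_sub,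
          homologyRowClass_eq_zero_iff]
        refine ⟨_, a • Φ.proj p (c.prev q) m w, ?_⟩
        have key := congrArg (Φ.proj p q (p + q)) hxz
        rw [map_add, hz0, hab, zero_add] at key
        rw [Submodule.coe_sub]
        refine Eq.trans ?_ (congrArg (· - _) key.symm)
        rw [map_smul, ← map_smul ((B.d (c.prev p) p).f q).hom]
        exact (add_sub_cancel_right _ _).symm
      · refine ⟨p, 0, ?_⟩
        rw [map_zero, vertClass_apply, eq_comm, homologyRowClass_eq_zero_iff]
        refine ⟨_, a • Φ.proj p (c.prev q) m w, ?_⟩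
        have key := congrArg (Φ.proj p q (p + q)) hxz
        rw [map_add, hz0, hab, zero_add, B.shape _ _ hp, HomologicalComplex.zero_f,
          ModuleCat.hom_zero, LinearMap.zero_apply, smul_zero, add_zero] at key
        rw [map_smul]
        exact key.symm
    · refine ⟨p, 0, ?_⟩
      rw [map_zero, vertClass_apply, eq_comm, homologyRowClass_eq_zero_iff]
      refine ⟨q, 0, ?_⟩
      have key : Φ.proj p q (p + q) x.1 = 0 := by
        rw [hxz, map_add, hz0, K.shape _ _ hm, ModuleCat.hom_zero, LinearMap.zero_apply, map_zero,
          add_zero]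
      rw [map_zero]
      exact key.symm

/-- The second page of the spectral sequence of a bicomplex filtered by columns is the horizontal
homology of the vertical homology. -/
theorem nonempty_secondPage_iso {E : QuadrantSS R v} (hE : IsFiltrationSS E K (Φ.filt wt) wt)
    (p q : ℕ) : Nonempty ((E.page 2 le_rfl).X (p, q) ≅ (homologyRow B q).homology p) := by
  obtain ⟨e, -⟩ := exists_equiv_of_surjective _ _ (hE.proj_surjective 2 le_rfl p q)
    (Φ.secondPageProj_surjective hQ p q) fun x => by
      rw [hE.proj_eq_zero_iff, secondPageProj_eq_zero_iff]
  exact ⟨e.toModuleIso⟩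

end BicomplexCoordinates
end

/-! ### Total complexes -/

section
variable {R : Type u} [CommRing R] {c : ComplexShape ℕ}

/-- The coordinates of the transposed bicomplex. -/
noncomputable def BicomplexCoordinates.flip {K : HomologicalComplex (ModuleCat.{u} R) c}
    {B : HomologicalComplex₂ (ModuleCat.{u} R) c c} (Φ : BicomplexCoordinates K B) :
    BicomplexCoordinates K B.flip where
  proj p q n := Φ.proj q p n
  incl p q n := Φ.incl q p n
  proj_incl p q n h x := Φ.proj_incl q p n (by lia) x
  proj_incl_of_ne' p q p' q' n h x := Φ.proj_incl_of_ne' q p q' p' n h.symm x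
  eq_zero n x h := Φ.eq_zero n x fun p q hpq => h q p (by lia)
  proj_d p q n m hnm h := by
    obtain ⟨a, b, ha, hb, hab⟩ := Φ.proj_d q p n m hnm (by lia)
    exact ⟨b, a, hb, ha, fun x => (hab x).trans (add_comm _ _)⟩

namespace HomologicalComplex₂

variable [c.TensorSigns] (B : HomologicalComplex₂ (ModuleCat.{u} R) c c)

/-- The projection of the total complex to the summand in bidegree `(p, q)`. -/
noncomputable def totalProj (p q n : ℕ) : (B.total c).X n ⟶ (B.X p).X q :=
  B.totalDesc fun i j _ => if h : i = p ∧ j = q then eqToHom (by rw [h.1, h.2]) else 0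

lemma ιTotal_totalProj (p q n : ℕ) (h : p + q = n) :
    B.ιTotal c p q n h ≫ B.totalProj p q n = 𝟙 _ := by
  simp [totalProj]

lemma ιTotal_totalProj_of_ne (p q p' q' n : ℕ) (h : p + q = n) (hne : ¬ (p = p' ∧ q = q')) :
    B.ιTotal c p q n h ≫ B.totalProj p' q' n = 0 := by
  simp [totalProj, hne]

lemma ιTotalOrZero_totalProj_of_ne (p q p' q' n : ℕ) (hne : ¬ (p = p' ∧ q = q')) :
    B.ιTotalOrZero c p q n ≫ B.totalProj p' q' n = 0 := by
  by_cases h : p + q = n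
  · rw [B.ιTotalOrZero_eq c p q n h, ιTotal_totalProj_of_ne _ _ _ _ _ _ _ hne]
  · rw [B.ιTotalOrZero_eq_zero c p q n h, zero_comp]

lemma ιTotalOrZero_totalProj (p q n : ℕ) (h : p + q = n) :
    B.ιTotalOrZero c p q n ≫ B.totalProj p q n = 𝟙 _ := by
  rw [B.ιTotalOrZero_eq c p q n h, ιTotal_totalProj]

lemma sum_totalProj_ιTotalOrZero (n : ℕ) :
    ∑ x ∈ Finset.HasAntidiagonal.antidiagonal n,
      B.totalProj x.1 x.2 n ≫ B.ιTotalOrZero c x.1 x.2 n = 𝟙 _ := by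
  refine total.hom_ext _ fun i j h => ?_
  rw [Preadditive.comp_sum, Finset.sum_eq_single (i, j)]
  · rw [← Category.assoc, ιTotal_totalProj _ _ _ _ h, Category.id_comp, Category.comp_id]
    exact B.ιTotalOrZero_eq c i j n h
  · rintro ⟨i', j'⟩ - hne
    rw [← Category.assoc, ιTotal_totalProj_of_ne _ _ _ _ _ _ h, zero_comp]
    rintro ⟨rfl, rfl⟩
    exact hne rfl
  · intro hn
    exact (hn (Finset.HasAntidiagonal.mem_antidiagonal.2 h)).elim

lemma d₁_totalProj {i p q m : ℕ} (hi : c.Rel i p) (h : p + q = m) :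
    B.d₁ c i q m ≫ B.totalProj p q m = ComplexShape.ε₁ c c c (i, q) • (B.d i p).f q := by
  rw [B.d₁_eq c hi q m h, Linear.units_smul_comp, Category.assoc, ιTotal_totalProj,
    Category.comp_id]

lemma d₁_totalProj_eq_zero {i j p q m : ℕ} (h : ¬ (c.Rel i p ∧ j = q)) :
    B.d₁ c i j m ≫ B.totalProj p q m = 0 := by
  by_cases hi : c.Rel i (c.next i)
  · rw [B.d₁_eq' c hi, Linear.units_smul_comp, Category.assoc, ιTotalOrZero_totalProj_of_ne,
      comp_zero, smul_zero]
    rintro ⟨rfl, rfl⟩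
    exact h ⟨hi, rfl⟩
  · rw [B.d₁_eq_zero c _ _ _ hi, zero_comp]

lemma d₂_totalProj {j p q m : ℕ} (hj : c.Rel j q) (h : p + q = m) :
    B.d₂ c p j m ≫ B.totalProj p q m = ComplexShape.ε₂ c c c (p, j) • (B.X p).d j q := by
  rw [B.d₂_eq c p hj m h, Linear.units_smul_comp, Category.assoc, ιTotal_totalProj,
    Category.comp_id]

lemma d₂_totalProj_eq_zero {i j p q m : ℕ} (h : ¬ (c.Rel j q ∧ i = p)) :
    B.d₂ c i j m ≫ B.totalProj p q m = 0 := by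
  by_cases hj : c.Rel j (c.next j)
  · rw [B.d₂_eq' c _ hj, Linear.units_smul_comp, Category.assoc, ιTotalOrZero_totalProj_of_ne,
      comp_zero, smul_zero]
    rintro ⟨rfl, rfl⟩
    exact h ⟨hj, rfl⟩
  · rw [B.d₂_eq_zero c _ _ _ hj, zero_comp]

lemma d_totalProj (p q n m : ℕ) (h : p + q = m) :
    (B.total c).d n m ≫ B.totalProj p q m =
      ComplexShape.ε₂ c c c (p, c.prev q) • (B.totalProj p (c.prev q) n ≫ (B.X p).d (c.prev q) q) +
      ComplexShape.ε₁ c c c (c.prev p, q) •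
        (B.totalProj (c.prev p) q n ≫ (B.d (c.prev p) p).f q) := by
  refine total.hom_ext _ fun i j hij => ?_
  rw [← Category.assoc, total_d, Preadditive.comp_add, B.ι_D₁, B.ι_D₂, Preadditive.add_comp,
    Preadditive.comp_add, Linear.comp_units_smul, Linear.comp_units_smul, add_comm]
  congr 1
  · by_cases hj : c.Rel j q ∧ i = p
    · obtain ⟨hj, rfl⟩ := hj
      obtain rfl := c.prev_eq' hj
      rw [d₂_totalProj _ hj h, ← Category.assoc, ιTotal_totalProj, Category.id_comp]
    · rw [d₂_totalProj_eq_zero _ hj]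
      by_cases hq : c.Rel (c.prev q) q
      · rw [← Category.assoc, ιTotal_totalProj_of_ne, zero_comp, smul_zero]
        rintro ⟨rfl, rfl⟩
        exact hj ⟨hq, rfl⟩
      · rw [HomologicalComplex.shape _ _ _ hq, comp_zero, comp_zero, smul_zero]
  · by_cases hi : c.Rel i p ∧ j = q
    · obtain ⟨hi, rfl⟩ := hi
      obtain rfl := c.prev_eq' hi
      rw [d₁_totalProj _ hi h, ← Category.assoc, ιTotal_totalProj, Category.id_comp]
    · rw [d₁_totalProj_eq_zero _ hi]
      by_cases hp : c.Rel (c.prev p) p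
      · rw [← Category.assoc, ιTotal_totalProj_of_ne, zero_comp, smul_zero]
        rintro ⟨rfl, rfl⟩
        exact hi ⟨hp, rfl⟩
      · rw [B.shape _ _ hp, HomologicalComplex.zero_f, comp_zero, comp_zero, smul_zero]

/-- The coordinates of the total complex of a bicomplex. -/
noncomputable def totalCoordinates : BicomplexCoordinates (B.total c) B where
  proj p q n := (B.totalProj p q n).hom
  incl p q n := (B.ιTotalOrZero c p q n).hom
  proj_incl p q n h x := by
    rw [← LinearMap.comp_apply, ← ModuleCat.hom_comp, ιTotalOrZero_totalProj _ _ _ _ h]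
    rfl
  proj_incl_of_ne' p q p' q' n h x := by
    rw [← LinearMap.comp_apply, ← ModuleCat.hom_comp, ιTotalOrZero_totalProj_of_ne]
    · rfl
    · tauto
  eq_zero n x h := by
    have h1 := congrArg (fun f => f.hom x) (B.sum_totalProj_ιTotalOrZero n)
    rw [ModuleCat.hom_sum, LinearMap.sum_apply, Finset.sum_eq_zero] at h1
    · exact h1.symm
    · rintro ⟨p, q⟩ hpq
      rw [ModuleCat.hom_comp, LinearMap.comp_apply,
        h p q (Finset.HasAntidiagonal.mem_antidiagonal.1 hpq), map_zero]
  proj_d p q n m hnm h := by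
    have hs : ∀ e : ℤˣ, (((e : ℤ) : R) * ((e : ℤ) : R) = 1) := fun e => by
      rw [← Int.cast_mul, Int.units_coe_mul_self, Int.cast_one]
    refine ⟨(ComplexShape.ε₂ c c c (p, c.prev q) : ℤ), (ComplexShape.ε₁ c c c (c.prev p, q) : ℤ),
      hs _, hs _, fun x => ?_⟩
    rw [← LinearMap.comp_apply, ← ModuleCat.hom_comp, d_totalProj _ _ _ _ _ h, ModuleCat.hom_add,
      LinearMap.add_apply]
    rw [Int.cast_smul_eq_zsmul, Int.cast_smul_eq_zsmul]
    rfl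

/-- The submodule of the total complex spanned by a set of bidegrees consists of the elements with
vanishing coordinates in the other bidegrees. -/
lemma mem_iSup_range_ιTotal (S : ℕ → ℕ → Prop) (n : ℕ) (x : (B.total c).X n) :
    (x ∈ ⨆ (i : ℕ) (j : ℕ) (h : i + j = n) (_ : S i j), LinearMap.range (B.ιTotal c i j n h).hom) ↔
      ∀ i j, i + j = n → ¬ S i j → B.totalCoordinates.proj i j n x = 0 := by
  constructor
  · intro hx i j hij hS
    suffices h : (⨆ (i : ℕ) (j : ℕ) (h : i + j = n) (_ : S i j),
        LinearMap.range (B.ιTotal c i j n h).hom) ≤ LinearMap.ker (B.totalProj i j n).hom from h hx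
    refine iSup_le fun i' => iSup_le fun j' => iSup_le fun h' => iSup_le fun hS' => ?_
    rintro _ ⟨y, rfl⟩
    rw [LinearMap.mem_ker, ← LinearMap.comp_apply, ← ModuleCat.hom_comp,
      ιTotal_totalProj_of_ne]
    · rfl
    · rintro ⟨rfl, rfl⟩
      exact hS hS'
  · intro hx
    have h1 := congrArg (fun f => f.hom x) (B.sum_totalProj_ιTotalOrZero n)
    rw [ModuleCat.hom_sum, LinearMap.sum_apply] at h1
    rw [← show _ = x from h1]
    refine Submodule.sum_mem _ ?_
    rintro ⟨p, q⟩ hpq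
    have hpq := Finset.HasAntidiagonal.mem_antidiagonal.1 hpq
    rw [ModuleCat.hom_comp, LinearMap.comp_apply]
    by_cases hS : S p q
    · refine Submodule.mem_iSup_of_mem p (Submodule.mem_iSup_of_mem q
        (Submodule.mem_iSup_of_mem hpq (Submodule.mem_iSup_of_mem hS ?_)))
      rw [B.ιTotalOrZero_eq c p q n hpq]
      exact ⟨_, rfl⟩
    · rw [show (B.totalProj p q n).hom x = 0 from hx p q hpq hS, map_zero]
      exact zero_mem _

lemma iSup_range_ιTotal_eq_filt (wt : ℕ → ℤ) (k : ℤ) (n : ℕ) :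
    ⨆ (i : ℕ) (j : ℕ) (h : i + j = n) (_ : wt i ≤ k), LinearMap.range (B.ιTotal c i j n h).hom =
      B.totalCoordinates.filt wt k n := by
  ext x
  rw [mem_iSup_range_ιTotal B (fun i _ => wt i ≤ k), BicomplexCoordinates.mem_filt]
  simp only [not_le]

lemma iSup_range_ιTotal_eq_filt_flip (wt : ℕ → ℤ) (k : ℤ) (n : ℕ) :
    ⨆ (i : ℕ) (j : ℕ) (h : i + j = n) (_ : wt j ≤ k), LinearMap.range (B.ιTotal c i j n h).hom =
      B.totalCoordinates.flip.filt wt k n := by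
  ext x
  rw [mem_iSup_range_ιTotal B (fun _ j => wt j ≤ k), BicomplexCoordinates.mem_filt]
  simp only [not_le]
  exact ⟨fun h p q hpq => h q p (by lia), fun h p q hpq => h q p (by lia)⟩

end HomologicalComplex₂
end

/-! ### The spectral sequences of a bifunctor applied to two complexes -/

section
universe v₁ v₂ u₁ u₂
variable {R : Type u} [CommRing R] {c : ComplexShape ℕ} {v : ℤ → ℤ × ℤ} {wt : ℕ → ℤ}
variable {𝒜 : Type u₁} [Category.{v₁} 𝒜] [Abelian 𝒜] {ℬ : Type u₂} [Category.{v₂} ℬ] [Abelian ℬ]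
  (T : 𝒜 ⥤ ℬ ⥤ ModuleCat.{u} R) [T.PreservesZeroMorphisms]
  [∀ X, (T.obj X).PreservesZeroMorphisms]
  (K₁ : HomologicalComplex 𝒜 c) (K₂ : HomologicalComplex ℬ c)

/-- If all `T (K₁ p, -)` are exact, then the `q`-th row of the first page for `T (K₁, K₂)` is
`T (K₁, H_q K₂)`. -/
noncomputable def homologyRowMapBifunctorIso [∀ p, (T.obj (K₁.X p)).PreservesHomology] (q : ℕ) :
    homologyRow (((T.mapBifunctorHomologicalComplex c c).obj K₁).obj K₂) q ≅
      ((T.flip.obj (K₂.homology q)).mapHomologicalComplex c).obj K₁ :=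
  HomologicalComplex.Hom.isoOfComponents
    (fun p => (K₂.sc q).mapHomologyIso (T.obj (K₁.X p)))
    fun p p' _ => by
      change _ ≫ (T.map (K₁.d p p')).app (K₂.sc q).homology = _
      rw [NatTrans.app_homology]
      exact Iso.hom_inv_id_assoc _ _

variable [c.TensorSigns] (hQ : IsQuadrantShape c v wt) {E : QuadrantSS R v}
include hQ

/-- The second page for the filtration by the degree of `K₁`, if all `T (K₁ p, -)` are exact. -/
theorem nonempty_secondPage_iso_left [∀ p, (T.obj (K₁.X p)).PreservesHomology]
    (hE : IsFiltrationSS E (HomologicalComplex.mapBifunctor K₁ K₂ T c)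
      (fun k n => ⨆ (i : ℕ) (j : ℕ) (h : i + j = n) (_ : wt i ≤ k), LinearMap.range
        (HomologicalComplex.ιMapBifunctor K₁ K₂ T c i j n h).hom) wt) (p q : ℕ) :
    Nonempty ((E.page 2 le_rfl).X (p, q) ≅
      (((T.flip.obj (K₂.homology q)).mapHomologicalComplex c).obj K₁).homology p) := by
  rw [show (fun k n => ⨆ (i : ℕ) (j : ℕ) (h : i + j = n) (_ : wt i ≤ k), LinearMap.range
      (HomologicalComplex.ιMapBifunctor K₁ K₂ T c i j n h).hom) =
      (HomologicalComplex₂.totalCoordinates _).filt wt from funext₂ fun k n =>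
        HomologicalComplex₂.iSup_range_ιTotal_eq_filt _ wt k n] at hE
  obtain ⟨e⟩ := (HomologicalComplex₂.totalCoordinates _).nonempty_secondPage_iso hQ hE p q
  exact ⟨e ≪≫ (HomologicalComplex.homologyFunctor _ c p).mapIso
    (homologyRowMapBifunctorIso T K₁ K₂ q)⟩

/-- The second page for the filtration by the degree of `K₂`, if all `T (-, K₂ p)` are exact. -/
theorem nonempty_secondPage_iso_right [∀ p, (T.flip.obj (K₂.X p)).PreservesHomology]
    (hE : IsFiltrationSS E (HomologicalComplex.mapBifunctor K₁ K₂ T c)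
      (fun k n => ⨆ (i : ℕ) (j : ℕ) (h : i + j = n) (_ : wt j ≤ k), LinearMap.range
        (HomologicalComplex.ιMapBifunctor K₁ K₂ T c i j n h).hom) wt) (p q : ℕ) :
    Nonempty ((E.page 2 le_rfl).X (p, q) ≅
      (((T.obj (K₁.homology q)).mapHomologicalComplex c).obj K₂).homology p) := by
  rw [show (fun k n => ⨆ (i : ℕ) (j : ℕ) (h : i + j = n) (_ : wt j ≤ k), LinearMap.range
      (HomologicalComplex.ιMapBifunctor K₁ K₂ T c i j n h).hom) =
      (HomologicalComplex₂.totalCoordinates _).flip.filt wt from funext₂ fun k n =>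
        HomologicalComplex₂.iSup_range_ιTotal_eq_filt_flip _ wt k n] at hE
  obtain ⟨e⟩ := (HomologicalComplex₂.totalCoordinates _).flip.nonempty_secondPage_iso hQ hE p q
  exact ⟨e ≪≫ (HomologicalComplex.homologyFunctor _ c p).mapIso
    (homologyRowMapBifunctorIso T.flip K₂ K₁ q)⟩

lemma isBoundedFiltration_mapBifunctor_left :
    IsBoundedFiltration (HomologicalComplex.mapBifunctor K₁ K₂ T c)
      (fun k n => ⨆ (i : ℕ) (j : ℕ) (h : i + j = n) (_ : wt i ≤ k), LinearMap.range
        (HomologicalComplex.ιMapBifunctor K₁ K₂ T c i j n h).hom) wt := by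
  rw [show (fun k n => ⨆ (i : ℕ) (j : ℕ) (h : i + j = n) (_ : wt i ≤ k), LinearMap.range
      (HomologicalComplex.ιMapBifunctor K₁ K₂ T c i j n h).hom) =
      (HomologicalComplex₂.totalCoordinates _).filt wt from funext₂ fun k n =>
        HomologicalComplex₂.iSup_range_ιTotal_eq_filt _ wt k n]
  exact BicomplexCoordinates.isBoundedFiltration _ hQ

lemma isBoundedFiltration_mapBifunctor_right :
    IsBoundedFiltration (HomologicalComplex.mapBifunctor K₁ K₂ T c)
      (fun k n => ⨆ (i : ℕ) (j : ℕ) (h : i + j = n) (_ : wt j ≤ k), LinearMap.range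
        (HomologicalComplex.ιMapBifunctor K₁ K₂ T c i j n h).hom) wt := by
  rw [show (fun k n => ⨆ (i : ℕ) (j : ℕ) (h : i + j = n) (_ : wt j ≤ k), LinearMap.range
      (HomologicalComplex.ιMapBifunctor K₁ K₂ T c i j n h).hom) =
      (HomologicalComplex₂.totalCoordinates _).flip.filt wt from funext₂ fun k n =>
        HomologicalComplex₂.iSup_range_ιTotal_eq_filt_flip _ wt k n]
  exact BicomplexCoordinates.isBoundedFiltration _ hQ

/-- The two spectral sequences of `T (K₁, K₂)`. If `T (K₁ i, -)` and `T (-, K₂ j)` are exact and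
`K₂` is a resolution of `M`, then the one for the filtration by the degree of `K₁` degenerates,
which identifies the homology of the total complex with that of `T (K₁, M)`; both converge to this
homology. -/
theorem exists_spectralSequences_mapBifunctor [∀ p, (T.obj (K₁.X p)).PreservesHomology]
    [∀ p, (T.flip.obj (K₂.X p)).PreservesHomology] (M : ℬ) (e₀ : K₂.homology 0 ≅ M)
    (h₀ : ∀ q, q ≠ 0 → IsZero (K₂.homology q)) :
    let K := HomologicalComplex.mapBifunctor K₁ K₂ T c
    let Fr : ℤ → ∀ n, Submodule R (K.X n) := fun k n =>
      ⨆ (i : ℕ) (j : ℕ) (h : i + j = n) (_ : wt j ≤ k), LinearMap.range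
        (HomologicalComplex.ιMapBifunctor K₁ K₂ T c i j n h).hom
    let Fl : ℤ → ∀ n, Submodule R (K.X n) := fun k n =>
      ⨆ (i : ℕ) (j : ℕ) (h : i + j = n) (_ : wt i ≤ k), LinearMap.range
        (HomologicalComplex.ιMapBifunctor K₁ K₂ T c i j n h).hom
    let H : ℕ → ModuleCat.{u} R := fun n =>
      (((T.flip.obj M).mapHomologicalComplex c).obj K₁).homology n
    ∃ φ : ∀ n, K.homology n ≅ H n,
      (∃ E : QuadrantSS R v, Nonempty (IsFiltrationSS E K Fr wt) ∧
        (∀ p q : ℕ, Nonempty ((E.page 2 le_rfl).X (p, q) ≅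
          (((T.obj (K₁.homology q)).mapHomologicalComplex c).obj K₂).homology p)) ∧
        Nonempty (ConvergesTo E H (fun k n => (filtHomology K Fr k n).map (φ n).hom.hom) wt)) ∧
      (∃ E : QuadrantSS R v, Nonempty (IsFiltrationSS E K Fl wt) ∧
        (∀ p : ℕ, Nonempty ((E.page 2 le_rfl).X (p, 0) ≅ H p)) ∧
        (∀ p q : ℕ, q ≠ 0 → IsZero ((E.page 2 le_rfl).X (p, q))) ∧
        Nonempty (ConvergesTo E H (fun k n => (filtHomology K Fl k n).map (φ n).hom.hom) wt)) := by
  intro K Fr Fl H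
  have hl := isBoundedFiltration_mapBifunctor_left T K₁ K₂ hQ
  have hr := isBoundedFiltration_mapBifunctor_right T K₁ K₂ hQ
  obtain ⟨E, ⟨hE⟩⟩ := hl.exists_isFiltrationSS hQ
  obtain ⟨E', ⟨hE'⟩⟩ := hr.exists_isFiltrationSS hQ
  have e2 : ∀ p, Nonempty ((E.page 2 le_rfl).X (p, 0) ≅ H p) := fun p => by
    obtain ⟨e⟩ := nonempty_secondPage_iso_left T K₁ K₂ hQ hE p 0
    exact ⟨e ≪≫ (HomologicalComplex.homologyFunctor _ c p).mapIso
      ((NatIso.mapHomologicalComplex (T.flip.mapIso e₀) c).app K₁)⟩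
  have e0 : ∀ p q, q ≠ 0 → IsZero ((E.page 2 le_rfl).X (p, q)) := fun p q hq => by
    obtain ⟨e⟩ := nonempty_secondPage_iso_left T K₁ K₂ hQ hE p q
    refine IsZero.of_iso ?_ e
    have hz : IsZero ((((T.flip.obj (K₂.homology q)).mapHomologicalComplex c).obj K₁).X p) :=
      (T.obj (K₁.X p)).map_isZero (h₀ q hq)
    exact ShortComplex.isZero_homology_of_isZero_X₂ _ hz
  obtain ⟨hc⟩ := hE.convergesTo hQ hl (fun n => Iso.refl _)
  have φ : ∀ n, K.homology n ≅ H n := fun n =>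
    (hc.nonempty_iso hQ e0 n).some ≪≫ (e2 n).some
  exact ⟨φ, ⟨E', ⟨hE'⟩, nonempty_secondPage_iso_right T K₁ K₂ hQ hE',
    hE'.convergesTo hQ hr φ⟩, E, ⟨hE⟩, e2, e0, hE.convergesTo hQ hl φ⟩

end

/-! ### Exactness of tensor products and of Hom functors -/

section
universe v₁ v₂ u₁ u₂

lemma CategoryTheory.ShortComplex.exact_iff_evaluation {D : Type u₁} [Category.{v₁} D]
    {𝒜 : Type u₂} [Category.{v₂} 𝒜] [Abelian 𝒜] (S : ShortComplex (D ⥤ 𝒜)) :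
    S.Exact ↔ ∀ a, (S.map ((evaluation D 𝒜).obj a)).Exact := by
  refine ⟨fun h a => h.map _, fun h => (S.exact_iff_isZero_homology).2 ?_⟩
  exact Functor.isZero _ fun a => (((S.map _).exact_iff_isZero_homology).1 (h a)).of_iso
    (S.mapHomologyIso ((evaluation D 𝒜).obj a)).symm

/-- Exactness can be tested by maps to injective objects. -/
lemma CategoryTheory.ShortComplex.exact_of_injective {𝒜 : Type u₁} [Category.{v₁} 𝒜] [Abelian 𝒜]
    [EnoughInjectives 𝒜] (S : ShortComplex 𝒜)
    (h : ∀ (J : 𝒜) [Injective J] (f : S.X₂ ⟶ J), S.f ≫ f = 0 → ∃ g : S.X₃ ⟶ J, S.g ≫ g = f) :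
    S.Exact := by
  rw [ShortComplex.exact_iff_kernel_ι_comp_cokernel_π_zero]
  obtain ⟨g, hg⟩ := h (Injective.under (cokernel S.f)) (cokernel.π S.f ≫ Injective.ι _)
    (by rw [cokernel.condition_assoc, zero_comp])
  rw [← cancel_mono (Injective.ι _), Category.assoc, ← hg, kernel.condition_assoc, zero_comp,
    zero_comp]

end

section
variable {C : Type u} [SmallCategory C] {R : Type u} [CommRing R]

/-- The canonical pairing `N a × M a → N ⊗_C M`. -/
noncomputable def functorTensorPairing (N : Cᵒᵖ ⥤ ModuleCat.{u} R) (M : C ⥤ ModuleCat.{u} R)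
    (a : C) : N.obj (op a) →ₗ[R] M.obj a →ₗ[R] ((functorTensor R).obj N).obj M :=
  (TensorProduct.mk R _ _).compr₂ (functorTensorι N M a).hom

lemma functorTensorPairing_map (N : Cᵒᵖ ⥤ ModuleCat.{u} R) {M M' : C ⥤ ModuleCat.{u} R}
    (g : M ⟶ M') (a : C) (x : N.obj (op a)) (y : M.obj a) :
    (((functorTensor R).obj N).map g).hom (functorTensorPairing N M a x y) =
      functorTensorPairing N M' a x ((g.app a).hom y) :=
  ConcreteCategory.congr_hom (functorTensorι_map N g a) (TensorProduct.tmul R x y)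

lemma functorTensorPairing_map_app {N N' : Cᵒᵖ ⥤ ModuleCat.{u} R} (f : N ⟶ N')
    (M : C ⥤ ModuleCat.{u} R) (a : C) (x : N.obj (op a)) (y : M.obj a) :
    (((functorTensor R).map f).app M).hom (functorTensorPairing N M a x y) =
      functorTensorPairing N' M a ((f.app (op a)).hom x) y :=
  ConcreteCategory.congr_hom (functorTensorι_map_app f M a) (TensorProduct.tmul R x y)

lemma functorTensorPairing_condition (N : Cᵒᵖ ⥤ ModuleCat.{u} R) (M : C ⥤ ModuleCat.{u} R)
    {a b : C} (f : a ⟶ b) (x : N.obj (op b)) (y : M.obj a) :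
    functorTensorPairing N M a ((N.map f.op).hom x) y =
      functorTensorPairing N M b x ((M.map f).hom y) :=
  ConcreteCategory.congr_hom (coend.condition (N ⋙ MonoidalCategory.curriedTensor (ModuleCat.{u} R)
    ⋙ (Functor.whiskeringLeft C _ _).obj M) f) (TensorProduct.tmul R x y)

lemma functorTensorPairing_hom_ext {N : Cᵒᵖ ⥤ ModuleCat.{u} R} {M : C ⥤ ModuleCat.{u} R}
    {Z : ModuleCat.{u} R} {f g : ((functorTensor R).obj N).obj M ⟶ Z}
    (h : ∀ a x y, f.hom (functorTensorPairing N M a x y) =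
      g.hom (functorTensorPairing N M a x y)) : f = g := by
  refine functorTensor_hom_ext fun a => ModuleCat.hom_ext (TensorProduct.ext' fun x y => ?_)
  exact h a x y

/-- The map out of a tensor product over `C` given by a balanced family of bilinear maps. -/
noncomputable def functorTensorLift {N : Cᵒᵖ ⥤ ModuleCat.{u} R} {M : C ⥤ ModuleCat.{u} R}
    {Z : ModuleCat.{u} R} (b : ∀ a, N.obj (op a) →ₗ[R] M.obj a →ₗ[R] Z)
    (hb : ∀ (a a' : C) (f : a ⟶ a') (x : N.obj (op a')) (y : M.obj a),
      b a ((N.map f.op).hom x) y = b a' x ((M.map f).hom y)) :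
    ((functorTensor R).obj N).obj M ⟶ Z :=
  coend.desc (F := N ⋙ MonoidalCategory.curriedTensor (ModuleCat.{u} R) ⋙
    (Functor.whiskeringLeft C _ _).obj M) (fun a => ModuleCat.ofHom (TensorProduct.lift (b a)))
    fun a a' f => ModuleCat.hom_ext (TensorProduct.ext' fun x y => hb a a' f x y)

lemma functorTensorLift_pairing {N : Cᵒᵖ ⥤ ModuleCat.{u} R} {M : C ⥤ ModuleCat.{u} R}
    {Z : ModuleCat.{u} R} (b : ∀ a, N.obj (op a) →ₗ[R] M.obj a →ₗ[R] Z)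
    (hb : ∀ (a a' : C) (f : a ⟶ a') (x : N.obj (op a')) (y : M.obj a),
      b a ((N.map f.op).hom x) y = b a' x ((M.map f).hom y)) (a : C) (x : N.obj (op a))
    (y : M.obj a) : (functorTensorLift b hb).hom (functorTensorPairing N M a x y) = b a x y :=
  ConcreteCategory.congr_hom
    (coend.ι_desc (F := N ⋙ MonoidalCategory.curriedTensor (ModuleCat.{u} R) ⋙
      (Functor.whiskeringLeft C _ _).obj M) _ _ a) (TensorProduct.tmul R x y)

/-- Tensoring with a projective functor is exact: dually to an injective module `J`, the maps
`N ⊗_C M ⟶ J` are the natural transformations from `N` to `a ↦ Hom (M a, J)`. -/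
theorem functorTensor_obj_preservesHomology (N : Cᵒᵖ ⥤ ModuleCat.{u} R) [Projective N] :
    ((functorTensor R).obj N).PreservesHomology := by
  refine Functor.preservesHomology_of_map_exact _ fun S hS => ?_
  refine ShortComplex.exact_of_injective _ fun J _ h hh => ?_
  replace hh : ((functorTensor R).obj N).map S.f ≫ h = 0 := hh
  -- the dual of `S` with values in `J`; it is exact since `J` is injective
  let S' : ShortComplex (Cᵒᵖ ⥤ ModuleCat.{u} R) :=
    { X₁ := S.X₃.op ⋙ (linearYoneda R (ModuleCat.{u} R)).obj J
      X₂ := S.X₂.op ⋙ (linearYoneda R (ModuleCat.{u} R)).obj J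
      X₃ := S.X₁.op ⋙ (linearYoneda R (ModuleCat.{u} R)).obj J
      f := Functor.whiskerRight (NatTrans.op S.g) _
      g := Functor.whiskerRight (NatTrans.op S.f) _
      zero := by
        ext a : 2
        refine ModuleCat.hom_ext (LinearMap.ext fun (φ : S.X₃.obj a.unop ⟶ J) => ?_)
        change S.f.app a.unop ≫ S.g.app a.unop ≫ φ = 0
        rw [← Category.assoc, ← NatTrans.comp_app, S.zero]
        exact zero_comp }
  have hS' : S'.Exact := by
    rw [ShortComplex.exact_iff_evaluation]
    intro a
    rw [ShortComplex.moduleCat_exact_iff]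
    intro φ hφ
    have := (S.exact_iff_evaluation.1 hS a.unop)
    exact ⟨this.descToInjective φ hφ, this.comp_descToInjective φ hφ⟩
  let k : N ⟶ S'.X₂ :=
    { app a := ModuleCat.ofHom (ModuleCat.homLinearEquiv.symm.toLinearMap.comp
        ((functorTensorPairing N S.X₂ a.unop).compr₂ h.hom))
      naturality a b f := by
        ext x : 2
        refine ModuleCat.hom_ext (LinearMap.ext fun z => ?_)
        exact congrArg h.hom (functorTensorPairing_condition N S.X₂ f.unop x z) }
  have hk : k ≫ S'.g = 0 := by
    ext a x : 4
    refine ModuleCat.hom_ext (LinearMap.ext fun z => ?_)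
    have := congrArg (fun f => f.hom (functorTensorPairing N S.X₁ a.unop x z)) hh
    exact (congrArg h.hom (functorTensorPairing_map N S.f a.unop x z)).symm.trans this
  let l := hS'.liftFromProjective k hk
  have hl : l ≫ S'.f = k := hS'.liftFromProjective_comp k hk
  refine ⟨functorTensorLift (fun a => ModuleCat.homLinearEquiv.toLinearMap.comp (l.app (op a)).hom)
    fun a b f x y => ?_, functorTensorPairing_hom_ext fun a x y => ?_⟩
  · have := ConcreteCategory.congr_hom (l.naturality f.op) x
    exact congrArg (fun φ => ModuleCat.Hom.hom φ y) this
  · have := congrArg (fun φ => ModuleCat.Hom.hom φ y)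
      (ConcreteCategory.congr_hom (NatTrans.congr_app hl (op a)) x)
    refine Eq.trans ?_ this
    refine (congrArg _ (functorTensorPairing_map N S.g a x y)).trans ?_
    exact functorTensorLift_pairing _ _ a x _

/-- Tensoring with a projective functor is exact, in the other variable. -/
theorem functorTensor_flip_obj_preservesHomology (M : C ⥤ ModuleCat.{u} R) [Projective M] :
    ((functorTensor R).flip.obj M).PreservesHomology := by
  refine Functor.preservesHomology_of_map_exact _ fun S hS => ?_
  refine ShortComplex.exact_of_injective _ fun J _ h hh => ?_
  replace hh : ((functorTensor R).map S.f).app M ≫ h = 0 := hh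
  -- the dual of `S` with values in `J`; it is exact since `J` is injective
  let S' : ShortComplex (C ⥤ ModuleCat.{u} R) :=
    { X₁ := S.X₃.rightOp ⋙ (linearYoneda R (ModuleCat.{u} R)).obj J
      X₂ := S.X₂.rightOp ⋙ (linearYoneda R (ModuleCat.{u} R)).obj J
      X₃ := S.X₁.rightOp ⋙ (linearYoneda R (ModuleCat.{u} R)).obj J
      f := Functor.whiskerRight (NatTrans.rightOp S.g) _
      g := Functor.whiskerRight (NatTrans.rightOp S.f) _
      zero := by
        ext a : 2
        refine ModuleCat.hom_ext (LinearMap.ext fun (φ : S.X₃.obj (op a) ⟶ J) => ?_)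
        change S.f.app (op a) ≫ S.g.app (op a) ≫ φ = 0
        rw [← Category.assoc, ← NatTrans.comp_app, S.zero]
        exact zero_comp }
  have hS' : S'.Exact := by
    rw [ShortComplex.exact_iff_evaluation]
    intro a
    rw [ShortComplex.moduleCat_exact_iff]
    intro φ hφ
    have := (S.exact_iff_evaluation.1 hS (op a))
    exact ⟨this.descToInjective φ hφ, this.comp_descToInjective φ hφ⟩
  let k : M ⟶ S'.X₂ :=
    { app a := ModuleCat.ofHom (ModuleCat.homLinearEquiv.symm.toLinearMap.comp
        ((functorTensorPairing S.X₂ M a).flip.compr₂ h.hom))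
      naturality a b f := by
        ext y : 2
        refine ModuleCat.hom_ext (LinearMap.ext fun z => ?_)
        exact congrArg h.hom (functorTensorPairing_condition S.X₂ M f z y).symm }
  have hk : k ≫ S'.g = 0 := by
    ext a y : 4
    refine ModuleCat.hom_ext (LinearMap.ext fun z => ?_)
    have := congrArg (fun f => f.hom (functorTensorPairing S.X₁ M a z y)) hh
    exact (congrArg h.hom (functorTensorPairing_map_app S.f M a z y)).symm.trans this
  let l := hS'.liftFromProjective k hk
  have hl : l ≫ S'.f = k := hS'.liftFromProjective_comp k hk
  refine ⟨functorTensorLift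
    (fun a => (ModuleCat.homLinearEquiv.toLinearMap.comp (l.app a).hom).flip)
    fun a b f x y => ?_, functorTensorPairing_hom_ext fun a x y => ?_⟩
  · have := ConcreteCategory.congr_hom (l.naturality f) y
    exact (congrArg (fun φ => ModuleCat.Hom.hom φ x) this).symm
  · have := congrArg (fun φ => ModuleCat.Hom.hom φ x)
      (ConcreteCategory.congr_hom (NatTrans.congr_app hl a) y)
    refine Eq.trans ?_ this
    refine (congrArg _ (functorTensorPairing_map_app S.g M a x y)).trans ?_
    exact functorTensorLift_pairing _ _ a _ y

end

section
universe v₁ u₁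
variable {𝒜 : Type u₁} [Category.{v₁} 𝒜] [Abelian 𝒜] (R : Type v₁) [CommRing R] [Linear R 𝒜]

theorem linearCoyoneda_obj_preservesHomology (P : 𝒜) [Projective P] :
    ((linearCoyoneda R 𝒜).obj (op P)).PreservesHomology := by
  refine Functor.preservesHomology_of_map_exact _ fun S hS => ?_
  rw [ShortComplex.moduleCat_exact_iff]
  exact fun φ hφ => ⟨hS.liftFromProjective φ hφ, hS.liftFromProjective_comp φ hφ⟩

theorem linearCoyoneda_flip_obj_preservesHomology (J : 𝒜) [Injective J] :
    ((linearCoyoneda R 𝒜).flip.obj J).PreservesHomology := by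
  have : ((linearCoyoneda R 𝒜).flip.obj J).Additive :=
    inferInstanceAs ((linearYoneda R 𝒜).obj J).Additive
  refine Functor.preservesHomology_of_map_exact _ fun S hS => ?_
  rw [ShortComplex.moduleCat_exact_iff]
  exact fun φ hφ => ⟨hS.unop.descToInjective φ hφ, hS.unop.comp_descToInjective φ hφ⟩

end

/-! ### Unique lifting for the space of homotopy classes of paths -/

section
variable {A : Type u} [TopologicalSpace A] {a : A}

/-- The path `γ`, as a path in the path component of its initial point. -/
def PathsFrom.toPathComponent (γ : PathsFrom a) : C(I, pathComponent a) where
  toFun t := ⟨γ.1 t, ⟨{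
    toFun s := γ.1 (s * t)
    continuous_toFun := by fun_prop
    source' := by rw [zero_mul, γ.2]
    target' := by rw [one_mul] }⟩⟩
  continuous_toFun := by fun_prop

lemma PathsFrom.toPathComponent_zero (γ : PathsFrom a) :
    γ.toPathComponent 0 = ⟨a, Joined.refl a⟩ := Subtype.ext γ.2

lemma PathsFrom.toPathComponent_homotopicRel {γ δ : PathsFrom a}
    (h : γ.1.HomotopicRel δ.1 {0, 1}) :
    γ.toPathComponent.HomotopicRel δ.toPathComponent {0, 1} := by
  obtain ⟨H⟩ := h
  have hH : ∀ s t : I, H (s, t) ∈ pathComponent a := fun s t => by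
    have h0 : H (s, 0) = a := (H.eq_fst s (by simp)).trans γ.2
    refine ⟨{
      toFun r := H (s, r * t)
      continuous_toFun := by fun_prop
      source' := by rw [zero_mul, h0]
      target' := by rw [one_mul] }⟩
  exact ⟨{
    toFun x := ⟨H x, hH x.1 x.2⟩
    continuous_toFun := by fun_prop
    map_zero_left t := Subtype.ext (H.apply_zero t)
    map_one_left t := Subtype.ext (H.apply_one t)
    prop' s t ht := Subtype.ext (H.prop' s t ht) }⟩

namespace UnivCover

lemma continuous_endpoint : Continuous (endpoint : UnivCover a → A) :=
  Continuous.quotient_lift ((continuous_eval_const (1 : I)).comp continuous_subtype_val) _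

/-- If the path component of `a` has a universal cover, then the space of homotopy classes of paths
starting at `a` maps injectively and continuously to a covering space of that component, by sending
a path to the endpoint of its lift. -/
theorem exists_injective_continuous (h : HasUnivCover (pathComponent a)) :
    ∃ (E : Type u) (_ : TopologicalSpace E) (p : E → pathComponent a) (ψ : UnivCover a → E),
      IsCoveringMap p ∧ Continuous ψ ∧ Function.Injective ψ ∧
        ∀ c, (p (ψ c) : A) = c.endpoint := by
  obtain ⟨E, _, p, _, cov⟩ := h
  -- a point of the covering space over the base point
  obtain ⟨e₀, he₀⟩ : ∃ e₀, (⟨a, Joined.refl a⟩ : pathComponent a) = p e₀ := by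
    obtain ⟨e⟩ := (inferInstance : Nonempty E)
    obtain ⟨γ⟩ : Joined a (p e : A) := (p e).2
    have hγ : (PathsFrom.ofPath γ).toPathComponent 1 = p e := Subtype.ext γ.target
    let δ : C(I, pathComponent a) :=
      (PathsFrom.ofPath γ).toPathComponent.comp ⟨unitInterval.symm, by fun_prop⟩
    have hδ : δ 0 = p e := by
      rw [← hγ]
      exact congrArg (PathsFrom.ofPath γ).toPathComponent unitInterval.symm_zero
    refine ⟨cov.liftPath δ e hδ 1, ?_⟩
    rw [← PathsFrom.toPathComponent_zero (PathsFrom.ofPath γ)]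
    refine Eq.trans ?_ (congrFun (cov.liftPath_lifts δ e hδ) 1).symm
    exact congrArg (PathsFrom.ofPath γ).toPathComponent unitInterval.symm_one.symm
  have h0 : ∀ γ : PathsFrom a, γ.toPathComponent 0 = p e₀ := fun γ =>
    γ.toPathComponent_zero.trans he₀
  let H : C(I × PathsFrom a, pathComponent a) :=
    { toFun x := x.2.toPathComponent x.1
      continuous_toFun := by
        refine Continuous.subtype_mk ?_ _
        have h1 : Continuous fun x : I × PathsFrom a => (x.2.1 : C(I, A)) :=
          continuous_subtype_val.comp continuous_snd
        exact h1.eval continuous_fst }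
  let L := cov.liftHomotopy H (ContinuousMap.const _ e₀) h0
  have hL : ∀ γ : PathsFrom a, L (1, γ) = cov.liftPath γ.toPathComponent e₀ (h0 γ) 1 :=
    fun γ => rfl
  refine ⟨E, _, p, Quotient.lift (fun γ => L (1, γ)) fun γ δ hγδ => ?_, cov,
    Continuous.quotient_lift (L.continuous.comp (by fun_prop)) _, ?_, ?_⟩
  · rw [hL, hL]
    exact cov.liftPath_apply_one_eq_of_homotopicRel
      (PathsFrom.toPathComponent_homotopicRel hγδ) e₀ _ _
  · intro c d
    induction c, d using Quotient.inductionOn₂ with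
    | h γ δ =>
      intro hγδ
      replace hγδ : L (1, γ) = L (1, δ) := hγδ
      rw [hL, hL] at hγδ
      -- the lifts are homotopic since the covering space is simply connected
      let γ' : Path e₀ (cov.liftPath γ.toPathComponent e₀ (h0 γ) 1) :=
        ⟨cov.liftPath γ.toPathComponent e₀ (h0 γ), cov.liftPath_zero _ _ _, rfl⟩
      let δ' : Path e₀ (cov.liftPath γ.toPathComponent e₀ (h0 γ) 1) :=
        ⟨cov.liftPath δ.toPathComponent e₀ (h0 δ), cov.liftPath_zero _ _ _, hγδ.symm⟩
      have key : γ'.Homotopic δ' := SimplyConnectedSpace.paths_homotopic γ' δ'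
      let π : C(E, A) := ⟨fun e => (p e : A), continuous_subtype_val.comp cov.continuous⟩
      have hγ' : π.comp γ'.toContinuousMap = γ.1 := ContinuousMap.ext fun t =>
        congrArg Subtype.val (congrFun (cov.liftPath_lifts _ _ (h0 γ)) t)
      have hδ' : π.comp δ'.toContinuousMap = δ.1 := ContinuousMap.ext fun t =>
        congrArg Subtype.val (congrFun (cov.liftPath_lifts _ _ (h0 δ)) t)
      have key' := ContinuousMap.HomotopicRel.comp_continuousMap key π
      rw [hγ', hδ'] at key'
      exact Quotient.sound key'
  · intro c
    induction c using Quotient.inductionOn with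
    | h γ => exact congrArg Subtype.val (congrFun (cov.liftPath_lifts _ _ (h0 γ)) 1)

/-- Unique lifting along the endpoint map. -/
theorem eq_of_endpoint_eq (h : HasUnivCover (pathComponent a)) {T : Type*} [TopologicalSpace T]
    [PreconnectedSpace T] {s s' : T → UnivCover a} (hs : Continuous s) (hs' : Continuous s')
    (he : ∀ t, (s t).endpoint = (s' t).endpoint) (t₀ : T) (h₀ : s t₀ = s' t₀) : s = s' := by
  obtain ⟨E, _, p, ψ, cov, hψ, hinj, hp⟩ := exists_injective_continuous h
  refine hinj.comp_left (cov.eq_of_comp_eq (hψ.comp hs) (hψ.comp hs') (funext fun t => ?_) t₀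
    (congrArg ψ h₀))
  exact Subtype.ext ((hp _).trans ((he t).trans (hp _).symm))

end UnivCover
end

/-! ### Simplices of the equivariant universal cover -/

section
variable {G X : Type u} [Group G] [MulAction G X]

/-- A `G`-map out of `G/H` is determined by its value at `eH`. -/
lemma MulActionHom.ext_quotient {H : Subgroup G} {S : Type*} [MulAction G S]
    {α β : (G ⧸ H) →[G] S} (h : α ((1 : G) : G ⧸ H) = β ((1 : G) : G ⧸ H)) : α = β := by
  ext c
  induction c using QuotientGroup.induction_on with
  | H g =>
    rw [show (g : G ⧸ H) = g • ((1 : G) : G ⧸ H) by simp, map_smul, map_smul, h]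

/-- The `G`-map `G/H → S` with `eH ↦ c`, for a point `c` fixed by `H`. -/
def MulActionHom.ofFixedPoint {H : Subgroup G} {S : Type*} [MulAction G S] (c : S)
    (hc : ∀ h ∈ H, h • c = c) : (G ⧸ H) →[G] S where
  toFun := Quotient.lift (fun g : G => g • c) fun g g' h => by
    have := hc _ (QuotientGroup.leftRel_apply.1 h)
    rw [mul_smul] at this
    exact (eq_inv_smul_iff.1 this.symm)
  map_smul' g x := by
    induction x using QuotientGroup.induction_on with
    | H k => exact mul_smul g k c

variable [TopologicalSpace X] [ContinuousConstSMul G X]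

lemma FundCat.Hom.act_mk_refl {a b : FundCat G X} (f : FundCat.Hom a b) :
    f.act (.mk (Path.refl b.pt)) = f.path :=
  UnivCover.trans_refl _ _

lemma FundCat.Hom.endpoint_act {a b : FundCat G X} (f : FundCat.Hom a b) (c : UnivCover b.pt) :
    (f.act c).endpoint = fixedPull f.map c.endpoint := by
  rw [FundCat.Hom.act, UnivCover.endpoint_trans, UnivCover.endpoint_map]

variable {T : Type} [TopologicalSpace T] (v₀ : T)

/-- The restriction of the codomain of `τ : T → X` to the fixed points of its stabilizer. -/
def toFixedPoints (τ : C(T, X)) : C(T, MulAction.fixedPoints (MulAction.stabilizer G τ) X) where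
  toFun t := ⟨τ t, fun g => DFunLike.congr_fun (MulAction.mem_stabilizer_iff.1 g.2) t⟩
  continuous_toFun := by fun_prop

/-- The object of the fundamental category given by the stabilizer of `τ : T → X` and the image of
the base point. -/
def mapObj (τ : C(T, X)) : FundCat G X := ⟨MulAction.stabilizer G τ, toFixedPoints τ v₀⟩

variable (seg : C(T × I, T)) (h0 : ∀ t, seg (t, 0) = v₀)

/-- The lift of `τ : T → X` to the universal cover provided by a contraction `seg` of `T`: the point
`t` is sent to the class of the image of the path `seg (t, -)` from `v₀` to `t`. -/
noncomputable def mapLift (τ : C(T, X)) : C(T, UnivCover (mapObj (G := G) v₀ τ).pt) where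
  toFun t := Quotient.mk (pathsFromSetoid (toFixedPoints (G := G) τ v₀))
    ⟨((toFixedPoints τ).comp seg).curry t, congrArg (toFixedPoints τ) (h0 t)⟩
  continuous_toFun := Continuous.comp (Y := PathsFrom (toFixedPoints (G := G) τ v₀))
    continuous_quotient_mk'
      (Continuous.subtype_mk (((toFixedPoints τ).comp seg).curry.continuous) _)

lemma endpoint_mapLift (h1 : ∀ t, seg (t, 1) = t) (τ : C(T, X)) (t : T) :
    ((mapLift (G := G) v₀ seg h0 τ t).endpoint : X) = τ t :=
  congrArg τ (h1 t)

lemma mapLift_apply (hv : ∀ s, seg (v₀, s) = v₀) (τ : C(T, X)) :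
    mapLift (G := G) v₀ seg h0 τ v₀ = .mk (Path.refl _) :=
  congrArg (Quotient.mk _) (Subtype.ext (ContinuousMap.ext fun s =>
    congrArg (toFixedPoints (G := G) τ) (hv s)))

/-- The maps from a contractible space to the equivariant universal cover form a free presheaf on
the fundamental category: its generators are the lifts of representatives of the `G`-orbits of maps
to `X`. -/
theorem existsUnique_act_comp_mapLift
    (hX : ∀ (H : Subgroup G) (x : MulAction.fixedPoints H X), HasUnivCover (pathComponent x))
    (h1 : ∀ t, seg (t, 1) = t) (hv : ∀ s, seg (v₀, s) = v₀) (b : FundCat G X)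
    (s : C(T, UnivCover b.pt)) :
    ∃! f : Σ i : MulAction.orbitRel.Quotient G C(T, X), b ⟶ mapObj v₀ i.out,
      ∀ t, FundCat.Hom.act f.2 (mapLift v₀ seg h0 f.1.out t) = s t := by
  have hT : PreconnectedSpace T := by
    have : PathConnectedSpace T := by
      refine ⟨⟨v₀⟩, fun x y => ?_⟩
      have h : ∀ t, Joined v₀ t := fun t => ⟨{
        toFun r := seg (t, r)
        continuous_toFun := by fun_prop
        source' := h0 t
        target' := h1 t }⟩
      exact (h x).symm.trans (h y)
    infer_instance
  let τ : C(T, X) := ⟨fun t => ((s t).endpoint : X),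
    continuous_subtype_val.comp (UnivCover.continuous_endpoint.comp s.continuous)⟩
  -- the `G`-map of a morphism carrying the generator to `s` translates the representative to `τ`
  have hτ : ∀ (f : Σ i : MulAction.orbitRel.Quotient G C(T, X), b ⟶ mapObj v₀ i.out),
      (∀ t, FundCat.Hom.act f.2 (mapLift v₀ seg h0 f.1.out t) = s t) →
      ∀ g : G, f.2.map ((1 : G) : G ⧸ b.sub) = (g : G ⧸ (mapObj v₀ f.1.out).sub) →
        τ = g • f.1.out := fun f hf g hg => ContinuousMap.ext fun t => by
    change ((s t).endpoint : X) = _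
    rw [← hf, FundCat.Hom.endpoint_act, fixedPull_apply _ g hg, endpoint_mapLift _ _ _ h1]
    rfl
  obtain ⟨i, hi⟩ : ∃ i : MulAction.orbitRel.Quotient G C(T, X), i = ⟦τ⟧ := ⟨_, rfl⟩
  obtain ⟨g, hg⟩ : ∃ g : G, τ = g • i.out := by
    have h : i.out ∈ MulAction.orbit G τ := by
      rw [← MulAction.orbitRel_apply, hi]
      exact Quotient.mk_out τ
    obtain ⟨g, hg⟩ := h
    exact ⟨g⁻¹, by rw [← show g • τ = i.out from hg, inv_smul_smul]⟩
  have hgb : ∀ h ∈ b.sub, h • (g : G ⧸ (mapObj v₀ i.out).sub) = g := by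
    intro h hh
    refine QuotientGroup.eq.2 (MulAction.mem_stabilizer_iff.2 ?_)
    have hτ : h⁻¹ • τ = τ := ContinuousMap.ext fun t =>
      (s t).endpoint.2 ⟨h⁻¹, inv_mem hh⟩
    change ((h * g)⁻¹ * g) • i.out = i.out
    rw [mul_inv_rev, mul_assoc, mul_smul, mul_smul, ← hg, hτ, hg, inv_smul_smul]
  let α := MulActionHom.ofFixedPoint (H := b.sub) (g : G ⧸ (mapObj v₀ i.out).sub) hgb
  have hα : α ((1 : G) : G ⧸ b.sub) = (g : G ⧸ (mapObj v₀ i.out).sub) := one_smul G _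
  let f : FundCat.Hom b (mapObj v₀ i.out) :=
    { map := α
      path := s v₀
      endpoint_path := Subtype.ext (by
        rw [fixedPull_apply _ g hα]
        exact DFunLike.congr_fun hg v₀) }
  refine ⟨⟨i, f⟩, fun t => ?_, ?_⟩
  · refine congrFun (UnivCover.eq_of_endpoint_eq (hX b.sub b.pt)
      (f.continuous_act.comp (mapLift v₀ seg h0 i.out).continuous) s.continuous (fun t => ?_) v₀
      ?_) t
    · refine Subtype.ext ?_
      rw [Function.comp_apply, FundCat.Hom.endpoint_act, fixedPull_apply _ g hα,
        endpoint_mapLift _ _ _ h1]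
      exact (DFunLike.congr_fun hg t).symm
    · rw [Function.comp_apply, mapLift_apply _ _ _ hv]
      exact f.act_mk_refl
  · rintro ⟨j, f'⟩ hf'
    obtain ⟨g', hg'⟩ := QuotientGroup.mk_surjective (f'.map ((1 : G) : G ⧸ b.sub))
    have hτ' := hτ ⟨j, f'⟩ hf' g' hg'.symm
    obtain rfl : i = j := by
      rw [hi, ← Quotient.out_eq j]
      exact Quotient.sound (MulAction.orbitRel_apply.2 ⟨g', hτ'.symm⟩)
    have hmap : f'.map = f.map := by
      refine MulActionHom.ext_quotient (hg'.symm.trans (Eq.trans ?_ hα.symm))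
      refine QuotientGroup.eq.2 (MulAction.mem_stabilizer_iff.2 ?_)
      rw [mul_smul, ← hg, hτ']
      exact inv_smul_smul _ _
    have hpath : f'.path = f.path := by
      rw [← FundCat.Hom.act_mk_refl f', ← mapLift_apply v₀ seg h0 hv]
      exact hf' v₀
    exact congrArg (Sigma.mk i) (FundCat.Hom.ext hmap hpath)

end

/-! ### Projectivity of the chains of a free presheaf -/

section
variable {D : Type u} [SmallCategory D] {R : Type u} [CommRing R]

lemma normalizedChainComplexMap_fromNormalizedChainComplex {S S' : SSet.{u}} (f : S ⟶ S')
    (A : ModuleCat.{u} R) :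
    SSet.normalizedChainComplexMap f A ≫ S'.fromNormalizedChainComplex A =
      S.fromNormalizedChainComplex A ≫ SSet.chainComplexMap f A := by
  rw [SSet.normalizedChainComplexMap, Category.assoc, Category.assoc,
    SSet.toNormalizedChainComplex_fromNormalizedChainComplex, SSet.chainComplexMap_PInfty,
    ← SSet.toNormalizedChainComplex_fromNormalizedChainComplex, Category.assoc,
    SSet.fromNormalizedChainComplex_toNormalizedChainComplex_assoc]

/-- The normalized chains are naturally a retract of the unnormalized ones. -/
noncomputable def normalizedChainsRetract (A : ModuleCat.{u} R) :
    Retract (SSet.normalizedChainComplexFunctorObj.{u} A)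
      ((SSet.chainComplexFunctor (ModuleCat.{u} R)).obj A) where
  i := { app S := S.fromNormalizedChainComplex A
         naturality _ _ f := normalizedChainComplexMap_fromNormalizedChainComplex f A }
  r := SSet.toNormalizedChainComplexNatTrans A
  retract := by
    ext S : 2
    exact S.fromNormalizedChainComplex_toNormalizedChainComplex A

variable (Z : Dᵒᵖ ⥤ SSet.{u}) (n : ℕ)

/-- If the `n`-simplices of `Z` form a free presheaf, that is, a coproduct of representable ones,
then the `n`-chains of `Z` are projective. -/
theorem projective_chains_of_free {ι : Type*} (a : ι → D)
    (z : ∀ i, (Z.obj (op (a i))).obj (op (SimplexCategory.mk n)))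
    (hz : ∀ (b : D) (s : (Z.obj (op b)).obj (op (SimplexCategory.mk n))),
      ∃! f : Σ i, b ⟶ a i, (Z.map f.2.op).app _ (z f.1) = s) :
    Projective (Z ⋙ (SSet.chainComplexFunctor (ModuleCat.{u} R)).obj (ModuleCat.of R R) ⋙
      HomologicalComplex.eval _ _ n) := by
  constructor
  intro A B f e he
  have hp : Projective (ModuleCat.of R R) :=
    ModuleCat.projective_of_free (Module.Basis.singleton Unit R)
  have he' : ∀ b, Epi (e.app b) := fun b => inferInstance
  -- lift the images of the generators, and extend along their unique translates
  let y : ∀ i, ModuleCat.of R R ⟶ A.obj (op (a i)) := fun i =>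
    Projective.factorThru (SSet.ιChainComplex _ (z i) ≫ f.app (op (a i))) (e.app (op (a i)))
  have hy : ∀ i, y i ≫ e.app (op (a i)) = SSet.ιChainComplex _ (z i) ≫ f.app (op (a i)) :=
    fun i => Projective.factorThru_comp _ _
  have hf : ∀ {b b' : Dᵒᵖ} (g : b ⟶ b') (s : (Z.obj b).obj (op (SimplexCategory.mk n))),
      SSet.ιChainComplex (Z.obj b') ((Z.map g).app _ s) ≫ f.app b' =
        SSet.ιChainComplex (Z.obj b) s ≫ f.app b ≫ B.map g := fun {b b'} g s =>
    (SSet.ι_chainComplexMap_f_assoc _ _ (Z.map g) (ModuleCat.of R R) s _).symm.trans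
      (congrArg (SSet.ιChainComplex (Z.obj b) s ≫ ·) (f.naturality g))
  choose φ hφ hφ' using hz
  let l : ∀ b : Dᵒᵖ, ((Z.obj b).chainComplex (ModuleCat.of R R)).X n ⟶ A.obj b := fun b =>
    Cofan.IsColimit.desc ((Z.obj b).isColimitChainComplexXCofan (ModuleCat.of R R) n)
      fun s => y (φ b.unop s).1 ≫ A.map (φ b.unop s).2.op
  have hl : ∀ b s, SSet.ιChainComplex (Z.obj b) s ≫ l b =
      y (φ b.unop s).1 ≫ A.map (φ b.unop s).2.op := fun b s =>
    Cofan.IsColimit.fac ((Z.obj b).isColimitChainComplexXCofan (ModuleCat.of R R) n) _ s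
  have hl' : ∀ b i (g : b ⟶ a i), SSet.ιChainComplex (Z.obj (op b)) ((Z.map g.op).app _ (z i)) ≫
      l (op b) = y i ≫ A.map g.op := fun b i g => by
    have h := hφ' b _ ⟨i, g⟩ rfl
    rw [hl, ← h]
  refine ⟨{ app := l, naturality := fun b b' g => ?_ }, ?_⟩
  · refine SSet.chainComplex_hom_ext fun s => ?_
    refine (SSet.ι_chainComplexMap_f_assoc _ _ (Z.map g) (ModuleCat.of R R) s _).trans ?_
    refine Eq.trans ?_ ((congrArg (· ≫ A.map g) (hl b s)).symm.trans (Category.assoc _ _ _))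
    have h := hl' b'.unop (φ b.unop s).1 (g.unop ≫ (φ b.unop s).2)
    rw [op_comp, Z.map_comp, A.map_comp, ← Category.assoc] at h
    refine Eq.trans ?_ h
    congr 2
    exact congrArg ((Z.map g).app _) (hφ b.unop s).symm
  · ext b : 2
    refine SSet.chainComplex_hom_ext fun s => ?_
    obtain ⟨b⟩ := b
    rw [← hφ b s]
    refine (Category.assoc _ _ _).symm.trans ((congrArg (· ≫ e.app (op b)) (hl' b _ _)).trans ?_)
    refine Eq.trans ?_ (hf (φ b s).2.op _).symm
    rw [Category.assoc, e.naturality, ← Category.assoc, hy]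
    exact Category.assoc _ _ _

/-- The same for normalized chains. -/
theorem projective_normalizedChains_of_free {ι : Type*} (a : ι → D)
    (z : ∀ i, (Z.obj (op (a i))).obj (op (SimplexCategory.mk n)))
    (hz : ∀ (b : D) (s : (Z.obj (op b)).obj (op (SimplexCategory.mk n))),
      ∃! f : Σ i, b ⟶ a i, (Z.map f.2.op).app _ (z f.1) = s) :
    Projective (Z ⋙ SSet.normalizedChainComplexFunctorObj (ModuleCat.of R R) ⋙
      HomologicalComplex.eval _ _ n) := by
  have := projective_chains_of_free (R := R) Z n a z hz
  exact @Retract.projective _ _ _ _ ((normalizedChainsRetract (ModuleCat.of R R)).map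
    ((Functor.whiskeringRight _ _ _).obj (HomologicalComplex.eval _ _ n) ⋙
      (Functor.whiskeringLeft _ _ _).obj Z)) this

end

/-! ### Projectivity of the chains of the equivariant universal cover -/

section

/-- The contraction of the standard simplex to a point along line segments. -/
noncomputable def stdSimplexContraction {m : Type} [Fintype m] (v₀ : stdSimplex ℝ m) :
    C(stdSimplex ℝ m × I, stdSimplex ℝ m) where
  toFun x := ⟨(1 - (x.2 : ℝ)) • v₀.1 + (x.2 : ℝ) • x.1.1,
    convex_stdSimplex ℝ m v₀.2 x.1.2 (by linarith [x.2.2.2]) x.2.2.1 (by ring)⟩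
  continuous_toFun := by fun_prop

variable (G X : Type u) [Group G] [MulAction G X] [TopologicalSpace X] [ContinuousConstSMul G X]
variable (R : Type u) [CommRing R]

/-- The chains of the equivariant universal cover are projective in each degree: the `0`-th vertex
and the contraction to it along segments show that the singular simplices form a free presheaf. -/
theorem projective_eqChains_X
    (hX : ∀ (H : Subgroup G) (x : MulAction.fixedPoints H X), HasUnivCover (pathComponent x))
    (n : ℕ) : Projective ((eqChains G X R).X n) := by
  let v₀ : stdSimplex ℝ (Fin (n + 1)) := ⟨_, single_mem_stdSimplex ℝ (0 : Fin (n + 1))⟩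
  have h0 : ∀ t, stdSimplexContraction v₀ (t, 0) = v₀ := fun t => Subtype.ext (by
    simp [stdSimplexContraction])
  have h1 : ∀ t, stdSimplexContraction v₀ (t, 1) = t := fun t => Subtype.ext (by
    simp [stdSimplexContraction])
  have hv : ∀ s, stdSimplexContraction v₀ (v₀, s) = v₀ := fun s => Subtype.ext (by
    simp [stdSimplexContraction, ← add_smul])
  refine projective_normalizedChains_of_free (R := R) (eqUnivCover G X ⋙ TopCat.toSSet) n
    (ι := MulAction.orbitRel.Quotient G C(stdSimplex ℝ (Fin (n + 1)), X))
    (fun i => mapObj v₀ i.out)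
    (fun i => ((eqUnivCover G X).obj (op (mapObj v₀ i.out))).toSSetObjEquiv
      (op (SimplexCategory.mk n)) |>.symm (mapLift v₀ (stdSimplexContraction v₀) h0 i.out))
    fun b s => ?_
  have key := existsUnique_act_comp_mapLift v₀ _ h0 hX h1 hv b
    (((eqUnivCover G X).obj (op b)).toSSetObjEquiv (op (SimplexCategory.mk n)) s)
  refine (existsUnique_congr fun f => ?_).1 key
  rw [← (((eqUnivCover G X).obj (op b)).toSSetObjEquiv
    (op (SimplexCategory.mk n))).apply_eq_iff_eq]
  exact ⟨fun h => ContinuousMap.ext h, fun h t => DFunLike.congr_fun h t⟩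

end

/-! ### The equivariant Eilenberg spectral sequences -/

section
variable (G X : Type u) [Group G] [MulAction G X] [TopologicalSpace X] [ContinuousConstSMul G X]
variable (R : Type u) [CommRing R]

/-- The homology of the chains of the equivariant universal cover is computed levelwise. -/
noncomputable def eqChainsHomologyIso (q : ℕ) :
    (eqChains G X R).homology q ≅ eqCoverHomology G X R q :=
  (NatIso.ofComponents (fun a => ((eqChains G X R).sc q).mapHomologyIso
    ((evaluation _ (ModuleCat.{u} R)).obj a)) fun {a b} f => by
      have := NatTrans.app_homology ((evaluation (FundCat G X)ᵒᵖ (ModuleCat.{u} R)).map f)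
        ((eqChains G X R).sc q)
      exact (Iso.hom_inv_id_assoc (((eqChains G X R).sc q).mapHomologyIso
        ((evaluation _ (ModuleCat.{u} R)).obj a)) _).symm.trans (congrArg (_ ≫ ·) this.symm) :
    eqCoverHomology G X R q ≅ _).symm

lemma isQuadrantShape_down :
    IsQuadrantShape (ComplexShape.down ℕ) (fun r => (-r, r - 1)) (fun p => (p : ℤ)) :=
  ⟨1, .inl rfl, fun i j => by rw [ComplexShape.down_Rel]; lia, fun p => (one_mul _).symm,
    fun r => by rw [one_mul, one_mul]⟩

lemma isQuadrantShape_up :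
    IsQuadrantShape (ComplexShape.up ℕ) (fun r => (r, 1 - r)) (fun p => -(p : ℤ)) :=
  ⟨-1, .inr rfl, fun i j => by rw [ComplexShape.up_Rel]; lia, fun p => (neg_one_mul _).symm,
    fun r => by ext <;> simp⟩

end

theorem mainTheorem1 {G X : Type u} [Group G] [TopologicalSpace X] [MulAction G X]
    [ContinuousConstSMul G X]
    (hX : ∀ (H : Subgroup G) (x : MulAction.fixedPoints H X), HasUnivCover (pathComponent x))
    {R : Type u} [CommRing R] :
    (∀ (M : FundCat G X ⥤ ModuleCat.{u} R) (P : ProjectiveResolution M),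
      ∃ φ : ∀ n, (eqTensorTotal G X P.complex).homology n ≅ eqHomology G X M n,
        (∃ E : QuadrantSS R (fun r => (-r, r - 1)),
          Nonempty (IsFiltrationSS E (eqTensorTotal G X P.complex)
            (fun k => eqTensorTotalSpan G X P.complex (fun _ j => (j : ℤ) ≤ k))
            (fun p => (p : ℤ))) ∧
          (∀ p q : ℕ, Nonempty ((E.page 2).X (p, q) ≅ torFunctor (eqCoverHomology G X R q) M p)) ∧
          Nonempty (ConvergesTo E (eqHomology G X M)
            (fun k n => (filtHomology (eqTensorTotal G X P.complex)
              (fun k => eqTensorTotalSpan G X P.complex (fun _ j => (j : ℤ) ≤ k)) k n).map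
                (φ n).hom.hom)
            (fun p => (p : ℤ)))) ∧
        (∃ E : QuadrantSS R (fun r => (-r, r - 1)),
          Nonempty (IsFiltrationSS E (eqTensorTotal G X P.complex)
            (fun k => eqTensorTotalSpan G X P.complex (fun i _ => (i : ℤ) ≤ k))
            (fun p => (p : ℤ))) ∧
          (∀ p : ℕ, Nonempty ((E.page 2).X (p, 0) ≅ eqHomology G X M p)) ∧
          (∀ p q : ℕ, q ≠ 0 → Limits.IsZero ((E.page 2).X (p, q))) ∧
          Nonempty (ConvergesTo E (eqHomology G X M)
            (fun k n => (filtHomology (eqTensorTotal G X P.complex)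
              (fun k => eqTensorTotalSpan G X P.complex (fun i _ => (i : ℤ) ≤ k)) k n).map
                (φ n).hom.hom)
            (fun p => (p : ℤ))))) ∧
    (∀ (N : (FundCat G X)ᵒᵖ ⥤ ModuleCat.{u} R) (J : InjectiveResolution N),
      ∃ φ : ∀ n, (eqHomTotal G X J.cocomplex).homology n ≅ eqCohomology G X N n,
        (∃ E : QuadrantSS R (fun r => (r, 1 - r)),
          Nonempty (IsFiltrationSS E (eqHomTotal G X J.cocomplex)
            (fun k => eqHomTotalSpan G X J.cocomplex (fun _ j => -(j : ℤ) ≤ k))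
            (fun p => -(p : ℤ))) ∧
          (∀ p q : ℕ, Nonempty ((E.page 2).X (p, q) ≅ extFunctor (eqCoverHomology G X R q) N p)) ∧
          Nonempty (ConvergesTo E (eqCohomology G X N)
            (fun k n => (filtHomology (eqHomTotal G X J.cocomplex)
              (fun k => eqHomTotalSpan G X J.cocomplex (fun _ j => -(j : ℤ) ≤ k)) k n).map
                (φ n).hom.hom)
            (fun p => -(p : ℤ)))) ∧
        (∃ E : QuadrantSS R (fun r => (r, 1 - r)),
          Nonempty (IsFiltrationSS E (eqHomTotal G X J.cocomplex)
            (fun k => eqHomTotalSpan G X J.cocomplex (fun i _ => -(i : ℤ) ≤ k))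
            (fun p => -(p : ℤ))) ∧
          (∀ p : ℕ, Nonempty ((E.page 2).X (p, 0) ≅ eqCohomology G X N p)) ∧
          (∀ p q : ℕ, q ≠ 0 → Limits.IsZero ((E.page 2).X (p, q))) ∧
          Nonempty (ConvergesTo E (eqCohomology G X N)
            (fun k n => (filtHomology (eqHomTotal G X J.cocomplex)
              (fun k => eqHomTotalSpan G X J.cocomplex (fun i _ => -(i : ℤ) ≤ k)) k n).map
                (φ n).hom.hom)
            (fun p => -(p : ℤ))))) := by
  have hC := projective_eqChains_X G X R hX
  constructor
  · intro M P
    have h₁ : ∀ p, ((functorTensor R).obj ((eqChains G X R).X p)).PreservesHomology := fun p =>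
      functorTensor_obj_preservesHomology _
    have h₂ : ∀ p, ((functorTensor R).flip.obj (P.complex.X p)).PreservesHomology := fun p =>
      functorTensor_flip_obj_preservesHomology _
    obtain ⟨φ, ⟨E, hE, e, hc⟩, h⟩ := exists_spectralSequences_mapBifunctor (functorTensor R)
      (eqChains G X R) P.complex isQuadrantShape_down M
      (isoOfQuasiIsoAt P.π 0 ≪≫ HomologicalComplex.singleObjHomologySelfIso _ _ _)
      (fun q hq => by
        obtain ⟨q, rfl⟩ := Nat.exists_eq_succ_of_ne_zero hq
        exact (P.complex_exactAt_succ q).isZero_homology)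
    refine ⟨φ, ⟨E, hE, fun p q => ?_, hc⟩, h⟩
    obtain ⟨e⟩ := e p q
    exact ⟨e ≪≫ (HomologicalComplex.homologyFunctor _ _ p).mapIso
      ((NatIso.mapHomologicalComplex ((functorTensor R).mapIso (eqChainsHomologyIso G X R q)) _).app
        P.complex) ≪≫ (P.isoLeftDerivedObj _ p).symm⟩
  · intro N J
    -- `eqChainsOp` is the complex of chains in the opposite category, with the same objects
    have h₁ : ∀ p, ((linearCoyoneda R ((FundCat G X)ᵒᵖ ⥤ ModuleCat.{u} R)).obj
        ((eqChainsOp G X R).X p)).PreservesHomology := fun p =>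
      linearCoyoneda_obj_preservesHomology R ((eqChains G X R).X p)
    have h₂ : ∀ p, ((linearCoyoneda R ((FundCat G X)ᵒᵖ ⥤ ModuleCat.{u} R)).flip.obj
        (J.cocomplex.X p)).PreservesHomology := fun p =>
      linearCoyoneda_flip_obj_preservesHomology R _
    obtain ⟨φ, ⟨E, hE, e, hc⟩, h⟩ := exists_spectralSequences_mapBifunctor
      (linearCoyoneda R ((FundCat G X)ᵒᵖ ⥤ ModuleCat.{u} R))
      (eqChainsOp G X R) J.cocomplex isQuadrantShape_up N
      ((isoOfQuasiIsoAt J.ι 0).symm ≪≫ HomologicalComplex.singleObjHomologySelfIso _ _ _)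
      (fun q hq => by
        obtain ⟨q, rfl⟩ := Nat.exists_eq_succ_of_ne_zero hq
        exact (J.cocomplex_exactAt_succ q).isZero_homology)
    refine ⟨φ, ⟨E, hE, fun p q => ?_, hc⟩, h⟩
    obtain ⟨e⟩ := e p q
    have i : (eqChainsOp G X R).homology q ≅ op (eqCoverHomology G X R q) :=
      (eqChains G X R).homologyOp q ≪≫ (eqChainsHomologyIso G X R q).symm.op
    exact ⟨e ≪≫ (HomologicalComplex.homologyFunctor _ _ p).mapIso
      ((NatIso.mapHomologicalComplex ((linearCoyoneda R _).mapIso i) _).app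
        J.cocomplex) ≪≫ (J.isoRightDerivedObj _ p).symm⟩
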